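/- Let $n\ge 3$, let $y\in\mathbb R^n$ with $a=|y|>0$, and put $\hat y=y/a$. For $x\in\mathbb R^n$ let $z=x+iy$, $z^2=\sum_j z_j^2$, and let $\gamma(z)=\sqrt{z^2}=p+iq$ with the branch $p=\operatorname{Re}\gamma\ge 0$. Let $\omega_n=2\pi^{n/2}/\Gamma(n/2)$, $A_n=\omega_n/\omega_{n-1}$, and $$\phi(z)=\frac{1}{\omega_n}\,\frac{\gamma(z)^{2-n}}{2-n},\qquad \phi_\varepsilon(z)=\begin{cases}\phi(z),& p>\varepsilon,\\ 0,& p\le\varepsilon,\end{cases}\qquad \varepsilon>0 .$$ Let $C^{n-2}(\mathbb R^n)$ be the space of complex-valued $C^{n-2}$ functions on $\mathbb R^n$; a linear functional $L$ on it is called bounded if there are a compact set $K$ and a constant $C$ with $|L(f)|\le C\max_{j\le n-2}\sup_K\|D^jf\|$ for all $f$. For real $p$ and $|q|\le a$ put $\rho=\sqrt{(a^2+p^2)(a^2-q^2)}/a$ and $\zeta=pq/a$ (oblate spheroidal coordinates), and for $f\in C^{n-2}(\mathbb R^n)$ let $$\bar f(p+iq)=\int_{S^{n-2}}f(\rho\sigma+\zeta\hat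 y)\,d\sigma,\qquad F(\gamma)=(a^2-q^2)^{\frac{n-3}2}\Big[\bar f(\gamma)+\frac{\gamma\,\partial_p\bar f(\gamma)}{n-2}\Big],\qquad \gamma=p+iq,$$ where $S^{n-2}$ is the unit sphere of the hyperplane $y^\perp$ and $d\sigma$ its normalized surface measure. Let $$T_m=\frac1{m!}\,\partial_q^mF(iq)\Big|_{q=0},\qquad V_n(f)=\frac{i^{1-n}a}{A_n}\int_{-a}^{a}\frac{F(iq)-\sum_{m=0}^{n-2}T_mq^m}{q^{n-1}}\,dq .$$ Then: 1. For every $\varepsilon>0$ the distributional Laplacian $\Delta_x\phi_\varepsilon(x+iy)$, that is $f\mapsto\int_{\mathbb R^n}\phi_\varepsilon(x+iy)\,\Delta f(x)\,dx$ on $C_c^\infty(\mathbb R^n)$, extends uniquely to a bounded linear functional $\tilde\delta_\varepsilon$ on $C^{n-2}(\mathbb R^n)$ (the regularized source). 2. For every $f\in C^{n-2}(\mathbb R^n)$ the function $q\mapsto F(iq)$ is $C^{n-3}$ near $q=0$ and its $(n-3)$-rd derivative is differentiable at $q=0$, so that $T_0,\dots,T_{n-2}$ exist. 3. For every $f\in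 C^{n-2}(\mathbb R^n)$ the limit $\langle\tilde\delta,f\rangle=\lim_{\varepsilon\to0^+}\langle\tilde\delta_\varepsilon,f\rangle$ exists, and $\tilde\delta$ (the singular source, the meaning given to $\Delta\phi$) is a bounded linear functional on $C^{n-2}(\mathbb R^n)$. 4. If $n=2k+2\ge4$ is even, then for every $f\in C^{n-2}(\mathbb R^n)$ $$\langle\tilde\delta,f\rangle=\frac{\pi a}{A_n}(-1)^k\,T_{2k}.$$ 5. If $n=2k+3\ge3$ is odd, then for every $f\in C^{n-2}(\mathbb R^n)$ the integral in $V_n(f)$ converges absolutely and $$\langle\tilde\delta,f\rangle=V_n(f)+\frac{2(-1)^k}{A_n}\sum_{l=0}^{k}\frac{a^{2l-2k}\,T_{2l}}{2k-2l+1}.$$ -/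

import Mathlib

open MeasureTheory Filter Topology
open scoped ContDiff

noncomputable section

namespace ComplexSource

/-- Euclidean space `ℝⁿ`. -/
abbrev Rn (n : ℕ) : Type := EuclideanSpace ℝ (Fin n)

/-- The point `z = x + i y` of `ℂⁿ`. -/
def cpoint {n : ℕ} (x y : Rn n) : Fin n → ℂ := fun j => (x j : ℂ) + Complex.I * (y j : ℂ)

/-- The complex length `γ(z) = √(z²)`, where `z² = ∑ zⱼ²`; the principal branch has `Re γ ≥ 0`. -/
def complexLength {n : ℕ} (z : Fin n → ℂ) : ℂ := (∑ j, z j ^ 2) ^ (1 / 2 : ℂ)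

/-- The area `ωₙ = 2 π^{n/2} / Γ(n/2)` of the unit sphere of `ℝⁿ`. -/
def sphereArea (n : ℕ) : ℝ := 2 * Real.pi ^ ((n : ℝ) / 2) / Real.Gamma ((n : ℝ) / 2)

/-- `Aₙ = ωₙ / ωₙ₋₁`. -/
def areaRatio (n : ℕ) : ℝ := sphereArea n / sphereArea (n - 1)

/-- The holomorphic potential `φ(z) = γ(z)^{2-n} / (ωₙ (2-n))`. -/
def potential {n : ℕ} (z : Fin n → ℂ) : ℂ :=
  1 / (sphereArea n : ℂ) * (complexLength z ^ ((2 : ℤ) - n) / (2 - (n : ℂ)))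

open Classical in
/-- The regularized potential `φ_ε(z) = θ(p - ε) φ(z)`, where `p = Re γ(z)`. -/
def regPotential {n : ℕ} (ε : ℝ) (z : Fin n → ℂ) : ℂ :=
  if ε < (complexLength z).re then potential z else 0

/-- The space `C^m(ℝⁿ)` of complex-valued functions (no condition at infinity). -/
def CSpace (n m : ℕ) : Submodule ℂ (Rn n → ℂ) where
  carrier := {f | ContDiff ℝ m f}
  add_mem' := fun {f g} (hf : ContDiff ℝ m f) (hg : ContDiff ℝ m g) =>
    (show ContDiff ℝ m (f + g) from hf.add hg)
  zero_mem' := (contDiff_const : ContDiff ℝ m (fun _ : Rn n => (0 : ℂ)))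
  smul_mem' := fun c f (hf : ContDiff ℝ m f) =>
    (show ContDiff ℝ m (c • f) from hf.const_smul c)

/-- Boundedness (continuity) of a linear functional on `C^m(ℝⁿ)`: it is controlled by the
suprema of the derivatives of order at most `m` over some compact set. -/
def IsBoundedFunctional {n m : ℕ} (L : CSpace n m →ₗ[ℂ] ℂ) : Prop :=
  ∃ K : Set (Rn n), IsCompact K ∧ ∃ C : ℝ, ∀ (f : CSpace n m) (M : ℝ), 0 ≤ M →
    (∀ j ≤ m, ∀ x ∈ K, ‖iteratedFDeriv ℝ j (f : Rn n → ℂ) x‖ ≤ M) → ‖L f‖ ≤ C * M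

/-- `L` is the regularized source `Δφ_ε(· + i y)`, as a functional on `C^{n-2}(ℝⁿ)`: it is
bounded, and on smooth compactly supported functions it is the distributional Laplacian of
`x ↦ φ_ε(x + i y)`. -/
def IsRegularizedSource {n : ℕ} (y : Rn n) (ε : ℝ) (L : CSpace n (n - 2) →ₗ[ℂ] ℂ) : Prop :=
  IsBoundedFunctional L ∧
    ∀ f : CSpace n (n - 2), ContDiff ℝ ∞ (f : Rn n → ℂ) → HasCompactSupport (f : Rn n → ℂ) →
      L f = ∫ x : Rn n, regPotential ε (cpoint x y) * Laplacian.laplacian (f : Rn n → ℂ) x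

/-- `L` is the singular source: the limit, as `ε → 0⁺`, of the regularized sources on every
function of class `C^{n-2}`. -/
def IsSingularSource {n : ℕ} (y : Rn n) (L : CSpace n (n - 2) →ₗ[ℂ] ℂ) : Prop :=
  ∃ Lreg : ℝ → (CSpace n (n - 2) →ₗ[ℂ] ℂ),
    (∀ ε : ℝ, 0 < ε → IsRegularizedSource y ε (Lreg ε)) ∧
      ∀ f : CSpace n (n - 2), Tendsto (fun ε => Lreg ε f) (𝓝[>] 0) (𝓝 (L f))

/-- The cylindrical radius `ρ = √((a² + p²)(a² - q²)) / a` in oblate spheroidal coordinates. -/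
def rhoCoord (a p q : ℝ) : ℝ := Real.sqrt ((a ^ 2 + p ^ 2) * (a ^ 2 - q ^ 2)) / a

/-- The axial coordinate `ζ = p q / a` in oblate spheroidal coordinates. -/
def zetaCoord (a p q : ℝ) : ℝ := p * q / a

/-- The spherical mean of `f` in oblate spheroidal coordinates: the average of `f(ρ σ + ζ ŷ)`
over the unit sphere `S^{n-2}` of the hyperplane orthogonal to `y`. -/
def sphMean {n : ℕ} (y : Rn n) (f : Rn n → ℂ) (p q : ℝ) : ℂ :=
  ⨍ σ, f (rhoCoord ‖y‖ p q • ((σ : (ℝ ∙ y)ᗮ) : Rn n) + (zetaCoord ‖y‖ p q / ‖y‖) • y)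
    ∂((volume : Measure (ℝ ∙ y)ᗮ).toSphere)

/-- The weighted spherical mean `F(γ) = (a² - q²)^ν [f̄(γ) + γ ∂ₚf̄(γ) / (n - 2)]` with
`γ = p + i q`, `a = |y|` and `ν = (n - 3) / 2`. -/
def weightedMean {n : ℕ} (y : Rn n) (f : Rn n → ℂ) (p q : ℝ) : ℂ :=
  (((‖y‖ ^ 2 - q ^ 2) ^ (((n : ℝ) - 3) / 2) : ℝ) : ℂ) *
    (sphMean y f p q +
      ((p : ℂ) + Complex.I * (q : ℂ)) * deriv (fun s : ℝ => sphMean y f s q) p / ((n : ℂ) - 2))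

/-- The Taylor coefficient `T_m` at `q = 0` of `q ↦ F(i q)`. -/
def taylorT {n : ℕ} (y : Rn n) (f : Rn n → ℂ) (m : ℕ) : ℂ :=
  iteratedDeriv m (fun q : ℝ => weightedMean y f 0 q) 0 / (m.factorial : ℂ)

/-- The integrand `(F(i q) - ∑_{m ≤ n-2} T_m q^m) / q^{n-1}` of `Vₙ(f)`. -/
def remainderQuot {n : ℕ} (y : Rn n) (f : Rn n → ℂ) (q : ℝ) : ℂ :=
  (weightedMean y f 0 q - ∑ m ∈ Finset.range (n - 1), (q : ℂ) ^ m * taylorT y f m)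
    / (q : ℂ) ^ (n - 1)

/-- `Vₙ(f) = (i^{1-n} a / Aₙ) ∫_{-a}^{a} (F(i q) - ∑_{m ≤ n-2} T_m q^m) / q^{n-1} dq`. -/
def interiorTerm {n : ℕ} (y : Rn n) (f : Rn n → ℂ) : ℂ :=
  Complex.I ^ ((1 : ℤ) - n) * (‖y‖ : ℂ) / (areaRatio n : ℂ) *
    ∫ q in (-‖y‖)..‖y‖, remainderQuot y f q

end ComplexSource

end

/-! ### Model integrals of `q ^ m / γ ^ N` and their limits -/

noncomputable section

namespace ComplexSource

/-! For `p > 0` the potential is smooth and harmonic, since `∑ z_j² = γ²`. Insert a cutoff `ψ(p)`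
and integrate by parts: all that survives is `ψ'(p)` times the flux of `φ` and `f` through the level
sets of `p` (`integral_cut_potential_mul_laplacian`). The quantities `p`, `q` and `|∇p|²` are
invariant under rotation about `y`, so passing to cylindrical and then spheroidal coordinates
averages `f` and turns the flux into an explicit factor times `∫ F(p + iq) / γ^(n-1) dq`
(`integral_cut_eq`). When `ψ` shrinks to the step at `ε`, the source becomes this expression at `p =
ε` (`integral_regPotential_mul_laplacian`). It involves only first derivatives of `f`, hence is
bounded on `C^(n-2)`. Uniqueness is density of test functions (`eq_of_eqOn_testFunctions`).

The limit `ε → 0` needs `F` to be a polynomial in `(p, q)` up to `O(|γ|^(n-1))`, whereas `F`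
contains a derivative of a function that is only `C^(n-2)`. The point is that near `γ = 0` the
cylindrical coordinates are smooth functions of `γ²`. A `C^m` function of them therefore has a
polynomial expansion of order `2m`, and the term `γ ∂_p f̄` carries a quadratic factor `γp` or `γq`
that pays for the lost derivative (`exists_unifExp_bigF`). Divided by `γ^(n-1)`, the remainder is
bounded and dominated convergence applies. The polynomial part reduces to the integrals of `q^m /
γ^N`, computed by recursion and antiderivatives. All estimates are linear in the `C^(n-2)` bound of
`f`, so the limit is a bounded functional (`exists_tendsto_integral_div_gam`).

On `p = 0` the low coefficients of the polynomial are the Taylor coefficients `T_m`, by Taylor's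
theorem with Peano remainder (`bigF_axis_regular`, `taylor_peano`, `limit_eq_taylor`). As `F(iq)` is
even, odd `T_m` vanish. For even `n` the regularized integrand is odd, and among the model integrals
only the logarithmic one survives, whose value is `π` up to sign (`monoLim_odd`). For odd `n` the
model integrals are rational in `a` (`monoLim_even`). -/

/-- The point `p + i q`. -/
def gam (p q : ℝ) : ℂ := (p : ℂ) + Complex.I * (q : ℂ)

lemma gam_re (p q : ℝ) : (gam p q).re = p := by simp [gam]
lemma gam_im (p q : ℝ) : (gam p q).im = q := by simp [gam]

lemma gam_ne_zero_of_pos {p : ℝ} (hp : 0 < p) (q : ℝ) : gam p q ≠ 0 := by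
  intro h
  have := congrArg Complex.re h
  rw [gam_re] at this
  simp at this
  exact hp.ne' this

lemma continuous_gam : Continuous (fun x : ℝ × ℝ => gam x.1 x.2) := by
  unfold gam; fun_prop

lemma hasDerivAt_gam (p q : ℝ) : HasDerivAt (fun q : ℝ => gam p q) Complex.I q := by
  unfold gam
  have := ((Complex.ofRealCLM.hasDerivAt (x := q)).const_mul Complex.I).const_add (p : ℂ)
  simpa using this

/-- The integral of `q ^ m / γ ^ N` over `[-a, a]`. -/
def monoInt (a : ℝ) (m N : ℕ) (p : ℝ) : ℂ := ∫ q in (-a)..a, (q : ℂ) ^ m / gam p q ^ N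

/-- The limit of `monoInt a m N p` as `p → 0⁺`. -/
def monoLim (a : ℝ) : ℕ → ℕ → ℂ
  | m, 0 => ∫ q in (-a)..a, (q : ℂ) ^ m
  | 0, 1 => Real.pi
  | 0, (N + 2) => ((Complex.I * a) ^ (-(N + 1 : ℤ)) - (-(Complex.I * a)) ^ (-(N + 1 : ℤ))) /
      (Complex.I * (-(N + 1 : ℤ)))
  | (m + 1), (N + 1) => -Complex.I * monoLim a m N

lemma continuous_mono_div {p : ℝ} (hp : 0 < p) (m N : ℕ) :
    Continuous fun q : ℝ => (q : ℂ) ^ m / gam p q ^ N := by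
  have := continuous_gam
  refine Continuous.div (by fun_prop) ?_ fun q => pow_ne_zero _ (gam_ne_zero_of_pos hp q)
  exact (this.comp (by fun_prop : Continuous fun q : ℝ => (p, q))).pow N

/-- Writing `q = -i (γ - p)` trades one factor `q` for one factor `γ`; the error term carries a
factor `p` and disappears in the limit. -/
lemma monoInt_succ_succ (a : ℝ) (m N : ℕ) {p : ℝ} (hp : 0 < p) :
    monoInt a (m + 1) (N + 1) p =
      -Complex.I * (monoInt a m N p - p * monoInt a m (N + 1) p) := by
  unfold monoInt
  rw [← intervalIntegral.integral_const_mul, ← intervalIntegral.integral_sub,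
    ← intervalIntegral.integral_const_mul]
  · congr 1 with q
    have h := gam_ne_zero_of_pos hp q
    have hq : (q : ℂ) = -Complex.I * (gam p q - p) := by
      simp [gam, ← mul_assoc]
    rw [pow_succ, pow_succ (gam p q) N, mul_div_mul_comm, div_mul_eq_div_div]
    have h1 : (q : ℂ) / gam p q = -Complex.I * (1 - p / gam p q) := by
      rw [div_eq_iff h]; nth_rw 1 [hq]; field_simp
    rw [h1]
    ring
  · exact (continuous_mono_div hp m N).intervalIntegrable _ _
  · exact ((continuous_mono_div hp m (N + 1)).intervalIntegrable _ _).const_mul _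

/-- The segment `p + iq` stays in the right half plane, where `log γ / i` is an antiderivative. -/
lemma monoInt_zero_one (a : ℝ) {p : ℝ} (hp : 0 < p) :
    monoInt a 0 1 p = (Complex.log (gam p a) - Complex.log (gam p (-a))) / Complex.I := by
  unfold monoInt
  have hd : ∀ q : ℝ, HasDerivAt (fun q => Complex.log (gam p q) / Complex.I)
      ((q : ℂ) ^ 0 / gam p q ^ 1) q := by
    intro q
    have hs : gam p q ∈ Complex.slitPlane := Or.inl (by rw [gam_re]; exact hp)
    have := ((hasDerivAt_gam p q).clog_real hs).div_const Complex.I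
    refine this.congr_deriv ?_
    field_simp [gam_ne_zero_of_pos hp q, Complex.I_ne_zero]
  rw [intervalIntegral.integral_eq_sub_of_hasDerivAt (fun q _ => hd q)
    ((continuous_mono_div hp 0 1).intervalIntegrable _ _)]
  ring

lemma monoInt_zero_add_two (a : ℝ) (N : ℕ) {p : ℝ} (hp : 0 < p) :
    monoInt a 0 (N + 2) p = (gam p a ^ (-(N + 1 : ℤ)) - gam p (-a) ^ (-(N + 1 : ℤ))) /
      (Complex.I * (-(N + 1 : ℤ))) := by
  unfold monoInt
  have hN : ((N : ℂ) + 1) ≠ 0 := by exact_mod_cast Nat.succ_ne_zero N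
  have hd : ∀ q : ℝ, HasDerivAt (fun q => gam p q ^ (-(N + 1 : ℤ)) / (Complex.I * (-(N + 1 : ℤ))))
      ((q : ℂ) ^ 0 / gam p q ^ (N + 2)) q := by
    intro q
    have h := gam_ne_zero_of_pos hp q
    have := ((hasDerivAt_zpow (-(N + 1 : ℤ)) (gam p q) (Or.inl h)).comp q
      (hasDerivAt_gam p q)).div_const (Complex.I * (-(N + 1 : ℤ)))
    refine this.congr_deriv ?_
    have : (-(N + 1 : ℤ) - 1) = -((N + 2 : ℕ) : ℤ) := by push_cast; ring
    rw [this, zpow_neg, zpow_natCast]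
    push_cast
    field_simp
  rw [intervalIntegral.integral_eq_sub_of_hasDerivAt (fun q _ => hd q)
    ((continuous_mono_div hp 0 _).intervalIntegrable _ _)]
  ring

lemma tendsto_gam (q : ℝ) : Tendsto (fun p : ℝ => gam p q) (𝓝[>] 0) (𝓝 (Complex.I * q)) := by
  have h : Continuous fun p : ℝ => gam p q :=
    continuous_gam.comp (by fun_prop : Continuous fun p : ℝ => (p, q))
  have := (h.tendsto 0).mono_left (nhdsWithin_le_nhds (s := Set.Ioi 0))
  simpa [gam] using this

lemma tendsto_ofReal_zero : Tendsto (fun p : ℝ => (p : ℂ)) (𝓝[>] 0) (𝓝 0) := by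
  have := (Complex.continuous_ofReal.tendsto 0).mono_left (nhdsWithin_le_nhds (s := Set.Ioi 0))
  simpa using this

lemma monoInt_exponent_zero (a : ℝ) (m : ℕ) : monoInt a m 0 = fun _ => monoLim a m 0 := by
  funext p
  simp only [monoInt, pow_zero, div_one]
  cases m <;> rw [monoLim]

/-- `∫ q ^ m / (p + i q) ^ N dq` over `[-a, a]` has a limit as `p → 0⁺`. -/
lemma tendsto_monoInt {a : ℝ} (ha : 0 < a) (m N : ℕ) :
    Tendsto (monoInt a m N) (𝓝[>] 0) (𝓝 (monoLim a m N)) := by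
  induction m generalizing N with
  | zero =>
    match N with
    | 0 => rw [monoInt_exponent_zero]; exact tendsto_const_nhds
    | 1 =>
      -- The endpoints `±ia` avoid the cut, so the logarithms pass to the limit; their difference
      -- `iπ` is the origin of the `π` in even dimensions.
      have h1 : Complex.I * (a : ℂ) ∈ Complex.slitPlane := Or.inr (by simpa using ha.ne')
      have h2 : Complex.I * ((-a : ℝ) : ℂ) ∈ Complex.slitPlane := Or.inr (by simpa using ha.ne')
      have ht := (((tendsto_gam a).clog h1).sub ((tendsto_gam (-a)).clog h2)).div_const Complex.I
      have hv : (Complex.log (Complex.I * (a : ℂ)) - Complex.log (Complex.I * ((-a : ℝ) : ℂ))) /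
          Complex.I = monoLim a 0 1 := by
        have e1 : Complex.log (Complex.I * (a : ℂ)) = Real.log a + Complex.I * (Real.pi / 2) := by
          rw [mul_comm, Complex.log_ofReal_mul ha Complex.I_ne_zero, Complex.log_I]; ring
        have e2 : Complex.log (Complex.I * ((-a : ℝ) : ℂ)) =
            Real.log a - Complex.I * (Real.pi / 2) := by
          have : Complex.I * ((-a : ℝ) : ℂ) = (a : ℂ) * (-Complex.I) := by push_cast; ring
          rw [this, Complex.log_ofReal_mul ha (neg_ne_zero.2 Complex.I_ne_zero), Complex.log_neg_I]
          ring
        rw [e1, e2, monoLim]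
        field_simp
        ring
      rw [← hv]
      refine ht.congr' ?_
      filter_upwards [self_mem_nhdsWithin] with p hp
      rw [monoInt_zero_one a hp]
    | N + 2 =>
      have h1 : Complex.I * (a : ℂ) ≠ 0 := by simp [ha.ne']
      have h2 : Complex.I * ((-a : ℝ) : ℂ) ≠ 0 := by simp [ha.ne']
      have ht := (((tendsto_gam a).zpow₀ (-(N + 1 : ℤ)) (Or.inl h1)).sub
        ((tendsto_gam (-a)).zpow₀ (-(N + 1 : ℤ)) (Or.inl h2))).div_const
          (Complex.I * (-(N + 1 : ℤ)))
      have hv : Complex.I * ((-a : ℝ) : ℂ) = -(Complex.I * a) := by push_cast; ring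
      rw [hv] at ht
      rw [monoLim]
      refine ht.congr' ?_
      filter_upwards [self_mem_nhdsWithin] with p hp
      rw [monoInt_zero_add_two a N hp]
  | succ m ih =>
    match N with
    | 0 => rw [monoInt_exponent_zero]; exact tendsto_const_nhds
    | N + 1 =>
      -- The induction is over all exponents at once: `ih (N + 1)` keeps the error integral
      -- convergent, so its factor `p` kills it.
      have ht := ((ih N).sub (tendsto_ofReal_zero.mul (ih (N + 1)))).const_mul (-Complex.I)
      simp only [zero_mul, sub_zero] at ht
      rw [monoLim]
      refine ht.congr' ?_
      filter_upwards [self_mem_nhdsWithin] with p hp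
      rw [monoInt_succ_succ a m N hp]

lemma monoLim_add_left (a : ℝ) (m j N : ℕ) :
    monoLim a (m + j) (N + j) = (-Complex.I) ^ j * monoLim a m N := by
  induction j with
  | zero => simp
  | succ j ih => rw [← add_assoc, ← add_assoc, monoLim, ih]; ring

/-- Here `q ^ m / (i q) ^ N` has a removable singularity, so the limit may be taken under the
integral. This lets the high coefficients of an approximating polynomial be moved back into an
integral. -/
lemma monoLim_of_le (a : ℝ) {m N : ℕ} (h : N ≤ m) :
    monoLim a m N = ∫ q in (-a)..a, (q : ℂ) ^ m / (Complex.I * q) ^ N := by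
  obtain ⟨j, rfl⟩ := Nat.exists_eq_add_of_le' h
  have := monoLim_add_left a j N 0
  rw [zero_add] at this
  rw [this, monoLim, ← intervalIntegral.integral_const_mul]
  refine intervalIntegral.integral_congr_ae ?_
  have h0 : ∀ᵐ q : ℝ, q ≠ 0 := by simp [ae_iff]
  filter_upwards [h0] with q hq _
  have hq' : (q : ℂ) ≠ 0 := by exact_mod_cast hq
  rw [mul_pow, pow_add, ← Complex.inv_I, inv_pow]
  field_simp

open Polynomial in
/-- Integrals of bivariate polynomials against `γ ^ (-N)` converge as `p → 0⁺`. -/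
lemma tendsto_integral_evalEval {a : ℝ} (ha : 0 < a) (N : ℕ) (P : ℂ[X][X]) :
    Tendsto (fun p : ℝ => ∫ q in (-a)..a, evalEval (q : ℂ) (p : ℂ) P / gam p q ^ N) (𝓝[>] 0)
      (𝓝 (∑ m ∈ Finset.range ((P.coeff 0).natDegree + 1),
        (P.coeff 0).coeff m * monoLim a m N)) := by
  have hB : ∀ b : ℂ[X], ∀ p : ℝ, 0 < p → ∫ q in (-a)..a, b.eval (q : ℂ) / gam p q ^ N =
      ∑ m ∈ Finset.range (b.natDegree + 1), b.coeff m * monoInt a m N p := by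
    intro b p hp
    simp_rw [monoInt, ← intervalIntegral.integral_const_mul]
    rw [← intervalIntegral.integral_finsetSum]
    · congr 1 with q
      rw [eval_eq_sum_range, Finset.sum_div]
      exact Finset.sum_congr rfl fun m _ => by ring
    · exact fun m _ => ((continuous_mono_div hp m N).intervalIntegrable _ _).const_mul _
  have hintg : ∀ b : ℂ[X], ∀ p : ℝ, 0 < p →
      IntervalIntegrable (fun q : ℝ => b.eval (q : ℂ) / gam p q ^ N) volume (-a) a := by
    intro b p hp
    have : Continuous fun q : ℝ => b.eval (q : ℂ) * ((q : ℂ) ^ 0 / gam p q ^ N) :=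
      (b.continuous.comp Complex.continuous_ofReal).mul (continuous_mono_div hp 0 N)
    simpa [div_eq_mul_inv] using this.intervalIntegrable (μ := volume) (-a) a
  have hBlim : ∀ b : ℂ[X], Tendsto
      (fun p : ℝ => ∫ q in (-a)..a, b.eval (q : ℂ) / gam p q ^ N) (𝓝[>] 0)
      (𝓝 (∑ m ∈ Finset.range (b.natDegree + 1), b.coeff m * monoLim a m N)) := by
    intro b
    have := tendsto_finsetSum (Finset.range (b.natDegree + 1))
      (fun m _ => (tendsto_monoInt ha m N).const_mul (b.coeff m))
    refine this.congr' ?_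
    filter_upwards [self_mem_nhdsWithin] with p hp
    rw [hB b p hp]
  have hdec : ∀ p : ℝ, 0 < p → ∫ q in (-a)..a, evalEval (q : ℂ) (p : ℂ) P / gam p q ^ N =
      ∑ j ∈ Finset.range (P.natDegree + 1),
        (p : ℂ) ^ j * ∫ q in (-a)..a, (P.coeff j).eval (q : ℂ) / gam p q ^ N := by
    intro p hp
    simp_rw [← intervalIntegral.integral_const_mul]
    rw [← intervalIntegral.integral_finsetSum]
    · congr 1 with q
      rw [evalEval, eval_eq_sum_range (p := P), eval_finsetSum, Finset.sum_div]
      exact Finset.sum_congr rfl fun m _ => by simp; ring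
    · exact fun j _ => (hintg _ p hp).const_mul _
  have hlim := tendsto_finsetSum (Finset.range (P.natDegree + 1))
      (fun j _ => (tendsto_ofReal_zero.pow j).mul (hBlim (P.coeff j)))
  -- The outer variable of `P` is `p`, so every term but the coefficient of `p ^ 0` tends to zero.
  rw [Finset.sum_range_succ'] at hlim
  simp only [ne_eq, Nat.add_eq_zero_iff, one_ne_zero, and_false, not_false_eq_true, zero_pow,
    zero_mul, Finset.sum_const_zero, pow_zero, one_mul, zero_add] at hlim
  refine hlim.congr' ?_
  filter_upwards [self_mem_nhdsWithin] with p hp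
  rw [hdec p hp]

end ComplexSource

end

/-! ### Polynomial expansions at the origin, uniform in a family -/

noncomputable section

namespace ComplexSource

open Polynomial

/-- The value at `(p, q)` of a bivariate polynomial; the outer variable is `p`. -/
def ev (x : ℝ × ℝ) (P : ℂ[X][X]) : ℂ := evalEval (x.2 : ℂ) (x.1 : ℂ) P

@[simp] lemma ev_add (x : ℝ × ℝ) (P Q : ℂ[X][X]) : ev x (P + Q) = ev x P + ev x Q :=
  evalEval_add _ _ P Q
@[simp] lemma ev_mul (x : ℝ × ℝ) (P Q : ℂ[X][X]) : ev x (P * Q) = ev x P * ev x Q :=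
  evalEval_mul _ _ P Q
@[simp] lemma ev_sub (x : ℝ × ℝ) (P Q : ℂ[X][X]) : ev x (P - Q) = ev x P - ev x Q :=
  evalEval_sub _ _ P Q
@[simp] lemma ev_pow (x : ℝ × ℝ) (P : ℂ[X][X]) (k : ℕ) : ev x (P ^ k) = ev x P ^ k :=
  evalEval_pow _ _ P k
@[simp] lemma ev_CC (x : ℝ × ℝ) (c : ℂ) : ev x (C (C c)) = c := by simp [ev]
@[simp] lemma ev_X (x : ℝ × ℝ) : ev x X = x.1 := by simp [ev]
@[simp] lemma ev_CX (x : ℝ × ℝ) : ev x (C X) = x.2 := by simp [ev, evalEval]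
lemma ev_sum {κ : Type*} (s : Finset κ) (x : ℝ × ℝ) (P : κ → ℂ[X][X]) :
    ev x (∑ j ∈ s, P j) = ∑ j ∈ s, ev x (P j) :=
  map_sum (evalEvalRingHom (x.2 : ℂ) (x.1 : ℂ)) P s

lemma continuous_ev (P : ℂ[X][X]) : Continuous fun x => ev x P := by
  unfold ev evalEval
  simp_rw [eval_eq_sum_range (p := P), eval_finsetSum]
  refine continuous_finsetSum _ fun i _ => ?_
  simp only [eval_mul, eval_pow, eval_C]
  have := (P.coeff i).continuous
  fun_prop

lemma exists_bound_ev (P : ℂ[X][X]) (R : ℝ) : ∃ B, 0 ≤ B ∧ ∀ x, ‖x‖ ≤ R → ‖ev x P‖ ≤ B := by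
  obtain ⟨B, hB⟩ := (isCompact_closedBall (0 : ℝ × ℝ) R).exists_bound_of_continuousOn
    (continuous_ev P).continuousOn
  exact ⟨max B 0, le_max_right _ _, fun x hx => (hB x (by simpa using hx)).trans (le_max_left _ _)⟩

/-- `g` agrees with a polynomial up to `O(‖x‖ ^ N)` near the origin. -/
def HasPolyExp (N : ℕ) (g : ℝ × ℝ → ℂ) : Prop :=
  ∃ (P : ℂ[X][X]) (C δ : ℝ), 0 ≤ C ∧ 0 < δ ∧ ∀ x, ‖x‖ < δ → ‖g x - ev x P‖ ≤ C * ‖x‖ ^ N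

/-- Every member of the family `u` agrees near the origin with a linear combination of finitely
many fixed polynomials up to `O(‖x‖ ^ N)`, with coefficients and error controlled by `M`. -/
def UnifExp {I : Type*} (M : I → ℝ) (N : ℕ) (u : I → ℝ × ℝ → ℂ) : Prop :=
  ∃ (κ : Type) (_ : Fintype κ) (P : κ → ℂ[X][X]) (c : I → κ → ℂ) (C δ : ℝ), 0 ≤ C ∧ 0 < δ ∧
    (∀ i j, ‖c i j‖ ≤ C * M i) ∧
    ∀ i x, ‖x‖ < δ → ‖u i x - ∑ j, c i j * ev x (P j)‖ ≤ C * M i * ‖x‖ ^ N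

section
variable {I : Type*} {M : I → ℝ} {N : ℕ} {u v : I → ℝ × ℝ → ℂ}

lemma UnifExp.hasPolyExp (h : UnifExp M N u) (hM : ∀ i, 0 ≤ M i) (i : I) :
    HasPolyExp N (u i) := by
  obtain ⟨κ, _, P, c, C₀, δ, hC, hδ, -, h⟩ := h
  refine ⟨∑ j, C (C (c i j)) * P j, C₀ * M i, δ, mul_nonneg hC (hM i), hδ, fun x hx => ?_⟩
  simpa [ev_sum] using h i x hx

lemma UnifExp.mono {N' : ℕ} (h : UnifExp M N u) (hM : ∀ i, 0 ≤ M i) (hN : N' ≤ N) :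
    UnifExp M N' u := by
  obtain ⟨κ, _, P, c, C₀, δ, hC, hδ, hc, h⟩ := h
  refine ⟨κ, ‹_›, P, c, C₀, min δ 1, hC, by positivity, hc, fun i x hx => ?_⟩
  refine (h i x (hx.trans_le (min_le_left _ _))).trans ?_
  exact mul_le_mul_of_nonneg_left (pow_le_pow_of_le_one (norm_nonneg _)
    (hx.trans_le (min_le_right _ _)).le hN) (mul_nonneg hC (hM i))

lemma UnifExp.congr (h : UnifExp M N u) {δ' : ℝ} (hδ' : 0 < δ')
    (huv : ∀ i x, ‖x‖ < δ' → v i x = u i x) : UnifExp M N v := by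
  obtain ⟨κ, _, P, c, C₀, δ, hC, hδ, hc, h⟩ := h
  refine ⟨κ, ‹_›, P, c, C₀, min δ δ', hC, by positivity, hc, fun i x hx => ?_⟩
  rw [huv i x (hx.trans_le (min_le_right _ _))]
  exact h i x (hx.trans_le (min_le_left _ _))

lemma UnifExp.add (hu : UnifExp M N u) (hv : UnifExp M N v) (hM : ∀ i, 0 ≤ M i) :
    UnifExp M N fun i x => u i x + v i x := by
  obtain ⟨κ, _, P, c, C₀, δ, hC, hδ, hc, h⟩ := hu
  obtain ⟨κ', _, P', c', C', δ', hC', hδ', hc', h'⟩ := hv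
  refine ⟨κ ⊕ κ', inferInstance, Sum.elim P P', fun i => Sum.elim (c i) (c' i), C₀ + C',
    min δ δ', by positivity, by positivity, ?_, fun i x hx => ?_⟩
  · rintro i (j | j)
    · exact (hc i j).trans (mul_le_mul_of_nonneg_right (by linarith) (hM i))
    · exact (hc' i j).trans (mul_le_mul_of_nonneg_right (by linarith) (hM i))
  · rw [Fintype.sum_sum_type]
    have h1 := h i x (hx.trans_le (min_le_left _ _))
    have h2 := h' i x (hx.trans_le (min_le_right _ _))
    simp only [Sum.elim_inl, Sum.elim_inr]
    calc _ = ‖(u i x - ∑ j, c i j * ev x (P j)) + (v i x - ∑ j, c' i j * ev x (P' j))‖ := by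
          congr 1; ring
      _ ≤ _ := norm_add_le _ _
      _ ≤ C₀ * M i * ‖x‖ ^ N + C' * M i * ‖x‖ ^ N := add_le_add h1 h2
      _ = _ := by ring

/-- A polynomial factor vanishing to order `r` raises the order of the error by `r`; the factors
`γp` and `γq` of `F` are used in this way with `r = 2`. -/
lemma UnifExp.mul_poly (hu : UnifExp M N u) (hM : ∀ i, 0 ≤ M i) (Q : ℂ[X][X]) {r : ℕ} {B : ℝ}
    (hB : 0 ≤ B) (hQ : ∀ x, ‖ev x Q‖ ≤ B * ‖x‖ ^ r) :
    UnifExp M (N + r) fun i x => ev x Q * u i x := by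
  obtain ⟨κ, _, P, c, C₀, δ, hC, hδ, hc, h⟩ := hu
  refine ⟨κ, ‹_›, fun j => Q * P j, c, C₀ * B + C₀, δ, by positivity, hδ, fun i j => ?_,
    fun i x hx => ?_⟩
  · refine (hc i j).trans (mul_le_mul_of_nonneg_right ?_ (hM i))
    nlinarith [mul_nonneg hC hB]
  · have e : ev x Q * u i x - ∑ j, c i j * ev x (Q * P j) =
        ev x Q * (u i x - ∑ j, c i j * ev x (P j)) := by
      rw [mul_sub, Finset.mul_sum]
      congr 1
      exact Finset.sum_congr rfl fun j _ => by rw [ev_mul]; ring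
    rw [e, norm_mul]
    calc _ ≤ (B * ‖x‖ ^ r) * (C₀ * M i * ‖x‖ ^ N) :=
          mul_le_mul (hQ x) (h i x hx) (norm_nonneg _) (by positivity)
      _ = (C₀ * B) * M i * ‖x‖ ^ (N + r) := by ring
      _ ≤ _ := by
        refine mul_le_mul_of_nonneg_right ?_ (by positivity)
        exact mul_le_mul_of_nonneg_right (by linarith) (hM i)

/-- With `Q` approximating `g` and `P` approximating `u`, use `g u - Q P = (g - Q) u + Q (u - P)`.
The multiplier `g` is fixed, so the basis polynomials `Q * P j` still do not depend on the member of
the family. -/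
lemma UnifExp.mul_left (hu : UnifExp M N u) (hM : ∀ i, 0 ≤ M i) {g : ℝ × ℝ → ℂ}
    (hg : HasPolyExp N g) : UnifExp M N fun i x => g x * u i x := by
  obtain ⟨Q, Cg, δg, hCg, hδg, hg⟩ := hg
  obtain ⟨B, hB, hQ⟩ := exists_bound_ev Q 1
  obtain ⟨κ, _, P, c, C₀, δ, hC, hδ, hc, h⟩ := hu
  choose BP hBP0 hBP using fun j => exists_bound_ev (P j) 1
  set S := ∑ j, BP j
  have hS : 0 ≤ S := Finset.sum_nonneg fun j _ => hBP0 j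
  -- On the unit ball `B` bounds `Q`, and `S` bounds the sum of the basis polynomials, whence `‖u‖ ≤
  -- (C₀ + C₀ S) M`.
  refine ⟨κ, ‹_›, fun j => Q * P j, c, C₀ + C₀ * B + Cg * (C₀ + C₀ * S), min (min δ δg) 1,
    by positivity, by positivity, fun i j => ?_, fun i x hx => ?_⟩
  · refine (hc i j).trans (mul_le_mul_of_nonneg_right ?_ (hM i))
    nlinarith [mul_nonneg hC hB, mul_nonneg hC hS, mul_nonneg hCg hC,
      mul_nonneg hCg (mul_nonneg hC hS)]
  · have hx1 : ‖x‖ ≤ 1 := (hx.trans_le (min_le_right _ _)).le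
    have hxδ := hx.trans_le ((min_le_left _ _).trans (min_le_left _ _))
    have hxg := hx.trans_le ((min_le_left _ _).trans (min_le_right _ _))
    have hMi := hM i
    have hpow : ‖x‖ ^ N ≤ 1 := pow_le_one₀ (norm_nonneg _) hx1
    have hr := h i x hxδ
    have hub : ‖u i x‖ ≤ (C₀ + C₀ * S) * M i := by
      have hs : ‖∑ j, c i j * ev x (P j)‖ ≤ C₀ * M i * S := by
        rw [Finset.mul_sum]
        refine norm_sum_le_of_le _ fun j _ => ?_
        rw [norm_mul]
        exact mul_le_mul (hc i j) (hBP j x hx1) (norm_nonneg _) (by positivity)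
      calc ‖u i x‖ = ‖(u i x - ∑ j, c i j * ev x (P j)) + ∑ j, c i j * ev x (P j)‖ := by
            congr 1; ring
        _ ≤ C₀ * M i * ‖x‖ ^ N + C₀ * M i * S := (norm_add_le _ _).trans (add_le_add hr hs)
        _ ≤ C₀ * M i * 1 + C₀ * M i * S := by gcongr
        _ = _ := by ring
    have e : g x * u i x - ∑ j, c i j * ev x (Q * P j) =
        (g x - ev x Q) * u i x + ev x Q * (u i x - ∑ j, c i j * ev x (P j)) := by
      have : ∑ j, c i j * ev x (Q * P j) = ev x Q * ∑ j, c i j * ev x (P j) := by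
        rw [Finset.mul_sum]
        exact Finset.sum_congr rfl fun j _ => by rw [ev_mul]; ring
      rw [this]; ring
    rw [e]
    calc _ ≤ ‖g x - ev x Q‖ * ‖u i x‖ + ‖ev x Q‖ * ‖u i x - ∑ j, c i j * ev x (P j)‖ :=
          (norm_add_le _ _).trans (by rw [norm_mul, norm_mul])
      _ ≤ (Cg * ‖x‖ ^ N) * ((C₀ + C₀ * S) * M i) + B * (C₀ * M i * ‖x‖ ^ N) := by
          gcongr
          · exact hg x hxg
          · exact hQ x hx1
      _ = (C₀ * B + Cg * (C₀ + C₀ * S)) * M i * ‖x‖ ^ N := by ring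
      _ ≤ _ := by gcongr; linarith

/-- Taylor expansion after a polynomial substitution that vanishes to order `r`. -/
lemma unifExp_comp (hM : ∀ i, 0 ≤ M i) {m : ℕ} {K : I → ℝ × ℝ → ℂ} {δ C₀ : ℝ} (hδ : 0 < δ)
    (hC₀ : 0 ≤ C₀) (hK : ∀ i x, ‖x‖ < δ → ContDiffAt ℝ m (K i) x)
    (hKb : ∀ i x, ‖x‖ < δ → ∀ j ≤ m, ‖iteratedFDeriv ℝ j (K i) x‖ ≤ C₀ * M i)
    {φ : ℝ × ℝ → ℝ × ℝ} {Q₁ Q₂ : ℂ[X][X]} (h₁ : ∀ x, ((φ x).1 : ℂ) = ev x Q₁)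
    (h₂ : ∀ x, ((φ x).2 : ℂ) = ev x Q₂) {r : ℕ} (hr : r ≠ 0) {B : ℝ} (hB : 1 ≤ B)
    (hφ : ∀ x, ‖φ x‖ ≤ B * ‖x‖ ^ r) :
    UnifExp M (r * m) fun i x => K i (φ x) := by
  have hδB : 0 < min (δ / B) 1 := by positivity
  have hsmall : ∀ x, ‖x‖ < min (δ / B) 1 → ‖φ x‖ < δ := by
    intro x hx
    have hx1 : ‖x‖ ≤ 1 := (hx.trans_le (min_le_right _ _)).le
    have hxd := hx.trans_le (min_le_left _ _)
    rw [lt_div_iff₀ (by positivity)] at hxd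
    calc ‖φ x‖ ≤ B * ‖x‖ ^ r := hφ x
      _ ≤ B * ‖x‖ := by gcongr; exact pow_le_of_le_one (norm_nonneg _) hx1 hr
      _ < δ := by linarith
  have hpow : ∀ x, ‖φ x‖ ^ m ≤ B ^ m * ‖x‖ ^ (r * m) := by
    intro x
    calc ‖φ x‖ ^ m ≤ (B * ‖x‖ ^ r) ^ m := by gcongr; exact hφ x
      _ = _ := by rw [mul_pow, pow_mul]
  let e₁ : ℝ × ℝ := (1, 0)
  let e₂ : ℝ × ℝ := (0, 1)
  have he₁ : ‖e₁‖ ≤ 1 := by simp [e₁, Prod.norm_def]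
  have he₂ : ‖e₂‖ ≤ 1 := by simp [e₂, Prod.norm_def]
  have hpw : ∀ {d : ℕ} (s : Finset (Fin d)) (k : Fin d),
      ‖s.piecewise (fun _ => e₁) (fun _ => e₂) k‖ ≤ 1 := by
    intro d s k
    by_cases hk : k ∈ s <;> simp [hk, he₁, he₂]
  -- Multilinear expansion over the set of slots filled with `e₁`: Taylor terms become monomials in
  -- the coordinates, with coefficients depending linearly on the derivative.
  have hmult : ∀ (d : ℕ) (T : (ℝ × ℝ) [×d]→L[ℝ] ℂ) (X : ℝ × ℝ), T (fun _ => X) =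
      ∑ s : Finset (Fin d), (X.1 : ℂ) ^ s.card * (X.2 : ℂ) ^ (d - s.card) *
        T (s.piecewise (fun _ => e₁) (fun _ => e₂)) := by
    intro d T X
    have hX : (fun _ : Fin d => X) = (fun _ => X.1 • e₁) + (fun _ => X.2 • e₂) := by
      funext k; simp [e₁, e₂]
    rw [hX, ContinuousMultilinearMap.map_add_univ]
    refine Finset.sum_congr rfl fun s _ => ?_
    have : s.piecewise (fun _ => X.1 • e₁) (fun _ => X.2 • e₂) =
        fun k => (s.piecewise (fun _ => X.1) (fun _ => X.2) k : ℝ) •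
          (s.piecewise (fun _ => e₁) (fun _ => e₂) k) := by
      funext k
      by_cases hk : k ∈ s <;> simp [hk]
    rw [this, ContinuousMultilinearMap.map_smul_univ, Finset.prod_piecewise]
    simp [Finset.card_univ_sdiff]
  -- Only degrees below `m` are kept, so the error needs no more than a bound on the `m`-th
  -- derivative.
  refine ⟨(d : Fin m) × Finset (Fin d), inferInstance,
    fun j => Q₁ ^ j.2.card * Q₂ ^ ((j.1 : ℕ) - j.2.card),
    fun i j => ((j.1 : ℕ).factorial : ℂ)⁻¹ *
      iteratedFDeriv ℝ (j.1 : ℕ) (K i) 0 (j.2.piecewise (fun _ => e₁) (fun _ => e₂)),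
    C₀ * B ^ m, min (δ / B) 1, by positivity, hδB, ?_, ?_⟩
  · rintro i ⟨d, s⟩
    have hb := hKb i 0 (by simpa using hδ) d d.2.le
    have hT := ContinuousMultilinearMap.le_mul_prod_of_opNorm_le_of_le hb
      (m := s.piecewise (fun _ => e₁) (fun _ => e₂)) (b := fun _ => 1) (fun k => hpw s k)
    have hfac : ‖((d : ℕ).factorial : ℂ)⁻¹‖ ≤ 1 := by
      rw [norm_inv, Complex.norm_natCast]
      exact inv_le_one_of_one_le₀ (by exact_mod_cast Nat.factorial_pos _)
    have hMi := hM i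
    rw [norm_mul]
    calc _ ≤ 1 * (C₀ * M i) := by
          refine mul_le_mul hfac (hT.trans (by simp)) (norm_nonneg _) zero_le_one
      _ = C₀ * 1 * M i := by ring
      _ ≤ C₀ * B ^ m * M i := by gcongr; exact one_le_pow₀ hB
  · intro i x hx
    have hs := hsmall x hx
    have hMi := hM i
    simp only [ev_mul, ev_pow, ← h₁, ← h₂]
    have hsum : ∑ j : (d : Fin m) × Finset (Fin d), ((j.1 : ℕ).factorial : ℂ)⁻¹ *
        iteratedFDeriv ℝ (j.1 : ℕ) (K i) 0 (j.2.piecewise (fun _ => e₁) (fun _ => e₂)) *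
          (((φ x).1 : ℂ) ^ j.2.card * ((φ x).2 : ℂ) ^ ((j.1 : ℕ) - j.2.card)) =
        ∑ d ∈ Finset.range m, (d.factorial : ℝ)⁻¹ •
          iteratedFDeriv ℝ d (K i) 0 (fun _ => φ x) := by
      rw [← Fin.sum_univ_eq_sum_range
        (fun d => (d.factorial : ℝ)⁻¹ • iteratedFDeriv ℝ d (K i) 0 (fun _ => φ x)),
        Fintype.sum_sigma]
      refine Finset.sum_congr rfl fun d _ => ?_
      rw [hmult, Finset.smul_sum]
      refine Finset.sum_congr rfl fun s _ => ?_
      rw [Complex.real_smul]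
      push_cast
      ring
    rw [hsum]
    -- The integral form of the remainder needs `m ≥ 1`; for `m = 0` the sup bound is already the
    -- claim.
    rcases Nat.eq_zero_or_pos m with rfl | hm
    · have := hKb i (φ x) hs 0 le_rfl
      simpa using this
    · obtain ⟨k, rfl⟩ := Nat.exists_eq_succ_of_ne_zero hm.ne'
      have hseg : ∀ t ∈ Set.Icc (0 : ℝ) 1, ‖(0 : ℝ × ℝ) + t • φ x‖ < δ := by
        intro t ht
        rw [zero_add, norm_smul, Real.norm_of_nonneg ht.1]
        nlinarith [norm_nonneg (φ x), ht.2, ht.1]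
      have hT := map_add_eq_sum_add_integral_iteratedFDeriv (f := K i) (x := 0) (y := φ x)
        (n := k) fun t ht => by exact_mod_cast hK i _ (hseg t ht)
      rw [zero_add] at hT
      rw [hT, Nat.succ_eq_add_one, add_sub_cancel_left, norm_smul]
      have hI : ‖∫ t in (0 : ℝ)..1, (1 - t) ^ k •
          iteratedFDeriv ℝ (k + 1) (K i) (0 + t • φ x) (fun _ => φ x)‖ ≤
            (C₀ * M i * ‖φ x‖ ^ (k + 1)) * |1 - 0| := by
        refine intervalIntegral.norm_integral_le_of_norm_le_const fun t ht => ?_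
        rw [Set.uIoc_of_le zero_le_one] at ht
        have ht' : t ∈ Set.Icc (0 : ℝ) 1 := ⟨ht.1.le, ht.2⟩
        rw [norm_smul]
        have h1 : ‖(1 - t) ^ k‖ ≤ 1 := by
          rw [norm_pow, Real.norm_of_nonneg (by linarith [ht.2])]
          exact pow_le_one₀ (by linarith [ht.2]) (by linarith [ht.1])
        have h2 := ContinuousMultilinearMap.le_mul_prod_of_opNorm_le_of_le
          (hKb i _ (hseg t ht') (k + 1) le_rfl) (m := fun _ => φ x) (b := fun _ => ‖φ x‖)
          (fun _ => le_rfl)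
        simp only [Finset.prod_const, Finset.card_univ, Fintype.card_fin] at h2
        calc _ ≤ 1 * (C₀ * M i * ‖φ x‖ ^ (k + 1)) :=
              mul_le_mul h1 h2 (norm_nonneg _) zero_le_one
          _ = _ := one_mul _
      have hfac : ‖((k.factorial : ℝ))⁻¹‖ ≤ 1 := by
        rw [norm_inv, Real.norm_natCast]
        exact inv_le_one_of_one_le₀ (by exact_mod_cast Nat.factorial_pos _)
      calc _ ≤ 1 * (C₀ * M i * ‖φ x‖ ^ (k + 1)) :=
            mul_le_mul hfac (hI.trans (by simp)) (norm_nonneg _) zero_le_one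
        _ ≤ C₀ * M i * (B ^ (k + 1) * ‖x‖ ^ (r * (k + 1))) := by
            rw [one_mul]; gcongr; exact hpow x
        _ = _ := by ring

end

/-- Functions that are `C ^ N` near the origin have a polynomial expansion of order `N`. -/
lemma hasPolyExp_of_contDiffAt {N : ℕ} {g : ℝ × ℝ → ℂ} (hg : ContDiffAt ℝ N g 0) :
    HasPolyExp N g := by
  have hev : ∀ᶠ x in 𝓝 (0 : ℝ × ℝ), ContDiffAt ℝ N g x := by
    exact hg.eventually (by simp)
  have hb : ∀ j : Fin (N + 1), ∃ C : ℝ, ∀ᶠ x in 𝓝 (0 : ℝ × ℝ), ‖iteratedFDeriv ℝ j g x‖ ≤ C := by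
    intro j
    have hc : ContinuousAt (iteratedFDeriv ℝ (j : ℕ) g) 0 :=
      (hg.iteratedFDeriv_right (i := j) (m := 0) (by
        rw [zero_add]; exact_mod_cast Nat.lt_succ_iff.1 j.2)).continuousAt
    refine ⟨‖iteratedFDeriv ℝ (j : ℕ) g 0‖ + 1, ?_⟩
    filter_upwards [hc.norm.eventually (gt_mem_nhds (lt_add_one _))] with x hx using hx.le
  choose Cb hCb using hb
  obtain ⟨δ, hδ, h⟩ := Metric.eventually_nhds_iff.1 (hev.and (eventually_all.2 hCb))
  have hu := unifExp_comp (I := Unit) (M := fun _ => 1) (fun _ => zero_le_one) (m := N)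
    (K := fun _ => g) (δ := δ) (C₀ := ∑ j, |Cb j|) hδ
    (Finset.sum_nonneg fun j _ => abs_nonneg _)
    (fun _ x hx => (h (by simpa using hx)).1)
    (fun _ x hx j hj => by
      have := (h (y := x) (by simpa using hx)).2 ⟨j, Nat.lt_succ_of_le hj⟩
      rw [mul_one]
      exact this.trans ((le_abs_self _).trans
        (Finset.single_le_sum (f := fun j => |Cb j|) (fun j _ => abs_nonneg _)
          (Finset.mem_univ _))))
    (φ := id) (Q₁ := X) (Q₂ := C X) (by simp) (by simp) (r := 1) one_ne_zero (B := 1) le_rfl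
    (by simp)
  rw [one_mul] at hu
  exact hu.hasPolyExp (fun _ => zero_le_one) ()

end ComplexSource

end

/-! ### Limits of singular integrals and identification of the coefficients -/

noncomputable section

namespace ComplexSource

open Polynomial

/-- The product norm is the maximum of `|p|` and `|q|`, so an error `O(‖x‖ ^ N)` stays bounded after
division by `γ ^ N`. -/
lemma norm_le_norm_gam (p q : ℝ) : ‖(p, q)‖ ≤ ‖gam p q‖ := by
  rw [Prod.norm_def]
  refine max_le ?_ ?_
  · simpa [gam_re] using Complex.abs_re_le_norm (gam p q)
  · simpa [gam_im] using Complex.abs_im_le_norm (gam p q)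

lemma gam_zero (q : ℝ) : gam 0 q = Complex.I * q := by simp [gam]

lemma gam_ne_zero_of_ne {p q : ℝ} (hq : q ≠ 0) : gam p q ≠ 0 := by
  intro h
  have := congrArg Complex.im h
  rw [gam_im] at this
  exact hq (by simpa using this)

lemma ae_ne_zero_real : ∀ᵐ q : ℝ, q ≠ 0 := by simp [ae_iff]

/-- Integrals of a function with a polynomial expansion of order `N` against `γ ^ (-N)` converge
as `p → 0⁺`, with a uniform bound on the limit. -/
theorem exists_tendsto_integral_div_gam {I : Type*} {M : I → ℝ} (hM : ∀ i, 0 ≤ M i) {N : ℕ}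
    {F : I → ℝ × ℝ → ℂ} (hF : UnifExp M N F) {a : ℝ} (ha : 0 < a) {C₁ : ℝ} (hC₁ : 0 ≤ C₁)
    (hFb : ∀ i p q, 0 ≤ p → p ≤ 1 → |q| ≤ a → ‖F i (p, q)‖ ≤ C₁ * M i)
    (hFc : ∀ i, ContinuousOn (F i) (Set.Icc 0 1 ×ˢ Set.Icc (-a) a)) :
    ∃ C' : ℝ, ∀ i, ∃ (L : ℂ) (b : ℂ[X]) (B : ℝ), ‖L‖ ≤ C' * M i ∧
      Tendsto (fun p : ℝ => ∫ q in (-a)..a, F i (p, q) / gam p q ^ N) (𝓝[>] 0) (𝓝 L) ∧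
      (∀ q, |q| ≤ a → ‖F i (0, q) - b.eval (q : ℂ)‖ ≤ B * |q| ^ N) ∧
      L = (∫ q in (-a)..a, (F i (0, q) - b.eval (q : ℂ)) / (Complex.I * q) ^ N) +
        ∑ m ∈ Finset.range (b.natDegree + 1), b.coeff m * monoLim a m N := by
  obtain ⟨κ, _, P, c, C₀, δ, hC₀, hδ, hc, hexp⟩ := hF
  choose BP hBP0 hBP using fun j => exists_bound_ev (P j) (max 1 a)
  set S := ∑ j, BP j
  have hS : 0 ≤ S := Finset.sum_nonneg fun j _ => hBP0 j
  set Λ : κ → ℂ := fun j => ∑ m ∈ Finset.range (((P j).coeff 0).natDegree + 1),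
        ((P j).coeff 0).coeff m * monoLim a m N
  -- The first summand serves inside the ball of radius `δ`. Outside it `‖x‖ ^ N ≥ δ ^ N`, and crude
  -- bounds for the function and its polynomial suffice.
  set C₂ := C₀ + (C₁ + C₀ * S) / δ ^ N with hC₂
  have hC₂0 : 0 ≤ C₂ := by positivity
  set R : I → ℝ × ℝ → ℂ := fun i x => F i x - ∑ j, c i j * ev x (P j) with hR
  have hRb : ∀ i p q, 0 ≤ p → p ≤ 1 → |q| ≤ a → ‖R i (p, q)‖ ≤ C₂ * M i * ‖(p, q)‖ ^ N := by
    intro i p q hp hp1 hq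
    have hMi := hM i
    by_cases hx : ‖(p, q)‖ < δ
    · refine (hexp i (p, q) hx).trans ?_
      gcongr
      rw [hC₂]
      have : 0 ≤ (C₁ + C₀ * S) / δ ^ N := by positivity
      linarith
    · have hx' : δ ≤ ‖(p, q)‖ := not_lt.1 hx
      have hn : ‖(p, q)‖ ≤ max 1 a := by
        rw [Prod.norm_def]
        exact max_le_max (by simpa [abs_of_nonneg hp] using hp1) (by simpa using hq)
      have hs : ‖∑ j, c i j * ev (p, q) (P j)‖ ≤ C₀ * M i * S := by
        rw [Finset.mul_sum]
        refine norm_sum_le_of_le _ fun j _ => ?_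
        rw [norm_mul]
        exact mul_le_mul (hc i j) (hBP j _ hn) (norm_nonneg _) (by positivity)
      calc ‖R i (p, q)‖ ≤ C₁ * M i + C₀ * M i * S :=
            (norm_sub_le _ _).trans (add_le_add (hFb i p q hp hp1 hq) hs)
        _ = (C₁ + C₀ * S) / δ ^ N * M i * δ ^ N := by field_simp
        _ ≤ C₂ * M i * ‖(p, q)‖ ^ N := by
            gcongr
            rw [hC₂]; linarith
  have hRγ : ∀ i p q, 0 ≤ p → p ≤ 1 → |q| ≤ a → ‖R i (p, q) / gam p q ^ N‖ ≤ C₂ * M i := by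
    intro i p q hp hp1 hq
    have hMi := hM i
    rw [norm_div, norm_pow]
    refine div_le_of_le_mul₀ (by positivity) (by positivity) ?_
    refine (hRb i p q hp hp1 hq).trans ?_
    gcongr
    exact norm_le_norm_gam p q
  have hRc : ∀ i, ContinuousOn (R i) (Set.Icc 0 1 ×ˢ Set.Icc (-a) a) := by
    intro i
    refine (hFc i).sub (Continuous.continuousOn ?_)
    exact continuous_finsetSum _ fun j _ => continuous_const.mul (continuous_ev _)
  -- The remainder divided by `γ ^ N` is bounded by a constant, and converges for each `q ≠ 0`.
  have hlimR : ∀ i, Tendsto (fun p : ℝ => ∫ q in (-a)..a, R i (p, q) / gam p q ^ N) (𝓝[>] 0)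
      (𝓝 (∫ q in (-a)..a, R i (0, q) / gam 0 q ^ N)) := by
    intro i
    have hev : ∀ᶠ p : ℝ in 𝓝[>] 0, p ∈ Set.Ioo (0 : ℝ) 1 := Ioo_mem_nhdsGT zero_lt_one
    refine intervalIntegral.tendsto_integral_filter_of_dominated_convergence
      (fun _ => C₂ * M i) ?_ ?_ intervalIntegrable_const ?_
    · filter_upwards [hev] with p hp
      refine ContinuousOn.aestronglyMeasurable ?_ measurableSet_uIoc
      rw [Set.uIoc_of_le (by linarith)]
      refine ContinuousOn.div ?_ ?_ fun q _ => pow_ne_zero _ (gam_ne_zero_of_pos hp.1 q)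
      · exact (hRc i).comp (by fun_prop) fun q hq => ⟨⟨hp.1.le, hp.2.le⟩, ⟨hq.1.le, hq.2⟩⟩
      · exact ((continuous_gam.comp (by fun_prop : Continuous fun q : ℝ => (p, q))).pow
          N).continuousOn
    · filter_upwards [hev] with p hp
      refine Eventually.of_forall fun q hq => hRγ i p q hp.1.le hp.2.le ?_
      rw [Set.uIoc_of_le (by linarith)] at hq
      exact abs_le.2 ⟨hq.1.le, hq.2⟩
    · filter_upwards [ae_ne_zero_real] with q hq0 hq
      rw [Set.uIoc_of_le (by linarith)] at hq
      refine Tendsto.div ?_ ?_ (pow_ne_zero _ (gam_ne_zero_of_ne hq0))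
      · have hcw := (hRc i) (0, q) ⟨⟨le_rfl, zero_le_one⟩, ⟨hq.1.le, hq.2⟩⟩
        refine Tendsto.comp hcw (tendsto_nhdsWithin_iff.2 ⟨?_, ?_⟩)
        · exact ((by fun_prop : Continuous fun p : ℝ => (p, q)).tendsto 0).mono_left
            nhdsWithin_le_nhds
        · filter_upwards [hev] with p hp
          exact ⟨⟨hp.1.le, hp.2.le⟩, ⟨hq.1.le, hq.2⟩⟩
      · have := (tendsto_gam q).pow N
        rwa [← gam_zero] at this
  refine ⟨C₂ * (2 * a) + ∑ j, C₀ * ‖Λ j‖, fun i => ?_⟩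
  set Pi : ℂ[X][X] := ∑ j, C (C (c i j)) * P j with hPi
  have hPi' : ∀ x, ev x Pi = ∑ j, c i j * ev x (P j) := by
    intro x; simp [hPi, ev_sum]
  have hpolyint : ∀ p : ℝ, 0 < p → ∀ Q : ℂ[X][X],
      IntervalIntegrable (fun q : ℝ => ev (p, q) Q / gam p q ^ N) volume (-a) a := by
    intro p hp Q
    refine Continuous.intervalIntegrable ?_ _ _
    refine Continuous.div ?_ ?_ fun q => pow_ne_zero _ (gam_ne_zero_of_pos hp q)
    · exact (continuous_ev Q).comp (by fun_prop : Continuous fun q : ℝ => (p, q))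
    · exact (continuous_gam.comp (by fun_prop : Continuous fun q : ℝ => (p, q))).pow N
  have hlimP := tendsto_integral_evalEval ha N Pi
  set LP := ∑ m ∈ Finset.range ((Pi.coeff 0).natDegree + 1),
        (Pi.coeff 0).coeff m * monoLim a m N
  -- Both sides are limits of the same integrals. The right side is linear in the coefficients `c i
  -- j`, which is what bounds the limit by `M i`.
  have hLP' : LP = ∑ j, c i j * Λ j := by
    have h2 := tendsto_finsetSum Finset.univ
      fun j _ => (tendsto_integral_evalEval ha N (P j)).const_mul (c i j)
    refine tendsto_nhds_unique hlimP (h2.congr' ?_)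
    filter_upwards [self_mem_nhdsWithin] with p hp
    simp_rw [← intervalIntegral.integral_const_mul]
    rw [← intervalIntegral.integral_finsetSum]
    · congr 1 with q
      have := hPi' (p, q)
      simp only [ev] at this
      rw [this, Finset.sum_div]
      exact Finset.sum_congr rfl fun j _ => by ring
    · exact fun j _ => (hpolyint p hp (P j)).const_mul _
  have hev0 : ∀ q : ℝ, ev (0, q) Pi = (Pi.coeff 0).eval (q : ℂ) := by
    intro q
    simp [ev, evalEval, coeff_zero_eq_eval_zero]
  refine ⟨(∫ q in (-a)..a, R i (0, q) / gam 0 q ^ N) + LP, Pi.coeff 0, C₂ * M i, ?_, ?_, ?_, ?_⟩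
  · have h1 : ‖∫ q in (-a)..a, R i (0, q) / gam 0 q ^ N‖ ≤ C₂ * M i * |a - -a| := by
      refine intervalIntegral.norm_integral_le_of_norm_le_const fun q hq => ?_
      rw [Set.uIoc_of_le (by linarith)] at hq
      exact hRγ i 0 q le_rfl zero_le_one (abs_le.2 ⟨hq.1.le, hq.2⟩)
    have h2 : ‖LP‖ ≤ ∑ j, C₀ * M i * ‖Λ j‖ := by
      rw [hLP']
      refine norm_sum_le_of_le _ fun j _ => ?_
      rw [norm_mul]
      exact mul_le_mul_of_nonneg_right (hc i j) (norm_nonneg _)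
    refine (norm_add_le _ _).trans ((add_le_add h1 h2).trans (le_of_eq ?_))
    rw [abs_of_nonneg (by linarith), add_mul (C₂ * (2 * a)), Finset.sum_mul]
    congr 1
    · ring
    · exact Finset.sum_congr rfl fun j _ => by ring
  · refine ((hlimR i).add hlimP).congr' ?_
    filter_upwards [Ioo_mem_nhdsGT zero_lt_one] with p hp
    rw [← intervalIntegral.integral_add]
    · congr 1 with q
      have := hPi' (p, q)
      rw [← add_div, hR]
      simp only [ev] at this ⊢
      rw [this]
      ring
    · refine ContinuousOn.intervalIntegrable ?_
      rw [Set.uIcc_of_le (by linarith)]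
      refine ContinuousOn.div ?_ ?_ fun q _ => pow_ne_zero _ (gam_ne_zero_of_pos hp.1 q)
      · exact (hRc i).comp (by fun_prop) fun q hq => ⟨⟨hp.1.le, hp.2.le⟩, hq⟩
      · exact ((continuous_gam.comp (by fun_prop : Continuous fun q : ℝ => (p, q))).pow
          N).continuousOn
    · exact hpolyint p hp.1 Pi
  · intro q hq
    have := hRb i 0 q le_rfl zero_le_one hq
    rw [← hev0, hPi']
    simpa [Prod.norm_def] using this
  · congr 1
    congr 1 with q
    rw [← hev0, hPi', gam_zero]

/-- Taylor's theorem with Peano remainder at the origin for a function whose `k`-th derivative is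
only differentiable at that point. -/
lemma taylor_peano (k : ℕ) {g : ℝ → ℂ} (hg : ContDiffAt ℝ k g 0)
    (hd : DifferentiableAt ℝ (iteratedDeriv k g) 0) :
    (fun x : ℝ => g x - ∑ m ∈ Finset.range (k + 2),
      (x : ℂ) ^ m * (iteratedDeriv m g 0 / (m.factorial : ℂ))) =o[𝓝 0] fun x : ℝ => x ^ (k + 1) := by
  induction k generalizing g with
  | zero =>
    rw [iteratedDeriv_zero] at hd
    have := hasDerivAt_iff_isLittleO.1 hd.hasDerivAt
    simp only [sub_zero] at this
    simp only [zero_add, pow_one, Finset.sum_range_succ, Finset.range_zero, Finset.sum_empty]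
    refine this.congr_left fun x => ?_
    simp [Complex.real_smul]
    ring
  | succ k ih =>
    have hg' : ContDiffAt ℝ k (deriv g) 0 := by
      have h1 : ContDiffAt ℝ k (fderiv ℝ g) 0 := hg.fderiv_right (by norm_cast)
      have h2 : deriv g = fun x => fderiv ℝ g x 1 := by funext x; simp
      rw [h2]
      exact h1.clm_apply contDiffAt_const
    have hd' : DifferentiableAt ℝ (iteratedDeriv k (deriv g)) 0 := by
      rwa [← iteratedDeriv_succ']
    have hrec := ih hg' hd'
    have hdiff : ∀ᶠ x in 𝓝 (0 : ℝ), DifferentiableAt ℝ g x := by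
      filter_upwards [hg.eventually (by simp)] with x hx
      exact hx.differentiableAt (by simp)
    obtain ⟨r, hr, hball⟩ := Metric.eventually_nhds_iff_ball.1 hdiff
    have hs : Metric.ball (0 : ℝ) r ∈ 𝓝 (0 : ℝ) := Metric.ball_mem_nhds _ hr
    -- The derivative of the remainder is the remainder of `deriv g`, which is `o(x ^ (k + 1))` by
    -- induction; the mean value inequality gains one more power.
    have key := (convex_ball (0 : ℝ) r).isLittleO_pow_succ_real (Metric.mem_ball_self hr)
      (n := k + 1) (f := fun x : ℝ => g x - ∑ m ∈ Finset.range (k + 1 + 2),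
        (x : ℂ) ^ m * (iteratedDeriv m g 0 / (m.factorial : ℂ)))
      (f' := fun x : ℝ => deriv g x - ∑ m ∈ Finset.range (k + 2),
        (x : ℂ) ^ m * (iteratedDeriv m (deriv g) 0 / (m.factorial : ℂ))) ?_ ?_
    · rw [nhdsWithin_eq_nhds.2 hs] at key
      simp only [sub_zero] at key
      refine key.congr_left fun x => ?_
      have : g 0 - ∑ m ∈ Finset.range (k + 1 + 2), ((0 : ℝ) : ℂ) ^ m *
          (iteratedDeriv m g 0 / (m.factorial : ℂ)) = 0 := by
        rw [Finset.sum_range_succ']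
        simp
      rw [this, sub_zero]
    · intro x hx
      refine HasDerivAt.hasDerivWithinAt ?_
      refine (hball x hx).hasDerivAt.sub ?_
      rw [show k + 1 + 2 = (k + 2) + 1 by ring]
      simp_rw [Finset.sum_range_succ' _ (k + 2)]
      have hsum : HasDerivAt (fun x : ℝ => ∑ m ∈ Finset.range (k + 2), (x : ℂ) ^ (m + 1) *
          (iteratedDeriv (m + 1) g 0 / ((m + 1).factorial : ℂ)))
          (∑ m ∈ Finset.range (k + 2),
        (x : ℂ) ^ m * (iteratedDeriv m (deriv g) 0 / (m.factorial : ℂ))) x := by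
        refine HasDerivAt.fun_sum fun m _ => ?_
        have h1 := ((hasDerivAt_pow (m + 1) (x : ℂ)).comp_ofReal).mul_const
          (iteratedDeriv (m + 1) g 0 / ((m + 1).factorial : ℂ))
        refine h1.congr_deriv ?_
        rw [← iteratedDeriv_succ', Nat.factorial_succ]
        have h2 : ((m : ℂ) + 1) ≠ 0 := by exact_mod_cast Nat.succ_ne_zero m
        have h3 : (m.factorial : ℂ) ≠ 0 := by exact_mod_cast m.factorial_ne_zero
        push_cast
        field_simp
      refine hsum.add_const ((x : ℂ) ^ 0 * (iteratedDeriv 0 g 0 / ((0 : ℕ).factorial : ℂ)))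
        |>.congr_of_eventuallyEq ?_
      exact Eventually.of_forall fun z => by simp
    · rw [nhdsWithin_eq_nhds.2 hs]
      simpa using hrec

/-- A polynomial that is `o(q ^ j)` at the origin has no coefficient of degree at most `j`. -/
lemma coeff_eq_zero_of_isLittleO (j : ℕ) (b : ℂ[X])
    (h : (fun q : ℝ => b.eval (q : ℂ)) =o[𝓝[≠] 0] fun q : ℝ => q ^ j) :
    ∀ m ≤ j, b.coeff m = 0 := by
  have h00 : ∀ (j : ℕ) (b : ℂ[X]), ((fun q : ℝ => b.eval (q : ℂ)) =o[𝓝[≠] 0] fun q : ℝ => q ^ j) →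
      b.coeff 0 = 0 := by
    intro j b h
    have h1 : Tendsto (fun q : ℝ => b.eval (q : ℂ)) (𝓝[≠] 0) (𝓝 (b.coeff 0)) := by
      have hc : Continuous fun q : ℝ => b.eval (q : ℂ) :=
        b.continuous.comp Complex.continuous_ofReal
      have := (hc.tendsto 0).mono_left (nhdsWithin_le_nhds (s := {0}ᶜ))
      simpa [coeff_zero_eq_eval_zero] using this
    have h2 : Tendsto (fun q : ℝ => b.eval (q : ℂ)) (𝓝[≠] 0) (𝓝 0) := by
      rw [← Asymptotics.isLittleO_one_iff ℝ]
      refine h.trans_isBigO ?_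
      have hc : Continuous fun q : ℝ => q ^ j := by fun_prop
      exact ((hc.tendsto 0).mono_left (nhdsWithin_le_nhds (s := {0}ᶜ))).isBigO_one ℝ
    exact tendsto_nhds_unique h1 h2
  induction j generalizing b with
  | zero =>
    intro m hm
    rw [Nat.le_zero.1 hm]
    exact h00 0 b h
  | succ j ih =>
    intro m hm
    have hb0 := h00 _ b h
    cases m with
    | zero => exact hb0
    | succ m =>
      rw [← coeff_divX]
      refine ih b.divX ?_ m (by omega)
      rw [Asymptotics.isLittleO_iff] at h ⊢
      intro c hc
      filter_upwards [h hc, self_mem_nhdsWithin] with q hq hq0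
      have e : b.eval (q : ℂ) = q * b.divX.eval (q : ℂ) := by
        conv_lhs => rw [← divX_mul_X_add b, hb0]
        simp [mul_comm]
      have hqpos : 0 < |q| := abs_pos.2 hq0
      rw [e, norm_mul, pow_succ, norm_mul, Complex.norm_real, Real.norm_eq_abs q] at hq
      have : |q| * ‖b.divX.eval (q : ℂ)‖ ≤ |q| * (c * ‖q ^ j‖) := by linarith
      exact le_of_mul_le_mul_left this hqpos

/-- The limit of `exists_tendsto_integral_div_gam` in terms of Taylor coefficients. -/
lemma limit_eq_taylor {N : ℕ} {g : ℝ → ℂ} {T : ℕ → ℂ} {a : ℝ} (ha : 0 < a)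
    (hgc : ContinuousOn g (Set.Icc (-a) a)) {b : ℂ[X]} {B : ℝ}
    (hb : ∀ q, |q| ≤ a → ‖g q - b.eval (q : ℂ)‖ ≤ B * |q| ^ (N + 1))
    (hT : (fun x : ℝ => g x - ∑ m ∈ Finset.range (N + 1), (x : ℂ) ^ m * T m) =o[𝓝 0]
      fun x : ℝ => x ^ N) :
    IntervalIntegrable (fun q : ℝ => (g q - ∑ m ∈ Finset.range (N + 1), (q : ℂ) ^ m * T m) /
      (Complex.I * q) ^ (N + 1)) volume (-a) a ∧
    (∫ q in (-a)..a, (g q - b.eval (q : ℂ)) / (Complex.I * q) ^ (N + 1)) +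
        ∑ m ∈ Finset.range (b.natDegree + 1), b.coeff m * monoLim a m (N + 1) =
      (∫ q in (-a)..a, (g q - ∑ m ∈ Finset.range (N + 1), (q : ℂ) ^ m * T m) /
        (Complex.I * q) ^ (N + 1)) + ∑ m ∈ Finset.range (N + 1), T m * monoLim a m (N + 1) := by
  -- Both polynomials approximate `g` up to `o(q ^ N)`, so they agree through degree `N`.
  have hcoef : ∀ m < N + 1, b.coeff m = T m := by
    have hO : (fun q : ℝ => b.eval (q : ℂ) - g q) =o[𝓝 0] fun q : ℝ => q ^ N := by
      have h1 : (fun q : ℝ => b.eval (q : ℂ) - g q) =O[𝓝 0] fun q : ℝ => q ^ (N + 1) := by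
        refine Asymptotics.IsBigO.of_bound B ?_
        filter_upwards [Icc_mem_nhds (neg_lt_zero.2 ha) ha] with q hq
        have := hb q (abs_le.2 hq)
        rw [norm_sub_rev, norm_pow, Real.norm_eq_abs]
        exact this
      refine h1.trans_isLittleO ?_
      simpa using (Asymptotics.isLittleO_pow_pow (𝕜 := ℝ) (Nat.lt_succ_self N))
    have hsum := hO.add hT
    have h := coeff_eq_zero_of_isLittleO N (b - ∑ m ∈ Finset.range (N + 1), C (T m) * X ^ m) (by
      refine Asymptotics.IsLittleO.mono ?_ nhdsWithin_le_nhds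
      refine hsum.congr_left fun q => ?_
      rw [eval_sub, eval_finsetSum]
      have : ∑ m ∈ Finset.range (N + 1), (C (T m) * X ^ m).eval (q : ℂ) =
          ∑ m ∈ Finset.range (N + 1), (q : ℂ) ^ m * T m :=
        Finset.sum_congr rfl fun m _ => by rw [eval_mul, eval_C, eval_pow, eval_X, mul_comm]
      rw [this]; ring)
    intro m hm
    have := h m (Nat.lt_succ_iff.1 hm)
    rw [coeff_sub, finsetSum_coeff, sub_eq_zero] at this
    rw [this]
    simp only [coeff_C_mul, coeff_X_pow]
    simp [hm]
  -- A common summation range. The coefficients of `b` beyond degree `N` are arbitrary; their model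
  -- limits are ordinary integrals by `monoLim_of_le`, so they cancel.
  set D := max (b.natDegree + 1) (N + 1)
  have hND : N + 1 ≤ D := le_max_right _ _
  have hbev : ∀ q : ℝ, b.eval (q : ℂ) = ∑ m ∈ Finset.range (N + 1), (q : ℂ) ^ m * T m +
      ∑ m ∈ Finset.Ico (N + 1) D, b.coeff m * (q : ℂ) ^ m := by
    intro q
    rw [eval_eq_sum_range' (lt_of_lt_of_le (Nat.lt_succ_self _) (le_max_left _ _ :
      b.natDegree + 1 ≤ D)), ← Finset.sum_range_add_sum_Ico _ hND]
    congr 1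
    exact Finset.sum_congr rfl fun m hm => by rw [hcoef m (Finset.mem_range.1 hm)]; ring
  have hsumD : ∑ m ∈ Finset.range (b.natDegree + 1), b.coeff m * monoLim a m (N + 1) =
      ∑ m ∈ Finset.range (N + 1), T m * monoLim a m (N + 1) +
        ∑ m ∈ Finset.Ico (N + 1) D, b.coeff m * monoLim a m (N + 1) := by
    have : ∑ m ∈ Finset.range (b.natDegree + 1), b.coeff m * monoLim a m (N + 1) =
        ∑ m ∈ Finset.range D, b.coeff m * monoLim a m (N + 1) := by
      refine Finset.sum_subset (Finset.range_mono (le_max_left _ _)) fun m _ hm => ?_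
      rw [coeff_eq_zero_of_natDegree_lt (by rw [Finset.mem_range] at hm; omega), zero_mul]
    rw [this, ← Finset.sum_range_add_sum_Ico _ hND]
    congr 1
    exact Finset.sum_congr rfl fun m hm => by rw [hcoef m (Finset.mem_range.1 hm)]
  have hmono : ∀ m ∈ Finset.Ico (N + 1) D, IntervalIntegrable
      (fun q : ℝ => b.coeff m * ((q : ℂ) ^ m / (Complex.I * q) ^ (N + 1))) volume (-a) a := by
    intro m hm
    have hm' := (Finset.mem_Ico.1 hm).1
    have h1 : IntervalIntegrable (fun q : ℝ => b.coeff m * ((Complex.I ^ (N + 1))⁻¹ *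
        (q : ℂ) ^ (m - (N + 1)))) volume (-a) a := (by fun_prop : Continuous fun q : ℝ =>
          b.coeff m * ((Complex.I ^ (N + 1))⁻¹ * (q : ℂ) ^ (m - (N + 1)))).intervalIntegrable _ _
    refine h1.congr_ae (ae_restrict_of_ae ?_)
    filter_upwards [ae_ne_zero_real] with q hq
    have hq' : (q : ℂ) ≠ 0 := by exact_mod_cast hq
    rw [mul_pow, pow_sub₀ _ hq' hm']
    field_simp
  have hint1 : IntervalIntegrable
      (fun q : ℝ => (g q - b.eval (q : ℂ)) / (Complex.I * q) ^ (N + 1)) volume (-a) a := by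
    rw [intervalIntegrable_iff]
    have : IsFiniteMeasure (volume.restrict (Set.uIoc (-a) a)) :=
      ⟨by rw [Set.uIoc_of_le (by linarith)]; simp⟩
    refine Integrable.of_bound (C := B) ?_ ?_
    · rw [Set.uIoc_of_le (by linarith)]
      refine AEStronglyMeasurable.div₀ ?_ ?_
      · refine AEStronglyMeasurable.sub ?_ ?_
        · exact (hgc.mono Set.Ioc_subset_Icc_self).aestronglyMeasurable measurableSet_Ioc
        · exact (b.continuous.comp Complex.continuous_ofReal).aestronglyMeasurable
      · exact (by fun_prop : Continuous fun q : ℝ =>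
          (Complex.I * (q : ℂ)) ^ (N + 1)).aestronglyMeasurable
    · filter_upwards [ae_restrict_mem measurableSet_uIoc, ae_restrict_of_ae ae_ne_zero_real]
        with q hq hq0
      rw [Set.uIoc_of_le (by linarith)] at hq
      rw [norm_div, norm_pow, norm_mul, Complex.norm_I, one_mul, Complex.norm_real,
        Real.norm_eq_abs, div_le_iff₀ (pow_pos (abs_pos.2 hq0) _)]
      exact hb q (abs_le.2 ⟨hq.1.le, hq.2⟩)
  have hsplit : ∀ q : ℝ, (g q - ∑ m ∈ Finset.range (N + 1), (q : ℂ) ^ m * T m) /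
      (Complex.I * q) ^ (N + 1) = (g q - b.eval (q : ℂ)) / (Complex.I * q) ^ (N + 1) +
        ∑ m ∈ Finset.Ico (N + 1) D, b.coeff m * ((q : ℂ) ^ m / (Complex.I * q) ^ (N + 1)) := by
    intro q
    rw [hbev q]
    simp_rw [← mul_div_assoc]
    rw [← Finset.sum_div]
    ring
  have hints : IntervalIntegrable (fun q : ℝ => ∑ m ∈ Finset.Ico (N + 1) D,
      b.coeff m * ((q : ℂ) ^ m / (Complex.I * q) ^ (N + 1))) volume (-a) a := by
    have := IntervalIntegrable.sum (Finset.Ico (N + 1) D) hmono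
    simpa [Finset.sum_fn] using this
  constructor
  · simp_rw [hsplit]
    exact hint1.add hints
  · simp_rw [hsplit]
    rw [intervalIntegral.integral_add hint1 hints, intervalIntegral.integral_finsetSum hmono, hsumD]
    have : ∑ m ∈ Finset.Ico (N + 1) D, b.coeff m * monoLim a m (N + 1) =
        ∑ m ∈ Finset.Ico (N + 1) D, ∫ q in (-a)..a,
          b.coeff m * ((q : ℂ) ^ m / (Complex.I * q) ^ (N + 1)) := by
      refine Finset.sum_congr rfl fun m hm => ?_
      rw [monoLim_of_le a (Finset.mem_Ico.1 hm).1, intervalIntegral.integral_const_mul]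
    rw [this]
    ring

end ComplexSource

end

/-! ### Means over the sphere as parametric integrals -/

noncomputable section

namespace ComplexSource

/-- Composition with a fixed map of class `C ^ m` is bounded in `C ^ m` on compact sets. -/
lemma exists_comp_bound {E F G : Type*} [NormedAddCommGroup E] [NormedSpace ℝ E]
    [NormedAddCommGroup F] [NormedSpace ℝ F] [NormedAddCommGroup G] [NormedSpace ℝ G]
    {m : ℕ} {f : E → F} {s K : Set E} (hs : IsOpen s) (hf : ContDiffOn ℝ m f s)
    (hK : IsCompact K) (hKs : K ⊆ s) :
    ∃ C, 0 ≤ C ∧ ∀ g : F → G, ContDiff ℝ m g → ∀ M, 0 ≤ M → ∀ x ∈ K,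
      (∀ i ≤ m, ‖iteratedFDeriv ℝ i g (f x)‖ ≤ M) →
        ∀ j ≤ m, ‖iteratedFDeriv ℝ j (g ∘ f) x‖ ≤ C * M := by
  have hb : ∀ i : Fin (m + 1), ∃ B, ∀ x ∈ K, ‖iteratedFDerivWithin ℝ i f s x‖ ≤ B := by
    intro i
    refine hK.exists_bound_of_continuousOn ?_
    refine (hf.continuousOn_iteratedFDerivWithin ?_ hs.uniqueDiffOn).mono hKs
    exact_mod_cast Nat.lt_succ_iff.1 i.2
  choose B hB using hb
  -- The summand `1` gives `D ≤ D ^ i` for `i ≥ 1`, the shape of bound required by the estimate for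
  -- derivatives of a composition.
  set D : ℝ := 1 + ∑ i, |B i| with hD
  have hD1 : 1 ≤ D := by
    have : 0 ≤ ∑ i, |B i| := Finset.sum_nonneg fun i _ => abs_nonneg _
    linarith
  have hDi : ∀ i ≤ m, ∀ x ∈ K, ‖iteratedFDerivWithin ℝ i f s x‖ ≤ D := by
    intro i hi x hx
    refine (hB ⟨i, Nat.lt_succ_of_le hi⟩ x hx).trans ((le_abs_self _).trans ?_)
    have := Finset.single_le_sum (f := fun i => |B i|) (fun i _ => abs_nonneg _)
      (Finset.mem_univ (⟨i, Nat.lt_succ_of_le hi⟩ : Fin (m + 1)))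
    linarith
  refine ⟨m.factorial * D ^ m, by positivity, fun g hg M hM x hx hgx j hj => ?_⟩
  have hxs := hKs hx
  have h := norm_iteratedFDerivWithin_comp_le (g := g) (f := f) (n := j) (s := s)
    (t := Set.univ) (N := m) (x := x) hg.contDiffOn hf (by exact_mod_cast hj) uniqueDiffOn_univ
    hs.uniqueDiffOn (Set.mapsTo_univ _ _) hxs (C := M) (D := D)
    (fun i hi => by
      rw [iteratedFDerivWithin_univ]
      exact hgx i (hi.trans hj))
    (fun i hi1 hi => (hDi i (hi.trans hj) x hx).trans (le_self_pow₀ hD1 (by omega)))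
  rw [iteratedFDerivWithin_of_isOpen j hs hxs] at h
  refine h.trans ?_
  calc (j.factorial : ℝ) * M * D ^ j ≤ m.factorial * M * D ^ m := by
        gcongr
    _ = _ := by ring

section Parametric

variable {S : Type*} [TopologicalSpace S] [CompactSpace S] [SecondCountableTopology S]
  [MeasurableSpace S] [BorelSpace S] (μ : Measure S) [IsFiniteMeasure μ]
  {V : Type} [NormedAddCommGroup V] [NormedSpace ℝ V]
  {E : Type} [NormedAddCommGroup E] [NormedSpace ℝ E] [ProperSpace E]

/-- Compactness of `S` and of a closed ball of parameters bounds the derivative uniformly, which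
gives the domination. -/
lemma hasFDerivAt_integral_param {ι : S → V} (hι : Continuous ι) {F : Type}
    [NormedAddCommGroup F] [NormedSpace ℝ F] {G : E × V → F} (hG : ContDiff ℝ 1 G) (v : E) :
    HasFDerivAt (fun v => ∫ s, G (v, ι s) ∂μ)
      (∫ s, (fderiv ℝ G (v, ι s)).comp (ContinuousLinearMap.inl ℝ E V) ∂μ) v := by
  have hc := hG.continuous
  have hc' : Continuous (fun x : E × S =>
      (fderiv ℝ G (x.1, ι x.2)).comp (ContinuousLinearMap.inl ℝ E V)) := by
    have := hG.continuous_fderiv one_ne_zero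
    fun_prop
  obtain ⟨B, hB⟩ := ((isCompact_closedBall v 1).prod (isCompact_univ (X := S))
    ).exists_bound_of_continuousOn hc'.continuousOn
  refine hasFDerivAt_integral_of_dominated_of_fderiv_le (bound := fun _ => B)
    (F' := fun v s => (fderiv ℝ G (v, ι s)).comp (ContinuousLinearMap.inl ℝ E V))
    (Metric.closedBall_mem_nhds v one_pos) ?_ ?_ ?_ ?_ (integrable_const _) ?_
  · refine Eventually.of_forall fun w => Continuous.aestronglyMeasurable ?_
    fun_prop
  · have : Continuous fun s => G (v, ι s) := by fun_prop
    exact this.integrable_of_hasCompactSupport (HasCompactSupport.of_compactSpace _)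
  · exact (hc'.comp (by fun_prop : Continuous fun s : S => (v, s))).aestronglyMeasurable
  · exact Eventually.of_forall fun s w hw => hB (w, s) ⟨hw, Set.mem_univ _⟩
  · refine Eventually.of_forall fun s w _ => ?_
    have h1 := (hG.differentiable one_ne_zero (w, ι s)).hasFDerivAt
    exact h1.comp w (hasFDerivAt_prodMk_left w (ι s))

/-- The derivative is a parametric integral of the same kind with operator values, so the induction
must leave the target space `F` free. -/
lemma contDiff_integral_param {ι : S → V} (hι : Continuous ι) (m : ℕ) {F : Type}
    [NormedAddCommGroup F] [NormedSpace ℝ F]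
    {G : E × V → F} (hG : ContDiff ℝ m G) : ContDiff ℝ m fun v => ∫ s, G (v, ι s) ∂μ := by
  induction m generalizing F with
  | zero =>
    rw [Nat.cast_zero, contDiff_zero] at hG ⊢
    have := continuous_parametric_integral_of_continuous (μ := μ)
      (f := fun v s => G (v, ι s)) (by fun_prop) (isCompact_univ (X := S))
    simpa using this
  | succ m ih =>
    have hG1 : ContDiff ℝ 1 G := hG.of_le (by exact_mod_cast Nat.le_add_left 1 m)
    rw [Nat.cast_add, Nat.cast_one, contDiff_succ_iff_fderiv] at hG ⊢
    refine ⟨fun v => (hasFDerivAt_integral_param μ hι hG1 v).differentiableAt, by simp, ?_⟩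
    have h1 : fderiv ℝ (fun v => ∫ s, G (v, ι s) ∂μ) = fun v => ∫ s,
        (fun x => (fderiv ℝ G x).comp (ContinuousLinearMap.inl ℝ E V)) (v, ι s) ∂μ := by
      funext v
      exact (hasFDerivAt_integral_param μ hι hG1 v).fderiv
    rw [h1]
    exact ih (hG.2.2.clm_comp contDiff_const)

/-- Same induction as for smoothness; restricting a derivative to the parameter directions is an
operator `L` of norm at most one, so no constant accumulates. -/
lemma norm_iteratedFDeriv_integral_param_le {ι : S → V} (hι : Continuous ι) (j : ℕ) {F : Type}
    [NormedAddCommGroup F] [NormedSpace ℝ F] {G : E × V → F} (hG : ContDiff ℝ j G) (v : E) {B : ℝ}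
    (hB : ∀ s, ‖iteratedFDeriv ℝ j G (v, ι s)‖ ≤ B) :
    ‖iteratedFDeriv ℝ j (fun v => ∫ s, G (v, ι s) ∂μ) v‖ ≤ B * μ.real Set.univ := by
  induction j generalizing F with
  | zero =>
    simp only [norm_iteratedFDeriv_zero] at hB ⊢
    exact norm_integral_le_of_norm_le_const (Eventually.of_forall hB)
  | succ m ih =>
    have hG1 : ContDiff ℝ 1 G := hG.of_le (by exact_mod_cast Nat.le_add_left 1 m)
    have h1 : fderiv ℝ (fun v => ∫ s, G (v, ι s) ∂μ) = fun v => ∫ s,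
        (fun x => (fderiv ℝ G x).comp (ContinuousLinearMap.inl ℝ E V)) (v, ι s) ∂μ := by
      funext v
      exact (hasFDerivAt_integral_param μ hι hG1 v).fderiv
    rw [← norm_iteratedFDeriv_fderiv, h1]
    have hG' : ContDiff ℝ m (fderiv ℝ G) := hG.fderiv_right (by norm_cast)
    refine ih (G := fun x => (fderiv ℝ G x).comp (ContinuousLinearMap.inl ℝ E V))
      (hG'.clm_comp contDiff_const) fun s => ?_
    refine le_trans ?_ ((norm_iteratedFDeriv_fderiv (𝕜 := ℝ) (f := G)).trans_le (hB s))
    let L : ((E × V) →L[ℝ] F) →L[ℝ] (E →L[ℝ] F) :=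
      (ContinuousLinearMap.compL ℝ E (E × V) F).flip (ContinuousLinearMap.inl ℝ E V)
    have hL : ‖L‖ ≤ 1 := by
      refine ContinuousLinearMap.opNorm_le_bound _ zero_le_one fun T => ?_
      rw [one_mul]
      refine ContinuousLinearMap.opNorm_le_bound _ (norm_nonneg _) fun w => ?_
      have h2 := T.le_opNorm (w, 0)
      simpa [L, Prod.norm_def] using h2
    have h3 := L.norm_iteratedFDeriv_comp_left (f := fderiv ℝ G) (x := (v, ι s)) (N := m)
      (n := m) hG'.contDiffAt le_rfl
    exact h3.trans (mul_le_of_le_one_left (norm_nonneg _) hL)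

end Parametric

variable {n : ℕ}

/-- The point of `ℝⁿ` with cylindrical coordinates `v = (ρ, ζ)` and angle `σ` about the axis `y`. -/
def cylPoint (y : Rn n) (v : ℝ × ℝ) (σ : Rn n) : Rn n := v.1 • σ + (v.2 / ‖y‖) • y

lemma contDiff_cylPoint (y : Rn n) {m : WithTop ℕ∞} :
    ContDiff ℝ m fun x : (ℝ × ℝ) × Rn n => cylPoint y x.1 x.2 := by
  unfold cylPoint
  fun_prop

/-- The mean over the angle `σ ∈ S^{n-2}` in cylindrical coordinates. -/
def cylMean (y : Rn n) (f : Rn n → ℂ) (v : ℝ × ℝ) : ℂ :=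
  ⨍ σ, f (cylPoint y v ((σ : (ℝ ∙ y)ᗮ) : Rn n)) ∂((volume : Measure (ℝ ∙ y)ᗮ).toSphere)

/-- The surface measure of the unit sphere of `y^⊥`. -/
def sphereMeas (y : Rn n) : Measure (Metric.sphere (0 : (ℝ ∙ y)ᗮ) 1) :=
  (volume : Measure (ℝ ∙ y)ᗮ).toSphere

instance (y : Rn n) : IsFiniteMeasure (sphereMeas y) := by unfold sphereMeas; infer_instance

/-- The inclusion of the unit sphere of `y^⊥` in `ℝⁿ`. -/
def sphereIncl (y : Rn n) (σ : Metric.sphere (0 : (ℝ ∙ y)ᗮ) 1) : Rn n :=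
  ((σ : (ℝ ∙ y)ᗮ) : Rn n)

lemma continuous_sphereIncl (y : Rn n) : Continuous (sphereIncl y) :=
  continuous_subtype_val.comp continuous_subtype_val

lemma cylMean_eq (y : Rn n) (f : Rn n → ℂ) : cylMean y f = fun v =>
    ((sphereMeas y).real Set.univ)⁻¹ •
      ∫ σ, (fun x : (ℝ × ℝ) × Rn n => f (cylPoint y x.1 x.2)) (v, sphereIncl y σ)
        ∂(sphereMeas y) := by
  funext v
  rw [cylMean, average_eq]
  rfl

lemma contDiff_cylMean (y : Rn n) {f : Rn n → ℂ} {m : ℕ} (hf : ContDiff ℝ m f) :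
    ContDiff ℝ m (cylMean y f) := by
  rw [cylMean_eq]
  exact ContDiff.const_smul _ (contDiff_integral_param (sphereMeas y) (continuous_sphereIncl y) m
    (hf.comp (contDiff_cylPoint y)))

/-- The mean is bounded from `C ^ m` to `C ^ m`, locally uniformly. -/
lemma exists_cylMean_bound (y : Rn n) (m : ℕ) (R : ℝ) : ∃ (K : Set (Rn n)) (C : ℝ),
    IsCompact K ∧ 0 ≤ C ∧ ∀ f : Rn n → ℂ, ContDiff ℝ m f → ∀ M, 0 ≤ M →
      (∀ j ≤ m, ∀ x ∈ K, ‖iteratedFDeriv ℝ j f x‖ ≤ M) → ∀ v, ‖v‖ ≤ R → ∀ j ≤ m,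
        ‖iteratedFDeriv ℝ j (cylMean y f) v‖ ≤ C * M := by
  have hKc : IsCompact (Metric.closedBall (0 : ℝ × ℝ) R ×ˢ Set.range (sphereIncl y)) :=
    (isCompact_closedBall _ _).prod (isCompact_range (continuous_sphereIncl y))
  obtain ⟨C, hC, hb⟩ := exists_comp_bound (G := ℂ) (m := m) isOpen_univ
    (contDiff_cylPoint y (m := m)).contDiffOn hKc (Set.subset_univ _)
  refine ⟨(fun x : (ℝ × ℝ) × Rn n => cylPoint y x.1 x.2) ''
    (Metric.closedBall (0 : ℝ × ℝ) R ×ˢ Set.range (sphereIncl y)),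
    |((sphereMeas y).real Set.univ)⁻¹| * (C * (sphereMeas y).real Set.univ),
    hKc.image (contDiff_cylPoint y (m := 0)).continuous, by positivity, ?_⟩
  intro f hf M hM hfK v hv j hj
  have hfj : ContDiff ℝ j f := hf.of_le (by exact_mod_cast hj)
  have h1 := norm_iteratedFDeriv_integral_param_le (sphereMeas y) (continuous_sphereIncl y) j
    (G := fun x : (ℝ × ℝ) × Rn n => f (cylPoint y x.1 x.2))
    (hfj.comp (contDiff_cylPoint y)) v (B := C * M) fun σ => by
      have hx : (v, sphereIncl y σ) ∈
          Metric.closedBall (0 : ℝ × ℝ) R ×ˢ Set.range (sphereIncl y) :=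
        ⟨by simpa using hv, Set.mem_range_self σ⟩
      exact hb f hf M hM _ hx (fun i hi => hfK i hi _ ⟨_, hx, rfl⟩) j hj
  rw [cylMean_eq, iteratedFDeriv_const_smul_apply', norm_smul, Real.norm_eq_abs]
  · calc _ ≤ |((sphereMeas y).real Set.univ)⁻¹| * (C * M * (sphereMeas y).real Set.univ) := by
          gcongr
      _ = _ := by ring
  · exact (contDiff_integral_param (sphereMeas y) (continuous_sphereIncl y) j
      (hfj.comp (contDiff_cylPoint y))).contDiffAt

end ComplexSource

end

/-! ### Spheroidal coordinates and the function `F` -/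

noncomputable section

namespace ComplexSource

variable {n : ℕ}

lemma rhoCoord_eq {a p q : ℝ} (ha : 0 < a) :
    rhoCoord a p q = Real.sqrt (a ^ 2 + p ^ 2) * Real.sqrt (a ^ 2 - q ^ 2) / a := by
  rw [rhoCoord, Real.sqrt_mul (by positivity)]

lemma rhoCoord_sq {a p q : ℝ} (ha : 0 < a) (hq : |q| ≤ a) :
    rhoCoord a p q ^ 2 = (a ^ 2 + p ^ 2) * (a ^ 2 - q ^ 2) / a ^ 2 := by
  have : 0 ≤ a ^ 2 - q ^ 2 := by nlinarith [abs_nonneg q, sq_abs q]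
  rw [rhoCoord, div_pow, Real.sq_sqrt (by positivity)]

lemma hasDerivAt_rhoCoord {a : ℝ} (ha : 0 < a) (p q : ℝ) :
    HasDerivAt (fun s => rhoCoord a s q) (p * (rhoCoord a p q / (a ^ 2 + p ^ 2))) p := by
  have h1 : HasDerivAt (fun s : ℝ => a ^ 2 + s ^ 2) (2 * p) p := by
    simpa using (hasDerivAt_pow 2 p).const_add (a ^ 2)
  have hpos : 0 < a ^ 2 + p ^ 2 := by positivity
  have h2 := ((h1.sqrt hpos.ne').mul_const (Real.sqrt (a ^ 2 - q ^ 2))).div_const a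
  have e : (fun s => rhoCoord a s q) =
      fun s => Real.sqrt (a ^ 2 + s ^ 2) * Real.sqrt (a ^ 2 - q ^ 2) / a := by
    funext s; exact rhoCoord_eq ha
  rw [e]
  refine h2.congr_deriv ?_
  rw [rhoCoord_eq ha]
  have hs : Real.sqrt (a ^ 2 + p ^ 2) ≠ 0 := (Real.sqrt_pos.2 hpos).ne'
  have hsq : a ^ 2 + p ^ 2 = Real.sqrt (a ^ 2 + p ^ 2) * Real.sqrt (a ^ 2 + p ^ 2) :=
    (Real.mul_self_sqrt hpos.le).symm
  rw [show p * (√(a ^ 2 + p ^ 2) * √(a ^ 2 - q ^ 2) / a / (a ^ 2 + p ^ 2)) =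
    p * (√(a ^ 2 + p ^ 2) * √(a ^ 2 - q ^ 2) / a / (√(a ^ 2 + p ^ 2) * √(a ^ 2 + p ^ 2))) by
      rw [← hsq]]
  field_simp

lemma hasDerivAt_zetaCoord (a p q : ℝ) : HasDerivAt (fun s => zetaCoord a s q) (q / a) p := by
  unfold zetaCoord
  simpa using ((hasDerivAt_id p).mul_const q).div_const a

/-- The cylindrical coordinates of a point with spheroidal coordinates `x = (p, q)`. -/
def cylOf (a : ℝ) (x : ℝ × ℝ) : ℝ × ℝ := (rhoCoord a x.1 x.2, zetaCoord a x.1 x.2)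

/-- The derivative of `cylOf` in the direction of `p`. -/
def cylDp (a : ℝ) (x : ℝ × ℝ) : ℝ × ℝ :=
  (x.1 * (rhoCoord a x.1 x.2 / (a ^ 2 + x.1 ^ 2)), x.2 / a)

lemma hasDerivAt_cylOf {a : ℝ} (ha : 0 < a) (p q : ℝ) :
    HasDerivAt (fun s => cylOf a (s, q)) (cylDp a (p, q)) p :=
  (hasDerivAt_rhoCoord ha p q).prodMk (hasDerivAt_zetaCoord a p q)

lemma continuous_cylOf (a : ℝ) : Continuous (cylOf a) := by
  unfold cylOf rhoCoord zetaCoord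
  fun_prop

lemma continuous_cylDp {a : ℝ} (ha : 0 < a) : Continuous (cylDp a) := by
  unfold cylDp rhoCoord
  refine Continuous.prodMk ?_ (by fun_prop)
  refine continuous_fst.mul (Continuous.div (by fun_prop) (by fun_prop) fun x => ?_)
  positivity

lemma hasDerivAt_sphMean {y : Rn n} (hy : y ≠ 0) {f : Rn n → ℂ} (hf : ContDiff ℝ 1 f) (p q : ℝ) :
    HasDerivAt (fun s => sphMean y f s q)
      (fderiv ℝ (cylMean y f) (cylOf ‖y‖ (p, q)) (cylDp ‖y‖ (p, q))) p := by
  have h1 : ContDiff ℝ 1 (cylMean y f) := by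
    exact_mod_cast contDiff_cylMean y (m := 1) (by exact_mod_cast hf)
  have h2 := (h1.differentiable one_ne_zero (cylOf ‖y‖ (p, q))).hasFDerivAt
  exact h2.comp_hasDerivAt p (hasDerivAt_cylOf (norm_pos_iff.2 hy) p q)

/-- The weight `(a² - q²)^{(n-3)/2}`. -/
def wgt (n : ℕ) (a q : ℝ) : ℝ := (a ^ 2 - q ^ 2) ^ (((n : ℝ) - 3) / 2)

/-- The function `F(p + i q)` in closed form. -/
def bigF (y : Rn n) (f : Rn n → ℂ) (x : ℝ × ℝ) : ℂ :=
  (wgt n ‖y‖ x.2 : ℂ) * (cylMean y f (cylOf ‖y‖ x) +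
    gam x.1 x.2 * fderiv ℝ (cylMean y f) (cylOf ‖y‖ x) (cylDp ‖y‖ x) / ((n : ℂ) - 2))

lemma weightedMean_eq {y : Rn n} (hy : y ≠ 0) {f : Rn n → ℂ} (hf : ContDiff ℝ 1 f) (p q : ℝ) :
    weightedMean y f p q = bigF y f (p, q) := by
  unfold weightedMean bigF
  rw [(hasDerivAt_sphMean hy hf p q).deriv]
  rfl

lemma continuous_wgt (hn : 3 ≤ n) (a : ℝ) : Continuous (wgt n a) := by
  unfold wgt
  refine Continuous.rpow_const (by fun_prop) fun q => Or.inr ?_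
  have : (3 : ℝ) ≤ n := by exact_mod_cast hn
  linarith

/-- Continuity includes `|q| = a`, where `ρ` fails to be differentiable in `q`: only the derivative
in `p` enters, and the weight has exponent `(n - 3) / 2 ≥ 0`. -/
lemma continuous_bigF (hn : 3 ≤ n) {y : Rn n} (hy : y ≠ 0) {f : Rn n → ℂ} (hf : ContDiff ℝ 1 f) :
    Continuous (bigF y f) := by
  have h1 : ContDiff ℝ 1 (cylMean y f) := by
    exact_mod_cast contDiff_cylMean y (m := 1) (by exact_mod_cast hf)
  have h2 := h1.continuous
  have h3 := h1.continuous_fderiv one_ne_zero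
  have h4 := continuous_cylOf ‖y‖
  have h5 := continuous_cylDp (norm_pos_iff.2 hy)
  have h6 := continuous_wgt hn ‖y‖
  have h7 := continuous_gam
  unfold bigF
  refine Continuous.mul (Complex.continuous_ofReal.comp (h6.comp continuous_snd)) ?_
  refine (h2.comp h4).add (Continuous.div_const (h7.mul ?_) _)
  exact (h3.comp h4).clm_apply h5

/-- The bounds defining the topology of `C^m(ℝⁿ)`. -/
def CBound (m : ℕ) (K : Set (Rn n)) (f : Rn n → ℂ) (M : ℝ) : Prop :=
  ∀ j ≤ m, ∀ x ∈ K, ‖iteratedFDeriv ℝ j f x‖ ≤ M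

lemma CBound.mono {m m' : ℕ} {K K' : Set (Rn n)} {f : Rn n → ℂ} {M : ℝ} (h : CBound m K f M)
    (hm : m' ≤ m) (hK : K' ⊆ K) : CBound m' K' f M :=
  fun j hj x hx => h j (hj.trans hm) x (hK hx)

lemma exists_bigF_bound (hn : 3 ≤ n) {y : Rn n} (hy : y ≠ 0) (P : ℝ) :
    ∃ (K : Set (Rn n)) (C : ℝ), IsCompact K ∧ 0 ≤ C ∧ ∀ f : Rn n → ℂ, ContDiff ℝ 1 f → ∀ M, 0 ≤ M →
      CBound 1 K f M → ∀ p q, 0 ≤ p → p ≤ P → |q| ≤ ‖y‖ → ‖bigF y f (p, q)‖ ≤ C * M := by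
  set S : Set (ℝ × ℝ) := Set.Icc 0 P ×ˢ Set.Icc (-‖y‖) ‖y‖
  have hS : IsCompact S := isCompact_Icc.prod isCompact_Icc
  obtain ⟨R, hR⟩ := hS.exists_bound_of_continuousOn (continuous_cylOf ‖y‖).continuousOn
  obtain ⟨D, hD⟩ := hS.exists_bound_of_continuousOn (continuous_cylDp (norm_pos_iff.2 hy)).continuousOn
  obtain ⟨W, hW⟩ := hS.exists_bound_of_continuousOn
    ((continuous_wgt hn ‖y‖).comp continuous_snd).continuousOn
  obtain ⟨Γ, hΓ⟩ := hS.exists_bound_of_continuousOn continuous_gam.continuousOn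
  obtain ⟨K, C, hK, hC, h⟩ := exists_cylMean_bound y 1 R
  refine ⟨K, |W| * (C + |Γ| * (C * |D|) / ‖(n : ℂ) - 2‖), hK, by positivity, ?_⟩
  intro f hf M hM hb p q hp hp' hq
  have hx : (p, q) ∈ S := ⟨⟨hp, hp'⟩, abs_le.1 hq⟩
  have h0 := h f (by exact_mod_cast hf) M hM hb _ (hR _ hx) 0 (by norm_num)
  have h1 := h f (by exact_mod_cast hf) M hM hb _ (hR _ hx) 1 le_rfl
  rw [norm_iteratedFDeriv_zero] at h0
  rw [norm_iteratedFDeriv_one] at h1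
  have hd := (fderiv ℝ (cylMean y f) (cylOf ‖y‖ (p, q))).le_of_opNorm_le_of_le h1
    ((hD _ hx).trans (le_abs_self D))
  unfold bigF
  rw [norm_mul, Complex.norm_real, mul_assoc]
  refine mul_le_mul ((hW _ hx).trans (le_abs_self W)) ?_ (norm_nonneg _) (abs_nonneg _)
  refine (norm_add_le _ _).trans ?_
  rw [add_mul]
  refine add_le_add h0 ?_
  rw [norm_div, norm_mul, div_mul_eq_mul_div]
  refine div_le_div_of_nonneg_right ?_ (norm_nonneg _)
  calc _ ≤ |Γ| * (C * M * |D|) :=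
        mul_le_mul ((hΓ _ hx).trans (le_abs_self Γ)) hd (norm_nonneg _) (abs_nonneg _)
    _ = _ := by ring

/-- The cylindrical coordinates as a function of `c = γ²`. -/
def chi (a : ℝ) (c : ℝ × ℝ) : ℝ × ℝ :=
  (Real.sqrt (a ^ 2 + c.1 - (c.2 / (2 * a)) ^ 2), c.2 / (2 * a))

/-- The square of `p + i q` in real coordinates. -/
def sqMap (x : ℝ × ℝ) : ℝ × ℝ := (x.1 ^ 2 - x.2 ^ 2, 2 * x.1 * x.2)

/-- Because `ρ² + ζ² = a² + Re γ²` and `2 a ζ = Im γ²`, the cylindrical coordinates depend on `γ²`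
alone. At `γ = 0` one has `ρ = a > 0`, so the square root in `chi` is smooth there. This is what
doubles the order of every expansion. -/
lemma chi_sqMap {a : ℝ} (ha : 0 < a) (x : ℝ × ℝ) : chi a (sqMap x) = cylOf a x := by
  unfold chi sqMap cylOf rhoCoord zetaCoord
  ext
  · simp only
    have e : a ^ 2 + (x.1 ^ 2 - x.2 ^ 2) - (2 * x.1 * x.2 / (2 * a)) ^ 2 =
        (a ^ 2 + x.1 ^ 2) * (a ^ 2 - x.2 ^ 2) / a ^ 2 := by
      field_simp; ring
    rw [e, Real.sqrt_div' _ (by positivity), Real.sqrt_sq ha.le]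
  · simp only
    field_simp

/-- The domain on which `chi` is smooth. -/
def chiDom (a : ℝ) : Set (ℝ × ℝ) := {c | 0 < a ^ 2 + c.1 - (c.2 / (2 * a)) ^ 2}

lemma isOpen_chiDom (a : ℝ) : IsOpen (chiDom a) :=
  isOpen_lt continuous_const (by fun_prop)

lemma contDiffOn_chi (a : ℝ) {m : WithTop ℕ∞} : ContDiffOn ℝ m (chi a) (chiDom a) := by
  unfold chi
  refine ContDiffOn.prodMk ?_ (by fun_prop)
  refine ContDiffOn.sqrt (by fun_prop) fun c hc => ?_
  exact ne_of_gt hc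

lemma exists_closedBall_chiDom {a : ℝ} (ha : 0 < a) :
    ∃ δ, 0 < δ ∧ Metric.closedBall (0 : ℝ × ℝ) δ ⊆ chiDom a := by
  have : chiDom a ∈ 𝓝 (0 : ℝ × ℝ) := (isOpen_chiDom a).mem_nhds (by simp [chiDom]; positivity)
  exact Metric.nhds_basis_closedBall.mem_iff.1 this

open Polynomial in
/-- A family of functions of `γ²` that is bounded in `C^m` has an expansion of order `2 m`. -/
lemma unifExp_sqMap {I : Type*} {M : I → ℝ} (hM : ∀ i, 0 ≤ M i) {m : ℕ}
    {K : I → ℝ × ℝ → ℂ} {δ C₀ : ℝ} (hδ : 0 < δ)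
    (hC₀ : 0 ≤ C₀) (hK : ∀ i x, ‖x‖ < δ → ContDiffAt ℝ m (K i) x)
    (hKb : ∀ i x, ‖x‖ < δ → ∀ j ≤ m, ‖iteratedFDeriv ℝ j (K i) x‖ ≤ C₀ * M i) :
    UnifExp M (2 * m) fun i x => K i (sqMap x) := by
  refine unifExp_comp hM hδ hC₀ hK hKb (φ := sqMap) (Q₁ := X ^ 2 - (C X) ^ 2)
    (Q₂ := C (C 2) * X * C X) (fun x => ?_) (fun x => ?_) (r := 2) two_ne_zero (B := 2)
    one_le_two fun x => ?_
  · simp [sqMap]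
  · simp [sqMap]
  · have h1 : |x.1| ≤ ‖x‖ := norm_fst_le x
    have h2 : |x.2| ≤ ‖x‖ := norm_snd_le x
    have h0 := norm_nonneg x
    have h3 : x.1 ^ 2 ≤ ‖x‖ ^ 2 := by rw [← sq_abs]; gcongr
    have h4 : x.2 ^ 2 ≤ ‖x‖ ^ 2 := by rw [← sq_abs x.2]; gcongr
    rw [Prod.norm_def, sqMap, Real.norm_eq_abs, Real.norm_eq_abs]
    refine max_le (abs_le.2 ⟨?_, ?_⟩) (abs_le.2 ⟨?_, ?_⟩) <;> simp only <;>
      nlinarith [sq_nonneg x.1, sq_nonneg x.2, sq_nonneg (x.1 + x.2), sq_nonneg (x.1 - x.2)]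

end ComplexSource

end

/-! ### Expansion of `F` to order `n - 1` -/

noncomputable section

namespace ComplexSource

variable {n : ℕ}

lemma contDiffAt_wgt (n : ℕ) {a : ℝ} (ha : 0 < a) {m : WithTop ℕ∞} : ContDiffAt ℝ m (wgt n a) 0 := by
  unfold wgt
  refine ContDiffAt.rpow_const_of_ne (by fun_prop) ?_
  simp [ne_of_gt ha]

lemma contDiffAt_kappa {a : ℝ} (ha : 0 < a) {m : WithTop ℕ∞} :
    ContDiffAt ℝ m (fun x : ℝ × ℝ => rhoCoord a x.1 x.2 / (a ^ 2 + x.1 ^ 2)) 0 := by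
  unfold rhoCoord
  refine ContDiffAt.div ?_ (by fun_prop) (by simp [ha.ne'])
  refine ContDiffAt.div_const (ContDiffAt.sqrt (by fun_prop) ?_) _
  simp [ne_of_gt ha]

/-- The derivative of the mean in the direction `e`. -/
def cylMeanD (y : Rn n) (e : ℝ × ℝ) (f : Rn n → ℂ) (v : ℝ × ℝ) : ℂ := fderiv ℝ (cylMean y f) v e

lemma contDiff_cylMeanD (y : Rn n) (e : ℝ × ℝ) {f : Rn n → ℂ} {m : ℕ}
    (hf : ContDiff ℝ (m + 1 : ℕ) f) : ContDiff ℝ m (cylMeanD y e f) := by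
  have h1 : ContDiff ℝ m (fderiv ℝ (cylMean y f)) :=
    (contDiff_cylMean y hf).fderiv_right (by norm_cast)
  exact h1.clm_apply contDiff_const

lemma norm_iteratedFDeriv_cylMeanD_le (y : Rn n) {e : ℝ × ℝ} (he : ‖e‖ ≤ 1) {f : Rn n → ℂ} {m : ℕ}
    (hf : ContDiff ℝ (m + 1 : ℕ) f) (v : ℝ × ℝ) :
    ‖iteratedFDeriv ℝ m (cylMeanD y e f) v‖ ≤ ‖iteratedFDeriv ℝ (m + 1) (cylMean y f) v‖ := by
  have h1 : ContDiff ℝ m (fderiv ℝ (cylMean y f)) :=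
    (contDiff_cylMean y hf).fderiv_right (by norm_cast)
  refine (norm_iteratedFDeriv_clm_apply_const h1.contDiffAt le_rfl).trans ?_
  rw [norm_iteratedFDeriv_fderiv]
  exact mul_le_of_le_one_left (norm_nonneg _) he

/-- Expansion of a family of functions of `γ²` obtained by composing with `chi`. -/
lemma unifExp_comp_cylOf {a : ℝ} (ha : 0 < a) {δ : ℝ} (hδ : 0 < δ)
    (hball : Metric.closedBall (0 : ℝ × ℝ) δ ⊆ chiDom a) {I : Type*} {M : I → ℝ}
    (hM : ∀ i, 0 ≤ M i) {m : ℕ} {u : I → ℝ × ℝ → ℂ} (hu : ∀ i, ContDiff ℝ m (u i)) {C : ℝ}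
    (hC : 0 ≤ C) (hub : ∀ i, ∀ c ∈ Metric.closedBall (0 : ℝ × ℝ) δ, ∀ j ≤ m,
      ‖iteratedFDeriv ℝ j (u i) (chi a c)‖ ≤ C * M i) :
    UnifExp M (2 * m) fun i x => u i (cylOf a x) := by
  obtain ⟨C', hC', hcomp⟩ := exists_comp_bound (G := ℂ) (m := m) (isOpen_chiDom a)
    (contDiffOn_chi a) (isCompact_closedBall 0 δ) hball
  have h := unifExp_sqMap hM (K := fun i => u i ∘ chi a) (m := m) (C₀ := C' * C) hδ
    (by positivity) (fun i x hx => ?_) (fun i x hx j hj => ?_)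
  · simpa [Function.comp_apply, chi_sqMap ha] using h
  · refine (hu i).contDiffAt.comp x ?_
    refine (contDiffOn_chi a).contDiffAt ((isOpen_chiDom a).mem_nhds (hball ?_))
    simpa using hx.le
  · have hx' : x ∈ Metric.closedBall (0 : ℝ × ℝ) δ := by simpa using hx.le
    have := hcomp (u i) (hu i) (C * M i) (mul_nonneg hC (hM i)) x hx' (hub i x hx') j hj
    rwa [← mul_assoc] at this

/-- Since `∂_p ρ` is a multiple of `p` and `∂_p ζ = q / a`, splitting the derivative into its `ρ`
and `ζ` parts exhibits the quadratic factors `γp` and `γq`. -/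
lemma bigF_eq (y : Rn n) (f : Rn n → ℂ) (x : ℝ × ℝ) : bigF y f x =
    (wgt n ‖y‖ x.2 : ℂ) * cylMean y f (cylOf ‖y‖ x) +
    ((wgt n ‖y‖ x.2 / ((n : ℂ) - 2) *
      ((rhoCoord ‖y‖ x.1 x.2 / (‖y‖ ^ 2 + x.1 ^ 2) : ℝ) : ℂ)) *
        (gam x.1 x.2 * x.1 * cylMeanD y (1, 0) f (cylOf ‖y‖ x)) +
    (wgt n ‖y‖ x.2 / ((n : ℂ) - 2) / ‖y‖) *
        (gam x.1 x.2 * x.2 * cylMeanD y (0, 1) f (cylOf ‖y‖ x))) := by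
  have hd : cylDp ‖y‖ x = (x.1 * (rhoCoord ‖y‖ x.1 x.2 / (‖y‖ ^ 2 + x.1 ^ 2))) • ((1 : ℝ), (0 : ℝ)) +
      (x.2 / ‖y‖) • ((0 : ℝ), (1 : ℝ)) := by
    ext <;> simp [cylDp]
  rw [bigF, hd, map_add, map_smul, map_smul, Complex.real_smul, Complex.real_smul]
  unfold cylMeanD
  push_cast
  ring

lemma norm_ev_gam_mul_le (x : ℝ × ℝ) {s : ℝ} (hs : |s| ≤ ‖x‖) :
    ‖gam x.1 x.2 * s‖ ≤ 2 * ‖x‖ ^ 2 := by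
  have h1 : |x.1| ≤ ‖x‖ := norm_fst_le x
  have h2 : |x.2| ≤ ‖x‖ := norm_snd_le x
  have h3 : ‖gam x.1 x.2‖ ≤ 2 * ‖x‖ := by
    unfold gam
    refine (norm_add_le _ _).trans ?_
    rw [norm_mul, Complex.norm_I, one_mul, Complex.norm_real, Complex.norm_real]
    simp only [Real.norm_eq_abs]
    linarith
  rw [norm_mul, Complex.norm_real, Real.norm_eq_abs]
  calc _ ≤ 2 * ‖x‖ * ‖x‖ := mul_le_mul h3 hs (abs_nonneg _) (by positivity)
    _ = _ := by ring

/-- Pairs of a function of class `C^{n-2}` and a bound for it on `K`. -/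
def BoundedPair (n : ℕ) (K : Set (Rn n)) : Type :=
  {x : (Rn n → ℂ) × ℝ // ContDiff ℝ (n - 2 : ℕ) x.1 ∧ 0 ≤ x.2 ∧ CBound (n - 2) K x.1 x.2}

-- Count orders with `n = k + 3`. The mean is `C^(k+1)` in `γ²`, giving order `2k + 2`; its
-- derivatives are `C^k`, giving `2k`, and the quadratic factors restore `2k + 2`. This is at least
-- `n - 1 = k + 2`. The freedom to enlarge `K` allows this bound to be combined with the sup bound
-- on `F`.
open Polynomial in
theorem exists_unifExp_bigF (hn : 3 ≤ n) {y : Rn n} (hy : y ≠ 0) :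
    ∃ K : Set (Rn n), IsCompact K ∧ ∀ K', K ⊆ K' →
      UnifExp (fun i : BoundedPair n K' => i.1.2) (n - 1) (fun i => bigF y i.1.1) := by
  have ha : 0 < ‖y‖ := norm_pos_iff.2 hy
  obtain ⟨δ, hδ, hball⟩ := exists_closedBall_chiDom ha
  obtain ⟨R, hR⟩ := (isCompact_closedBall (0 : ℝ × ℝ) δ).exists_bound_of_continuousOn
    ((contDiffOn_chi ‖y‖ (m := 0)).continuousOn.mono hball)
  obtain ⟨K, C₀, hK, hC, hb⟩ := exists_cylMean_bound y (n - 2) R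
  obtain ⟨k, rfl⟩ : ∃ k, n = k + 3 := ⟨n - 3, by omega⟩
  refine ⟨K, hK, fun K' hKK' => ?_⟩
  have hM : ∀ i : BoundedPair (k + 3) K', 0 ≤ i.1.2 := fun i => i.2.2.1
  have hA : UnifExp (fun i : BoundedPair (k + 3) K' => i.1.2) (2 * (k + 1))
      fun i x => cylMean y i.1.1 (cylOf ‖y‖ x) := by
    refine unifExp_comp_cylOf ha hδ hball hM (fun i => contDiff_cylMean y i.2.1) hC
      fun i c hc j hj => ?_
    exact hb i.1.1 i.2.1 i.1.2 i.2.2.1 (i.2.2.2.mono le_rfl hKK') _ (hR c hc) j hj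
  have hB : ∀ e : ℝ × ℝ, ‖e‖ ≤ 1 → UnifExp (fun i : BoundedPair (k + 3) K' => i.1.2) (2 * k)
      fun i x => cylMeanD y e i.1.1 (cylOf ‖y‖ x) := by
    intro e he
    refine unifExp_comp_cylOf ha hδ hball hM (fun i => contDiff_cylMeanD y e i.2.1) hC
      fun i c hc j hj => ?_
    refine (norm_iteratedFDeriv_cylMeanD_le y he (i.2.1.of_le ?_) _).trans ?_
    · norm_cast
      omega
    · exact hb i.1.1 i.2.1 i.1.2 i.2.2.1 (i.2.2.2.mono le_rfl hKK') _ (hR c hc) (j + 1)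
        (by simpa using hj)
  have hw : ContDiffAt ℝ (k + 2 : ℕ) (fun x : ℝ × ℝ => ((wgt (k + 3) ‖y‖ x.2 : ℝ) : ℂ)) 0 :=
    Complex.ofRealCLM.contDiff.contDiffAt.comp _
      ((contDiffAt_wgt (k + 3) ha).comp (0 : ℝ × ℝ) contDiffAt_snd)
  have hκ : ContDiffAt ℝ (k + 2 : ℕ) (fun x : ℝ × ℝ =>
      ((rhoCoord ‖y‖ x.1 x.2 / (‖y‖ ^ 2 + x.1 ^ 2) : ℝ) : ℂ)) 0 :=
    Complex.ofRealCLM.contDiff.contDiffAt.comp _ (contDiffAt_kappa ha)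
  have t1 := (hA.mono hM (N' := k + 2) (by omega)).mul_left hM (hasPolyExp_of_contDiffAt hw)
  have t2 := (((hB (1, 0) (by simp [Prod.norm_def])).mul_poly hM ((X + C (C Complex.I) * C X) * X)
    (r := 2) (B := 2) zero_le_two fun x => by
      have := norm_ev_gam_mul_le x (s := x.1) (norm_fst_le x)
      simpa [gam] using this).mono hM (N' := k + 2) (by omega)).mul_left hM
    (hasPolyExp_of_contDiffAt ((hw.div_const (((k + 3 : ℕ) : ℂ) - 2)).mul hκ))
  have t3 := (((hB (0, 1) (by simp [Prod.norm_def])).mul_poly hM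
    ((X + C (C Complex.I) * C X) * C X)
    (r := 2) (B := 2) zero_le_two fun x => by
      have := norm_ev_gam_mul_le x (s := x.2) (norm_snd_le x)
      simpa [gam] using this).mono hM (N' := k + 2) (by omega)).mul_left hM
    (hasPolyExp_of_contDiffAt ((hw.div_const (((k + 3 : ℕ) : ℂ) - 2)).div_const (‖y‖ : ℂ)))
  refine (t1.add (t2.add t3 hM) hM).congr one_pos fun i x _ => ?_
  rw [bigF_eq]
  simp only [gam, ev_mul, ev_add, ev_X, ev_CC, ev_CX]

end ComplexSource

end

/-! ### Regularity and parity of `F(iq)`; the limit for `F` -/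

noncomputable section

namespace ComplexSource

variable {n : ℕ}

/-- Multiplication by the coordinate gains one derivative at the origin. -/
lemma differentiableAt_iteratedDeriv_mul_id (k : ℕ) {B : ℝ → ℂ} (hB : ContDiffAt ℝ k B 0) :
    DifferentiableAt ℝ (iteratedDeriv k fun q : ℝ => (q : ℂ) * B q) 0 := by
  -- Leibniz rule; for `k = 0` the truncated `k - 1` is harmless because its coefficient is zero.
  have hform : iteratedDeriv k (fun q : ℝ => (q : ℂ) * B q) =ᶠ[𝓝 0]
      fun q => (q : ℂ) * iteratedDeriv k B q + k * iteratedDeriv (k - 1) B q := by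
    induction k with
    | zero => exact Eventually.of_forall fun q => by simp
    | succ k ih =>
      have hk := ih (hB.of_le (by exact_mod_cast Nat.le_succ k))
      have hd : ∀ j ≤ k, ∀ᶠ q in 𝓝 (0 : ℝ), DifferentiableAt ℝ (iteratedDeriv j B) q := by
        intro j hj
        filter_upwards [hB.eventually (by simp)] with q hq
        have h1 : DifferentiableAt ℝ (iteratedFDeriv ℝ j B) q :=
          hq.differentiableAt_iteratedFDeriv (by exact_mod_cast Nat.lt_succ_of_le hj)
        have : iteratedDeriv j B = fun q => iteratedFDeriv ℝ j B q (fun _ => 1) := by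
          funext q; exact iteratedDeriv_eq_iteratedFDeriv
        rw [this]
        exact h1.continuousMultilinear_apply_const _
      filter_upwards [hk.eventuallyEq_nhds, hd k le_rfl, hd (k - 1) (by omega)] with q hq h1 h2
      rw [iteratedDeriv_succ, hq.deriv_eq]
      have e1 : HasDerivAt (fun q : ℝ => (q : ℂ) * iteratedDeriv k B q)
          (1 * iteratedDeriv k B q + (q : ℂ) * deriv (iteratedDeriv k B) q) q :=
        (Complex.ofRealCLM.hasDerivAt (x := q)).mul h1.hasDerivAt
      have e2 := (h2.hasDerivAt).const_mul (k : ℂ)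
      have e3 : HasDerivAt
          (fun q : ℝ => (q : ℂ) * iteratedDeriv k B q + k * iteratedDeriv (k - 1) B q) _ q :=
        e1.add e2
      rw [e3.deriv, iteratedDeriv_succ]
      rcases k with _ | k
      · simp; ring
      · simp only [Nat.add_sub_cancel]
        rw [iteratedDeriv_succ (n := k)]
        push_cast
        ring
  refine DifferentiableAt.congr_of_eventuallyEq ?_ hform
  refine DifferentiableAt.add ?_ ?_
  · have hc : ContinuousAt (iteratedDeriv k B) 0 := by
      have : iteratedDeriv k B = fun q => iteratedFDeriv ℝ k B q (fun _ => 1) := by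
        funext q; exact iteratedDeriv_eq_iteratedFDeriv
      rw [this]
      have h1 : ContinuousAt (iteratedFDeriv ℝ k B) 0 :=
        (hB.iteratedFDeriv_right (i := k) (m := 0) (by simp)).continuousAt
      exact (ContinuousMultilinearMap.apply ℝ (fun _ : Fin k => ℝ) ℂ
        (fun _ => 1)).continuous.continuousAt.comp h1
    -- The difference quotient at `0` of `q B^(k)(q)` is `B^(k)(q)` itself, so continuity of `B^(k)`
    -- is enough.
    refine HasDerivAt.differentiableAt (f' := iteratedDeriv k B 0) ?_
    rw [hasDerivAt_iff_tendsto_slope]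
    refine (hc.tendsto.mono_left nhdsWithin_le_nhds).congr' ?_
    filter_upwards [self_mem_nhdsWithin] with q hq
    have hq' : (q : ℂ) ≠ 0 := by exact_mod_cast (hq : q ≠ 0)
    simp [slope, Complex.real_smul]
    field_simp
  · rcases k with _ | k
    · simp
    · refine DifferentiableAt.const_mul ?_ _
      have : iteratedDeriv (k + 1 - 1) B = fun q => iteratedFDeriv ℝ k B q (fun _ => 1) := by
        funext q; exact iteratedDeriv_eq_iteratedFDeriv
      rw [this]
      have h1 : DifferentiableAt ℝ (iteratedFDeriv ℝ k B) 0 :=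
        hB.differentiableAt_iteratedFDeriv (by exact_mod_cast Nat.lt_succ_self k)
      exact h1.continuousMultilinear_apply_const _

lemma iteratedDeriv_differentiableAt_of_contDiffAt (k : ℕ) {g : ℝ → ℂ}
    (hg : ContDiffAt ℝ (k + 1 : ℕ) g 0) : DifferentiableAt ℝ (iteratedDeriv k g) 0 := by
  have : iteratedDeriv k g = fun q => iteratedFDeriv ℝ k g q (fun _ => 1) := by
    funext q; exact iteratedDeriv_eq_iteratedFDeriv
  rw [this]
  have h1 : DifferentiableAt ℝ (iteratedFDeriv ℝ k g) 0 :=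
    hg.differentiableAt_iteratedFDeriv (by exact_mod_cast Nat.lt_succ_self k)
  exact h1.continuousMultilinear_apply_const _

lemma contDiffAt_cylOf_zero {a : ℝ} (ha : 0 < a) {m : WithTop ℕ∞} :
    ContDiffAt ℝ m (fun q : ℝ => cylOf a (0, q)) 0 := by
  unfold cylOf rhoCoord zetaCoord
  refine ContDiffAt.prodMk ?_ (by fun_prop)
  refine ContDiffAt.div_const (ContDiffAt.sqrt (by fun_prop) ?_) _
  simp [ha.ne']

/-- Regularity of `q ↦ F(i q)` at the origin. -/
theorem bigF_axis_regular (hn : 3 ≤ n) {y : Rn n} (hy : y ≠ 0) {f : Rn n → ℂ}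
    (hf : ContDiff ℝ (n - 2 : ℕ) f) :
    ContDiffAt ℝ (n - 3 : ℕ) (fun q : ℝ => bigF y f (0, q)) 0 ∧
      DifferentiableAt ℝ (iteratedDeriv (n - 3) fun q : ℝ => bigF y f (0, q)) 0 := by
  have ha : 0 < ‖y‖ := norm_pos_iff.2 hy
  obtain ⟨k, rfl⟩ : ∃ k, n = k + 3 := ⟨n - 3, by omega⟩
  simp only [Nat.add_sub_cancel, show k + 3 - 2 = k + 1 by omega] at hf ⊢
  have hw : ∀ m : WithTop ℕ∞, ContDiffAt ℝ m (fun q : ℝ => ((wgt (k + 3) ‖y‖ q : ℝ) : ℂ)) 0 :=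
    fun m => Complex.ofRealCLM.contDiff.contDiffAt.comp _ (contDiffAt_wgt (k + 3) ha)
  have h1 : ContDiffAt ℝ (k + 1 : ℕ)
      (fun q : ℝ => ((wgt (k + 3) ‖y‖ q : ℝ) : ℂ) * cylMean y f (cylOf ‖y‖ (0, q))) 0 :=
    (hw _).mul ((contDiff_cylMean y hf).contDiffAt.comp (0 : ℝ) (contDiffAt_cylOf_zero ha))
  have h2 : ContDiffAt ℝ k (fun q : ℝ => (((wgt (k + 3) ‖y‖ q : ℝ) : ℂ) /
      (((k + 3 : ℕ) : ℂ) - 2) / ‖y‖) * (Complex.I * q * cylMeanD y (0, 1) f (cylOf ‖y‖ (0, q)))) 0 := by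
    refine (((hw _).div_const _).div_const _).mul (ContDiffAt.mul ?_ ?_)
    · exact contDiffAt_const.mul Complex.ofRealCLM.contDiff.contDiffAt
    · exact (contDiff_cylMeanD y (0, 1) hf).contDiffAt.comp (0 : ℝ) (contDiffAt_cylOf_zero ha)
  -- At `p = 0` the `ρ` part drops out and the `ζ` part carries `i q · q`. One factor `q` is kept
  -- outside: it recovers, at the origin, the derivative lost in `cylMeanD`.
  have e : (fun q : ℝ => bigF y f (0, q)) =
      (fun q : ℝ => ((wgt (k + 3) ‖y‖ q : ℝ) : ℂ) * cylMean y f (cylOf ‖y‖ (0, q))) +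
        fun q : ℝ => (q : ℂ) * ((((wgt (k + 3) ‖y‖ q : ℝ) : ℂ) /
      (((k + 3 : ℕ) : ℂ) - 2) / ‖y‖) *
        (Complex.I * q * cylMeanD y (0, 1) f (cylOf ‖y‖ (0, q)))) := by
    funext q
    rw [bigF_eq]
    simp only [Pi.add_apply, gam]
    push_cast
    ring
  have h3 : ContDiffAt ℝ k (fun q : ℝ => (q : ℂ) * ((((wgt (k + 3) ‖y‖ q : ℝ) : ℂ) /
      (((k + 3 : ℕ) : ℂ) - 2) / ‖y‖) *
        (Complex.I * q * cylMeanD y (0, 1) f (cylOf ‖y‖ (0, q))))) 0 :=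
    Complex.ofRealCLM.contDiff.contDiffAt.mul h2
  have h1' := h1.of_le (m := k) (by exact_mod_cast Nat.le_succ k)
  rw [e]
  refine ⟨h1'.add h3, ?_⟩
  have hev : iteratedDeriv k ((fun q : ℝ => ((wgt (k + 3) ‖y‖ q : ℝ) : ℂ) *
      cylMean y f (cylOf ‖y‖ (0, q))) + fun q : ℝ => (q : ℂ) * ((((wgt (k + 3) ‖y‖ q : ℝ) : ℂ) /
      (((k + 3 : ℕ) : ℂ) - 2) / ‖y‖) *
        (Complex.I * q * cylMeanD y (0, 1) f (cylOf ‖y‖ (0, q))))) =ᶠ[𝓝 0]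
      iteratedDeriv k (fun q : ℝ => ((wgt (k + 3) ‖y‖ q : ℝ) : ℂ) *
      cylMean y f (cylOf ‖y‖ (0, q))) + iteratedDeriv k (fun q : ℝ => (q : ℂ) *
        ((((wgt (k + 3) ‖y‖ q : ℝ) : ℂ) / (((k + 3 : ℕ) : ℂ) - 2) / ‖y‖) *
        (Complex.I * q * cylMeanD y (0, 1) f (cylOf ‖y‖ (0, q))))) := by
    filter_upwards [h1'.eventually (by simp), h3.eventually (by simp)] with q hq1 hq2
    rw [iteratedDeriv_add hq1 hq2]
    rfl
  refine DifferentiableAt.congr_of_eventuallyEq ?_ hev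
  exact (iteratedDeriv_differentiableAt_of_contDiffAt k h1).add
    (differentiableAt_iteratedDeriv_mul_id k h2)

/-- `F(i q)` is even in `q`. -/
lemma bigF_axis_neg (y : Rn n) (f : Rn n → ℂ) (q : ℝ) : bigF y f (0, -q) = bigF y f (0, q) := by
  rw [bigF_eq, bigF_eq]
  simp [wgt, gam, cylOf, rhoCoord, zetaCoord]

/-- The Taylor coefficients of `F(i q)` at the origin. -/
def axisT (y : Rn n) (f : Rn n → ℂ) (m : ℕ) : ℂ :=
  iteratedDeriv m (fun q : ℝ => bigF y f (0, q)) 0 / (m.factorial : ℂ)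

lemma axisT_odd (y : Rn n) (f : Rn n → ℂ) {m : ℕ} (hm : Odd m) : axisT y f m = 0 := by
  have h := iteratedDeriv_comp_neg m (fun q : ℝ => bigF y f (0, q)) 0
  simp only [bigF_axis_neg, neg_zero, hm.neg_one_pow] at h
  have h2 : iteratedDeriv m (fun q : ℝ => bigF y f (0, q)) 0 = 0 := by
    rw [neg_smul, one_smul] at h
    exact self_eq_neg.1 h
  rw [axisT, h2, zero_div]

/-- The singular part of the integral defining the regularized source converges. -/
theorem exists_limit_bigF (hn : 3 ≤ n) {y : Rn n} (hy : y ≠ 0) :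
    ∃ (K : Set (Rn n)) (C : ℝ), IsCompact K ∧ ∀ f : Rn n → ℂ, ContDiff ℝ (n - 2 : ℕ) f →
      ∃ L : ℂ, (∀ M, 0 ≤ M → CBound (n - 2) K f M → ‖L‖ ≤ C * M) ∧
      Tendsto (fun p : ℝ => ∫ q in (-‖y‖)..‖y‖, bigF y f (p, q) / gam p q ^ (n - 1)) (𝓝[>] 0)
        (𝓝 L) ∧
      IntervalIntegrable (fun q : ℝ => (bigF y f (0, q) -
        ∑ m ∈ Finset.range (n - 1), (q : ℂ) ^ m * axisT y f m) / (Complex.I * q) ^ (n - 1))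
        volume (-‖y‖) ‖y‖ ∧
      L = (∫ q in (-‖y‖)..‖y‖, (bigF y f (0, q) -
        ∑ m ∈ Finset.range (n - 1), (q : ℂ) ^ m * axisT y f m) / (Complex.I * q) ^ (n - 1)) +
        ∑ m ∈ Finset.range (n - 1), axisT y f m * monoLim ‖y‖ m (n - 1) := by
  have ha : 0 < ‖y‖ := norm_pos_iff.2 hy
  obtain ⟨K₁, hK₁, hexp⟩ := exists_unifExp_bigF hn hy
  obtain ⟨K₂, C₂, hK₂, hC₂, hbd⟩ := exists_bigF_bound hn hy 1
  set K := K₁ ∪ K₂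
  have hf1 : ∀ f : Rn n → ℂ, ContDiff ℝ (n - 2 : ℕ) f → ContDiff ℝ 1 f := fun f hf =>
    hf.of_le (by exact_mod_cast (by omega : 1 ≤ n - 2))
  obtain ⟨C', hC'⟩ := exists_tendsto_integral_div_gam (M := fun i : BoundedPair n K => i.1.2)
    (fun i => i.2.2.1) (hexp K Set.subset_union_left) ha hC₂
    (fun i p q hp hp1 hq => hbd i.1.1 (hf1 _ i.2.1) i.1.2 i.2.2.1
      (i.2.2.2.mono (by omega) Set.subset_union_right) p q hp hp1 hq)
    (fun i => (continuous_bigF hn hy (hf1 _ i.2.1)).continuousOn)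
  refine ⟨K, C', hK₁.union hK₂, fun f hf => ?_⟩
  -- Some finite bound is needed to make `f` a member of the family.
  have hex : ∃ M₀, 0 ≤ M₀ ∧ CBound (n - 2) K f M₀ := by
    have hb : ∀ j : Fin (n - 2 + 1), ∃ B, ∀ x ∈ K, ‖iteratedFDeriv ℝ j f x‖ ≤ B := by
      intro j
      refine (hK₁.union hK₂).exists_bound_of_continuousOn (Continuous.continuousOn ?_)
      exact hf.continuous_iteratedFDeriv (by exact_mod_cast Nat.lt_succ_iff.1 j.2)
    choose B hB using hb
    refine ⟨∑ j, |B j|, Finset.sum_nonneg fun j _ => abs_nonneg _, fun j hj x hx => ?_⟩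
    refine (hB ⟨j, Nat.lt_succ_of_le hj⟩ x hx).trans ((le_abs_self _).trans ?_)
    exact Finset.single_le_sum (f := fun j => |B j|) (fun j _ => abs_nonneg _) (Finset.mem_univ _)
  obtain ⟨M₀, hM₀, hb₀⟩ := hex
  obtain ⟨L, b, B, -, hlim, hBb, hL⟩ := hC' ⟨(f, M₀), hf, hM₀, hb₀⟩
  obtain ⟨hr1, hr2⟩ := bigF_axis_regular hn hy hf
  have hpe := taylor_peano (n - 3) hr1 hr2
  rw [show n - 3 + 2 = (n - 2) + 1 by omega, show n - 3 + 1 = n - 2 by omega] at hpe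
  have hN : n - 1 = (n - 2) + 1 := by omega
  have hc : Continuous fun q : ℝ => bigF y f (0, q) :=
    (continuous_bigF hn hy (hf1 _ hf)).comp (by fun_prop)
  rw [hN] at hBb hL
  obtain ⟨hintg, heq⟩ := limit_eq_taylor (T := axisT y f) ha hc.continuousOn hBb hpe
  rw [← hN] at hintg heq
  refine ⟨L, fun M hM hb => ?_, hlim, hintg, ?_⟩
  -- Another bound `M` gives another member of the family but the same integrals, so the limit is
  -- the same and inherits the estimate with `M`.
  · obtain ⟨L', b', B', hLb', hlim', -, -⟩ := hC' ⟨(f, M), hf, hM, hb⟩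
    rw [tendsto_nhds_unique hlim hlim']
    exact hLb'
  · rw [← heq, hL, ← hN]

end ComplexSource

end

/-! ### Density of test functions in `C^m` -/

noncomputable section

namespace ComplexSource

open scoped Convolution in
lemma exists_mollify_dist_le {E : Type} [NormedAddCommGroup E] [NormedSpace ℝ E]
    [FiniteDimensional ℝ E] [MeasurableSpace E] [BorelSpace E] (μ : Measure E)
    [μ.IsAddHaarMeasure] {F : Type} [NormedAddCommGroup F] [NormedSpace ℝ F]
    [CompleteSpace F] {f : E → F} (hf : Continuous f) (hc : HasCompactSupport f) {η : ℝ}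
    (hη : 0 < η) : ∃ r > 0, ∀ φ : ContDiffBump (0 : E), φ.rOut < r → ∀ x,
      ‖(φ.normed μ ⋆[ContinuousLinearMap.lsmul ℝ ℝ, μ] f) x - f x‖ ≤ η := by
  obtain ⟨r, hr, h⟩ := Metric.uniformContinuous_iff.1 (hc.uniformContinuous_of_continuous hf) η hη
  refine ⟨r, hr, fun φ hφ x => ?_⟩
  rw [← dist_eq_norm]
  exact φ.dist_normed_convolution_le hf.aestronglyMeasurable fun z hz => (h (lt_trans hz hφ)).le

open scoped Convolution in
/-- Mollification approximates a compactly supported `C ^ m` function with all its derivatives. -/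
lemma exists_mollify_close {E : Type} [NormedAddCommGroup E] [NormedSpace ℝ E]
    [FiniteDimensional ℝ E] [MeasurableSpace E] [BorelSpace E] (μ : Measure E)
    [μ.IsAddHaarMeasure] (m : ℕ) {F : Type} [NormedAddCommGroup F] [NormedSpace ℝ F]
    [CompleteSpace F] {f : E → F} (hf : ContDiff ℝ m f) (hc : HasCompactSupport f) {η : ℝ}
    (hη : 0 < η) : ∃ r > 0, ∀ φ : ContDiffBump (0 : E), φ.rOut < r → ∀ j ≤ m, ∀ x,
      ‖iteratedFDeriv ℝ j (fun x => (φ.normed μ ⋆[ContinuousLinearMap.lsmul ℝ ℝ, μ] f) x - f x) x‖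
        ≤ η := by
  induction m generalizing F with
  | zero =>
    obtain ⟨r, hr, h⟩ := exists_mollify_dist_le μ hf.continuous hc hη
    refine ⟨r, hr, fun φ hφ j hj x => ?_⟩
    obtain rfl : j = 0 := by omega
    rw [norm_iteratedFDeriv_zero]
    exact h φ hφ x
  | succ m ih =>
    have hf1 : ContDiff ℝ 1 f := hf.of_le (by exact_mod_cast Nat.succ_le_succ (Nat.zero_le m))
    have hfd : ContDiff ℝ m (fderiv ℝ f) := hf.fderiv_right (by exact_mod_cast le_rfl)
    obtain ⟨r, hr, h⟩ := exists_mollify_dist_le μ hf.continuous hc hη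
    obtain ⟨r', hr', h'⟩ := ih hfd (hc.fderiv ℝ)
    refine ⟨min r r', lt_min hr hr', fun φ hφ j hj x => ?_⟩
    rcases j with _ | j
    · rw [norm_iteratedFDeriv_zero]
      exact h φ (hφ.trans_le (min_le_left _ _)) x
    · rw [← norm_iteratedFDeriv_fderiv]
      -- Differentiation falls on `f` alone, so the derivative of the mollification error is the
      -- mollification error of the derivative.
      have e : fderiv ℝ (fun x => (φ.normed μ ⋆[ContinuousLinearMap.lsmul ℝ ℝ, μ] f) x - f x) =
          fun x => (φ.normed μ ⋆[ContinuousLinearMap.lsmul ℝ ℝ, μ] fderiv ℝ f) x -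
            fderiv ℝ f x := by
        funext x
        have h1 := hc.hasFDerivAt_convolution_right (ContinuousLinearMap.lsmul ℝ ℝ)
          (μ := μ) (φ.contDiff_normed (n := 0) (μ := μ)).continuous.locallyIntegrable hf1 x
        have hL : (ContinuousLinearMap.lsmul ℝ ℝ : ℝ →L[ℝ] F →L[ℝ] F).precompR E =
            ContinuousLinearMap.lsmul ℝ ℝ := by
          ext c u; simp
        rw [hL] at h1
        exact (h1.sub (hf1.differentiable (by simp) x).hasFDerivAt).fderiv
      rw [e]
      exact h' φ (hφ.trans_le (min_le_right _ _)) j (by omega) x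

/-- Bounded functionals on `C ^ m` are determined by their values on test functions. -/
theorem eq_of_eqOn_testFunctions {n m : ℕ} {L₁ L₂ : CSpace n m →ₗ[ℂ] ℂ}
    (h₁ : IsBoundedFunctional L₁) (h₂ : IsBoundedFunctional L₂)
    (h : ∀ f : CSpace n m, ContDiff ℝ ∞ (f : Rn n → ℂ) → HasCompactSupport (f : Rn n → ℂ) →
      L₁ f = L₂ f) : L₁ = L₂ := by
  obtain ⟨K₁, hK₁, C₁, hC₁⟩ := h₁
  obtain ⟨K₂, hK₂, C₂, hC₂⟩ := h₂
  ext f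
  obtain ⟨R, hR⟩ := (hK₁.union hK₂).isBounded.subset_ball (0 : Rn n)
  set R' := |R| + 1
  have hR' : 0 < R' := by positivity
  let χ : ContDiffBump (0 : Rn n) := ⟨R', R' + 1, hR', by linarith⟩
  have hfC : ContDiff ℝ m (f : Rn n → ℂ) := f.2
  have hχC : ContDiff ℝ m fun x => (χ x : ℝ) • (f : Rn n → ℂ) x :=
    χ.contDiff.smul hfC
  have hχc : HasCompactSupport fun x => (χ x : ℝ) • (f : Rn n → ℂ) x :=
    χ.hasCompactSupport.smul_right
  let g : CSpace n m := ⟨_, hχC⟩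
  -- The cutoff equals `1` in a neighbourhood of the two compact sets, so boundedness with `M = 0`
  -- makes `f` and `g` indistinguishable for both functionals.
  have hcut : ∀ x ∈ K₁ ∪ K₂, ∀ j ≤ m,
      ‖iteratedFDeriv ℝ j ((f - g : CSpace n m) : Rn n → ℂ) x‖ ≤ 0 := by
    intro x hx j _
    have hxb : x ∈ Metric.ball (0 : Rn n) R' :=
      Metric.ball_subset_ball (by simp only [R']; linarith [le_abs_self R]) (hR hx)
    have hev : ((f - g : CSpace n m) : Rn n → ℂ) =ᶠ[𝓝 x] fun _ => 0 := by
      filter_upwards [Metric.isOpen_ball.mem_nhds hxb] with z hz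
      have : χ z = 1 := χ.one_of_mem_closedBall (Metric.ball_subset_closedBall hz)
      simp [g, this]
    rw [(hev.iteratedFDeriv ℝ j).eq_of_nhds]
    simp
  have e1 : L₁ f = L₁ g := by
    have := hC₁ (f - g) 0 le_rfl fun j hj x hx => hcut x (Or.inl hx) j hj
    rw [mul_zero, norm_le_zero_iff, map_sub, sub_eq_zero] at this
    exact this
  have e2 : L₂ f = L₂ g := by
    have := hC₂ (f - g) 0 le_rfl fun j hj x hx => hcut x (Or.inr hx) j hj
    rw [mul_zero, norm_le_zero_iff, map_sub, sub_eq_zero] at this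
    exact this
  have key : ∀ η > 0, ‖L₁ g - L₂ g‖ ≤ (|C₁| + |C₂|) * η := by
    intro η hη
    obtain ⟨r, hr, hφ⟩ := exists_mollify_close (volume : Measure (Rn n)) m hχC hχc hη
    let φ : ContDiffBump (0 : Rn n) := ⟨r / 4, r / 2, by positivity, by linarith⟩
    have hu : ContDiff ℝ ∞ (MeasureTheory.convolution (φ.normed volume)
        (fun x => (χ x : ℝ) • (f : Rn n → ℂ) x) (ContinuousLinearMap.lsmul ℝ ℝ) volume) :=
      φ.hasCompactSupport_normed.contDiff_convolution_left _ φ.contDiff_normed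
        hχC.continuous.locallyIntegrable
    have huc : HasCompactSupport (MeasureTheory.convolution (φ.normed volume)
        (fun x => (χ x : ℝ) • (f : Rn n → ℂ) x) (ContinuousLinearMap.lsmul ℝ ℝ) volume) :=
      HasCompactSupport.convolution _ φ.hasCompactSupport_normed hχc
    let u : CSpace n m := ⟨_, (hu.of_le (by exact_mod_cast le_top) : ContDiff ℝ m _)⟩
    have hb := hφ φ (by simp only [φ]; linarith)
    have b1 := hC₁ (u - g) η hη.le fun j hj x _ => hb j hj x
    have b2 := hC₂ (u - g) η hη.le fun j hj x _ => hb j hj x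
    have hu12 : L₁ u = L₂ u := h u hu huc
    have : L₁ g - L₂ g = L₂ (u - g) - L₁ (u - g) := by
      rw [map_sub, map_sub, hu12]; ring
    rw [this]
    calc _ ≤ ‖L₂ (u - g)‖ + ‖L₁ (u - g)‖ := norm_sub_le _ _
      _ ≤ C₂ * η + C₁ * η := add_le_add b2 b1
      _ ≤ |C₂| * η + |C₁| * η := by gcongr <;> exact le_abs_self _
      _ = _ := by ring
  rw [e1, e2, ← sub_eq_zero, ← norm_le_zero_iff]
  refine ge_of_tendsto (x := 𝓝[>] (0 : ℝ)) (f := fun η => (|C₁| + |C₂|) * η) ?_ ?_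
  · have : Tendsto (fun η : ℝ => (|C₁| + |C₂|) * η) (𝓝 0) (𝓝 ((|C₁| + |C₂|) * 0)) :=
      (continuous_const.mul continuous_id).tendsto 0
    rw [mul_zero] at this
    exact this.mono_left nhdsWithin_le_nhds
  · filter_upwards [self_mem_nhdsWithin] with η hη using key η hη

end ComplexSource

end

/-! ### The complex length and its derivatives -/

noncomputable section

namespace ComplexSource

variable {n : ℕ}

/-- The square `z² = ∑ zⱼ²` for `z = x + i y`. -/
def csq (y x : Rn n) : ℂ := ∑ j, cpoint x y j ^ 2

/-- The complex length of `x + i y` as a function of `x`. -/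
def clen (y x : Rn n) : ℂ := complexLength (cpoint x y)

lemma cpow_half_sq (w : ℂ) : (w ^ (1 / 2 : ℂ)) ^ 2 = w := by
  simp

lemma cpow_half_re_nonneg (w : ℂ) : 0 ≤ (w ^ (1 / 2 : ℂ)).re := by
  rcases eq_or_ne w 0 with rfl | hw
  · rw [Complex.zero_cpow (by norm_num)]; simp
  · rw [Complex.cpow_def_of_ne_zero hw, Complex.exp_re]
    refine mul_nonneg (Real.exp_pos _).le (Real.cos_nonneg_of_mem_Icc ?_)
    have e : (Complex.log w * (1 / 2 : ℂ)).im = w.arg / 2 := by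
      simp [Complex.mul_im, Complex.log_im]; ring
    rw [e]
    constructor
    · linarith [Complex.neg_pi_lt_arg w]
    · linarith [Complex.arg_le_pi w]

/-- Solve for `p²` from `|w| = p² + q²` and `Re w = p² - q²`. The formula shows that `p` is
continuous even across the branch cut, where `γ` need not be. -/
lemma cpow_half_re (w : ℂ) : (w ^ (1 / 2 : ℂ)).re = √((‖w‖ + w.re) / 2) := by
  have h := cpow_half_sq w
  have hn : ‖w‖ = (w ^ (1 / 2 : ℂ)).re ^ 2 + (w ^ (1 / 2 : ℂ)).im ^ 2 := by
    conv_lhs => rw [← h, norm_pow, ← Complex.normSq_eq_norm_sq, Complex.normSq_apply]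
    ring
  have hr : w.re = (w ^ (1 / 2 : ℂ)).re ^ 2 - (w ^ (1 / 2 : ℂ)).im ^ 2 := by
    conv_lhs => rw [← h, pow_two, Complex.mul_re]
    ring
  rw [hn, hr, eq_comm, Real.sqrt_eq_iff_mul_self_eq (by nlinarith [sq_nonneg (w ^ (1 / 2 : ℂ)).re])
    (cpow_half_re_nonneg w)]
  ring

lemma cpow_half_of_sq {g : ℂ} (hg : 0 < g.re) : (g ^ 2) ^ (1 / 2 : ℂ) = g := by
  have h := cpow_half_sq (g ^ 2)
  have h0 := cpow_half_re_nonneg (g ^ 2)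
  rcases sq_eq_sq_iff_eq_or_eq_neg.1 h with h | h
  · exact h
  · rw [h] at h0
    simp at h0
    linarith

/-- On the cut `|w| = -Re w`, so the real part of the root vanishes. Hence `γ` is smooth wherever `p
> 0`. -/
lemma mem_slitPlane_of_cpow_half {w : ℂ} (h : 0 < (w ^ (1 / 2 : ℂ)).re) : w ∈ Complex.slitPlane := by
  by_contra hw
  rw [Complex.mem_slitPlane_iff, not_or, not_lt, not_not] at hw
  rw [cpow_half_re, Real.sqrt_pos] at h
  have : ‖w‖ = -w.re := by
    rw [← Complex.abs_re_eq_norm.2 hw.2, abs_of_nonpos hw.1]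
  linarith

lemma clen_eq (y x : Rn n) : clen y x = csq y x ^ (1 / 2 : ℂ) := rfl

lemma clen_sq (y x : Rn n) : clen y x ^ 2 = csq y x := cpow_half_sq _

lemma contDiff_csq (y : Rn n) {m : WithTop ℕ∞} : ContDiff ℝ m (csq y) := by
  unfold csq cpoint
  refine ContDiff.sum fun j _ => ContDiff.pow (ContDiff.add ?_ contDiff_const) 2
  exact Complex.ofRealCLM.contDiff.comp (EuclideanSpace.proj (𝕜 := ℝ) j).contDiff

lemma continuous_clen_re (y : Rn n) : Continuous fun x => (clen y x).re := by
  have : (fun x => (clen y x).re) = fun x => √((‖csq y x‖ + (csq y x).re) / 2) := by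
    funext x; exact cpow_half_re _
  rw [this]
  have := (contDiff_csq y (m := 0)).continuous
  fun_prop

lemma csq_re (y x : Rn n) : (csq y x).re = ‖x‖ ^ 2 - ‖y‖ ^ 2 := by
  rw [EuclideanSpace.norm_sq_eq, EuclideanSpace.norm_sq_eq, ← Finset.sum_sub_distrib]
  simp [csq, cpoint, pow_two]

lemma csq_im (y x : Rn n) : (csq y x).im = 2 * ∑ j, x j * y j := by
  simp only [csq, cpoint, pow_two, Complex.im_sum, Finset.mul_sum]
  refine Finset.sum_congr rfl fun j _ => ?_
  simp [Complex.mul_im]; ring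

lemma clen_ne_zero {y x : Rn n} (h : 0 < (clen y x).re) : clen y x ≠ 0 := by
  intro h0; rw [h0] at h; simp at h

lemma contDiffAt_clen {y x : Rn n} (h : 0 < (clen y x).re) {m : WithTop ℕ∞} :
    ContDiffAt ℝ m (clen y) x := by
  have hs : csq y x ∈ Complex.slitPlane := mem_slitPlane_of_cpow_half h
  have h1 : ContDiffAt ℂ m (fun w : ℂ => w ^ (1 / 2 : ℂ)) (csq y x) :=
    (AnalyticAt.cpow analyticAt_id analyticAt_const hs).contDiffAt
  exact (h1.restrict_scalars ℝ).comp x (contDiff_csq y).contDiffAt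

/-- The derivative of `z² / 2`. -/
def zform (y x : Rn n) : Rn n →L[ℝ] ℂ :=
  ∑ j, cpoint x y j • Complex.ofRealCLM.comp (EuclideanSpace.proj (𝕜 := ℝ) j)

lemma zform_apply (y x v : Rn n) : zform y x v = ∑ j, cpoint x y j * (v j : ℂ) := by
  simp [zform]

lemma zform_single (y x : Rn n) (j : Fin n) :
    zform y x (EuclideanSpace.single j 1) = cpoint x y j := by
  rw [zform_apply, Finset.sum_eq_single j] <;> simp +contextual

lemma hasFDerivAt_cpoint (y x : Rn n) (j : Fin n) : HasFDerivAt (fun x => cpoint x y j)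
    (Complex.ofRealCLM.comp (EuclideanSpace.proj (𝕜 := ℝ) j)) x := by
  unfold cpoint
  exact (Complex.ofRealCLM.comp (EuclideanSpace.proj (𝕜 := ℝ) j)).hasFDerivAt.add_const _

lemma hasFDerivAt_csq (y x : Rn n) : HasFDerivAt (csq y) ((2 : ℂ) • zform y x) x := by
  have h := HasFDerivAt.fun_sum (u := Finset.univ)
    fun j (_ : j ∈ Finset.univ) => (hasFDerivAt_cpoint y x j).pow 2
  refine h.congr_fderiv ?_
  ext v
  simp [zform, Finset.mul_sum, mul_assoc]

/-- Differentiate `γ² = z²` and divide by `2γ`. -/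
lemma hasFDerivAt_clen {y x : Rn n} (h : 0 < (clen y x).re) :
    HasFDerivAt (clen y) ((clen y x)⁻¹ • zform y x) x := by
  have h1 := (contDiffAt_clen h (m := 1)).differentiableAt (by simp)
  have h2 := h1.hasFDerivAt.pow 2
  have h3 : HasFDerivAt (fun x => clen y x ^ 2) ((2 : ℂ) • zform y x) x := by
    simp only [clen_sq]; exact hasFDerivAt_csq y x
  have h4 := h2.unique h3
  refine h1.hasFDerivAt.congr_fderiv ?_
  ext v
  have h5 := congrArg (fun T => T v) h4
  have h0 := clen_ne_zero h
  simp at h5 ⊢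
  field_simp
  linear_combination h5 / 2

lemma hasFDerivAt_clen_re {y x : Rn n} (h : 0 < (clen y x).re) :
    HasFDerivAt (fun x => (clen y x).re)
      (Complex.reCLM.comp ((clen y x)⁻¹ • zform y x)) x :=
  Complex.reCLM.hasFDerivAt.comp x (hasFDerivAt_clen h)

lemma hasFDerivAt_clen_zpow {y x : Rn n} (h : 0 < (clen y x).re) (k : ℤ) :
    HasFDerivAt (fun x => clen y x ^ k) ((k * clen y x ^ (k - 2)) • zform y x) x := by
  have h0 := clen_ne_zero h
  have h1 := ((hasDerivAt_zpow k (clen y x) (Or.inl h0)).hasFDerivAt.restrictScalars ℝ).comp x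
    (hasFDerivAt_clen h)
  refine h1.congr_fderiv ?_
  ext v
  simp
  rw [show k - 1 = (k - 2) + 1 by ring, zpow_add₀ h0, zpow_one]
  field_simp

end ComplexSource

end

/-! ### Green's identity with a cutoff in `p` -/

noncomputable section

namespace ComplexSource

variable {n : ℕ}

/-- The product of `g` with the cutoff `ψ(p)`. -/
def cut (y : Rn n) (ψ : ℝ → ℝ) (g : Rn n → ℂ) (x : Rn n) : ℂ := (ψ (clen y x).re : ℂ) * g x

/-- By continuity of `p`, the product vanishes near every point with `p < ε`; at all other points `p
≥ ε > 0`, where `γ` and `g` are smooth. -/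
lemma contDiff_cut {y : Rn n} {ψ : ℝ → ℝ} {g : Rn n → ℂ} {ε : ℝ} {m : WithTop ℕ∞} (hε : 0 < ε)
    (hψ : ContDiff ℝ m ψ) (hz : ∀ t ≤ ε, ψ t = 0)
    (hg : ∀ x, 0 < (clen y x).re → ContDiffAt ℝ m g x) : ContDiff ℝ m (cut y ψ g) := by
  rw [contDiff_iff_contDiffAt]
  intro x
  rcases lt_or_ge (clen y x).re ε with hx | hx
  · have : cut y ψ g =ᶠ[𝓝 x] fun _ => 0 := by
      filter_upwards [(isOpen_lt (continuous_clen_re y) continuous_const).mem_nhds hx] with u hu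
      simp [cut, hz _ (le_of_lt hu)]
    exact contDiffAt_const.congr_of_eventuallyEq this
  · have hp := hε.trans_le hx
    refine ContDiffAt.mul ?_ (hg x hp)
    exact Complex.ofRealCLM.contDiff.contDiffAt.comp x (hψ.contDiffAt.comp x
      (Complex.reCLM.contDiff.contDiffAt.comp x (contDiffAt_clen hp)))

lemma deriv_eq_zero_of_le {ψ : ℝ → ℝ} {ε : ℝ} (hψ : ContDiff ℝ 1 ψ) (hz : ∀ t ≤ ε, ψ t = 0) :
    ∀ t ≤ ε, deriv ψ t = 0 := by
  intro t ht
  have h1 := ((hψ.differentiable (by simp) t).hasDerivAt.hasDerivWithinAt (s := Set.Iic t))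
  have h2 : HasDerivWithinAt ψ 0 (Set.Iic t) t :=
    (hasDerivWithinAt_const t (Set.Iic t) (0 : ℝ)).congr (fun u hu => hz u (le_trans hu ht))
      (hz t ht)
  exact (uniqueDiffOn_Iic t t Set.self_mem_Iic).eq_deriv _ h1 h2

lemma fderiv_cut {y : Rn n} {ψ : ℝ → ℝ} {g : Rn n → ℂ} {ε : ℝ} (hε : 0 < ε)
    (hψ : ContDiff ℝ 1 ψ) (hz : ∀ t ≤ ε, ψ t = 0) {x v : Rn n} {g' : ℂ}
    (hg : 0 < (clen y x).re → ∃ T : Rn n →L[ℝ] ℂ, HasFDerivAt g T x ∧ T v = g') :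
    fderiv ℝ (cut y ψ g) x v =
      ((deriv ψ (clen y x).re : ℝ) : ℂ) * ((zform y x v / clen y x).re : ℂ) * g x +
        (ψ (clen y x).re : ℂ) * g' := by
  rcases lt_or_ge (clen y x).re ε with hx | hx
  · have : cut y ψ g =ᶠ[𝓝 x] fun _ => 0 := by
      filter_upwards [(isOpen_lt (continuous_clen_re y) continuous_const).mem_nhds hx] with u hu
      simp [cut, hz _ (le_of_lt hu)]
    rw [this.fderiv_eq, hz _ hx.le, deriv_eq_zero_of_le hψ hz _ hx.le]
    simp
  · have hp := hε.trans_le hx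
    obtain ⟨T, hT, rfl⟩ := hg hp
    have h1 := ((hψ.differentiable (by simp) (clen y x).re).hasDerivAt.hasFDerivAt).comp x
      (hasFDerivAt_clen_re hp)
    have h2 := (Complex.ofRealCLM.hasFDerivAt.comp x h1).mul hT
    have e : fderiv ℝ (cut y ψ g) x = _ := HasFDerivAt.fderiv h2
    rw [e]
    simp [div_eq_inv_mul]
    ring

/-- The partial derivatives of the potential. -/
def potentialGrad (y : Rn n) (j : Fin n) (x : Rn n) : ℂ :=
  1 / (sphereArea n : ℂ) * (cpoint x y j * clen y x ^ (-(n : ℤ)))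

lemma contDiffAt_clen_zpow {y x : Rn n} (h : 0 < (clen y x).re) (k : ℤ) {m : WithTop ℕ∞} :
    ContDiffAt ℝ m (fun x => clen y x ^ k) x := by
  have h1 : ContDiffAt ℂ m (fun w : ℂ => w ^ k) (clen y x) :=
    (analyticAt_id.zpow (clen_ne_zero h)).contDiffAt
  exact (h1.restrict_scalars ℝ).comp x (contDiffAt_clen h)

lemma contDiff_cpoint (y : Rn n) (j : Fin n) {m : WithTop ℕ∞} :
    ContDiff ℝ m fun x => cpoint x y j :=
  (Complex.ofRealCLM.comp (EuclideanSpace.proj (𝕜 := ℝ) j)).contDiff.add contDiff_const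

lemma contDiffAt_potential {y x : Rn n} (h : 0 < (clen y x).re) {m : WithTop ℕ∞} :
    ContDiffAt ℝ m (fun x => potential (cpoint x y)) x :=
  contDiffAt_const.mul ((contDiffAt_clen_zpow h _).div_const _)

lemma contDiffAt_potentialGrad {y x : Rn n} (h : 0 < (clen y x).re) (j : Fin n)
    {m : WithTop ℕ∞} : ContDiffAt ℝ m (potentialGrad y j) x :=
  contDiffAt_const.mul ((contDiff_cpoint y j).contDiffAt.mul (contDiffAt_clen_zpow h _))

lemma hasFDerivAt_potential (hn : 3 ≤ n) {y x : Rn n} (h : 0 < (clen y x).re) (j : Fin n) :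
    ∃ T : Rn n →L[ℝ] ℂ, HasFDerivAt (fun x => potential (cpoint x y)) T x ∧
      T (EuclideanSpace.single j 1) = potentialGrad y j x := by
  have h1 := ((hasFDerivAt_clen_zpow h (2 - n)).mul_const ((2 - (n : ℂ))⁻¹)).const_mul
    (1 / (sphereArea n : ℂ))
  refine ⟨_, h1, ?_⟩
  have hn2 : (2 - (n : ℂ)) ≠ 0 := by
    rw [sub_ne_zero]; norm_cast; omega
  simp only [_root_.smul_apply, zform_single, potentialGrad, smul_eq_mul]
  rw [show (2 - (n : ℤ)) - 2 = -(n : ℤ) by ring]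
  push_cast
  field_simp

lemma hasFDerivAt_potentialGrad {y x : Rn n} (h : 0 < (clen y x).re) (j : Fin n) :
    ∃ T : Rn n →L[ℝ] ℂ, HasFDerivAt (potentialGrad y j) T x ∧
      T (EuclideanSpace.single j 1) = 1 / (sphereArea n : ℂ) *
        (clen y x ^ (-(n : ℤ)) - n * cpoint x y j ^ 2 * clen y x ^ (-(n : ℤ) - 2)) := by
  have h1 := ((hasFDerivAt_cpoint y x j).mul (hasFDerivAt_clen_zpow h (-(n : ℤ)))).const_mul
    (1 / (sphereArea n : ℂ))
  refine ⟨_, h1, ?_⟩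
  simp [zform_single]
  ring

/-- Harmonicity of the potential: `∑ z_j² = γ²` makes the sum `n γ^(-n) - n γ² γ^(-n-2)`. -/
lemma sum_potentialHess {y x : Rn n} (h : 0 < (clen y x).re) :
    ∑ j, (clen y x ^ (-(n : ℤ)) - n * cpoint x y j ^ 2 * clen y x ^ (-(n : ℤ) - 2)) = 0 := by
  rw [Finset.sum_sub_distrib, ← Finset.sum_mul, ← Finset.mul_sum]
  have e : ∑ j, cpoint x y j ^ 2 = clen y x ^ 2 := (clen_sq y x).symm
  have h0 := clen_ne_zero h
  rw [e, sub_eq_add_neg (-(n : ℤ)), zpow_add₀ h0]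
  simp
  field_simp
  simp

lemma laplacian_eq_sum {f : Rn n → ℂ} (hf : ContDiff ℝ 2 f) (x : Rn n) :
    Laplacian.laplacian f x = ∑ j, fderiv ℝ (fun x => fderiv ℝ f x (EuclideanSpace.single j 1)) x
      (EuclideanSpace.single j 1) := by
  rw [InnerProductSpace.laplacian_eq_iteratedFDeriv_orthonormalBasis f
    (EuclideanSpace.basisFun (Fin n) ℝ)]
  refine Finset.sum_congr rfl fun j _ => ?_
  rw [iteratedFDeriv_two_apply]
  have hd : DifferentiableAt ℝ (fderiv ℝ f) x :=
    (hf.fderiv_right (m := 1) (by norm_num)).differentiable (by simp) x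
  have e : HasFDerivAt (fun x => fderiv ℝ f x (EuclideanSpace.single j 1)) _ x :=
    hd.hasFDerivAt.clm_apply (hasFDerivAt_const _ x)
  rw [e.fderiv]
  simp

/-- Green's identity for the potential with a cutoff in `p`. -/
theorem integral_cut_potential_mul_laplacian (hn : 3 ≤ n) (y : Rn n) {ψ : ℝ → ℝ} {ε : ℝ}
    (hε : 0 < ε) (hψ : ContDiff ℝ 1 ψ) (hz : ∀ t ≤ ε, ψ t = 0) {f : Rn n → ℂ}
    (hf : ContDiff ℝ 2 f) (hc : HasCompactSupport f) :
    ∫ x, cut y ψ (fun x => potential (cpoint x y)) x * Laplacian.laplacian f x =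
      ∫ x, ((deriv ψ (clen y x).re : ℝ) : ℂ) * ∑ j, ((cpoint x y j / clen y x).re : ℂ) *
        (potentialGrad y j x * f x -
          potential (cpoint x y) * fderiv ℝ f x (EuclideanSpace.single j 1)) := by
  set e : Fin n → Rn n := fun j => EuclideanSpace.single j 1 with he
  set h := cut y ψ (fun x => potential (cpoint x y)) with hh
  have hC : ContDiff ℝ 1 h := contDiff_cut hε hψ hz fun x hx => contDiffAt_potential hx
  have hCj : ∀ j, ContDiff ℝ 1 (cut y ψ (potentialGrad y j)) := fun j =>
    contDiff_cut hε hψ hz fun x hx => contDiffAt_potentialGrad hx j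
  have hDf : ∀ j, ContDiff ℝ 1 fun x => fderiv ℝ f x (e j) := fun j =>
    (hf.fderiv_right (m := 1) (by norm_num)).clm_apply contDiff_const
  have hDc : ∀ j, HasCompactSupport fun x => fderiv ℝ f x (e j) := fun j =>
    hc.fderiv_apply ℝ (e j)
  have hf1 : ContDiff ℝ 1 f := hf.of_le (by norm_num)
  have cfd : ∀ {g : Rn n → ℂ} (v : Rn n), ContDiff ℝ 1 g → Continuous fun x => fderiv ℝ g x v :=
    fun v hg => (hg.continuous_fderiv (by simp)).clm_apply continuous_const
  have iA : ∀ j, Integrable fun x => fderiv ℝ h x (e j) * fderiv ℝ f x (e j) := fun j =>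
    ((cfd _ hC).mul (hDf j).continuous).integrable_of_hasCompactSupport (hDc j).mul_left
  have iA' : ∀ j, Integrable fun x => h x * fderiv ℝ (fun x => fderiv ℝ f x (e j)) x (e j) :=
    fun j => (hC.continuous.mul (cfd _ (hDf j))).integrable_of_hasCompactSupport
      ((hDc j).fderiv_apply ℝ (e j)).mul_left
  have iB : ∀ j, Integrable fun x => cut y ψ (potentialGrad y j) x * fderiv ℝ f x (e j) :=
    fun j => ((hCj j).continuous.mul (hDf j).continuous).integrable_of_hasCompactSupport
      (hDc j).mul_left
  have iC : ∀ j, Integrable fun x => fderiv ℝ (cut y ψ (potentialGrad y j)) x (e j) * f x :=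
    fun j => ((cfd _ (hCj j)).mul hf.continuous).integrable_of_hasCompactSupport hc.mul_left
  have p1 : ∀ j, ∫ x, h x * fderiv ℝ (fun x => fderiv ℝ f x (e j)) x (e j) =
      -∫ x, fderiv ℝ h x (e j) * fderiv ℝ f x (e j) := fun j =>
    integral_mul_fderiv_eq_neg_fderiv_mul_of_integrable (iA j) (iA' j)
      ((hC.continuous.mul (hDf j).continuous).integrable_of_hasCompactSupport (hDc j).mul_left)
      (fun x _ => hC.differentiable (by simp) x) (fun x _ => (hDf j).differentiable (by simp) x)
  have p2 : ∀ j, ∫ x, cut y ψ (potentialGrad y j) x * fderiv ℝ f x (e j) =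
      -∫ x, fderiv ℝ (cut y ψ (potentialGrad y j)) x (e j) * f x := fun j =>
    integral_mul_fderiv_eq_neg_fderiv_mul_of_integrable (iC j) (iB j)
      (((hCj j).continuous.mul hf.continuous).integrable_of_hasCompactSupport hc.mul_left)
      (fun x _ => (hCj j).differentiable (by simp) x) (fun x _ => hf1.differentiable (by simp) x)
  have s1 : ∫ x, h x * Laplacian.laplacian f x =
      ∑ j, ∫ x, h x * fderiv ℝ (fun x => fderiv ℝ f x (e j)) x (e j) := by
    rw [← integral_finsetSum _ fun j _ => iA' j]
    simp only [laplacian_eq_sum hf, Finset.mul_sum, he]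
  have iN : ∀ j, Integrable fun x => -(fderiv ℝ h x (e j) * fderiv ℝ f x (e j)) :=
    fun j => (iA j).neg
  have iAB : ∀ j, Integrable fun x => -(fderiv ℝ h x (e j) * fderiv ℝ f x (e j)) +
      cut y ψ (potentialGrad y j) x * fderiv ℝ f x (e j) := fun j => (iN j).add (iB j)
  have iABC : ∀ j, Integrable fun x => -(fderiv ℝ h x (e j) * fderiv ℝ f x (e j)) +
      cut y ψ (potentialGrad y j) x * fderiv ℝ f x (e j) +
      fderiv ℝ (cut y ψ (potentialGrad y j)) x (e j) * f x := fun j => (iAB j).add (iC j)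
  -- One integration by parts, plus the integral of the total derivative `∂_j (ψ ∂_jφ f)`, which is
  -- zero. In this arrangement `ψ` is differentiated only once.
  have s2 : ∀ j, ∫ x, h x * fderiv ℝ (fun x => fderiv ℝ f x (e j)) x (e j) =
      ∫ x, (-(fderiv ℝ h x (e j) * fderiv ℝ f x (e j)) +
        cut y ψ (potentialGrad y j) x * fderiv ℝ f x (e j) +
        fderiv ℝ (cut y ψ (potentialGrad y j)) x (e j) * f x) := by
    intro j
    rw [integral_add (iAB j) (iC j), integral_add (iN j) (iB j),
      integral_neg, p1 j, p2 j]
    ring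
  rw [s1, Finset.sum_congr rfl fun j _ => s2 j,
    ← integral_finsetSum _ fun j _ => iABC j]
  refine integral_congr_ae (Eventually.of_forall fun x => ?_)
  have d1 : ∀ j, fderiv ℝ h x (e j) = _ := fun j =>
    fderiv_cut hε hψ hz (v := e j) fun hx => hasFDerivAt_potential hn hx j
  have d2 : ∀ j, fderiv ℝ (cut y ψ (potentialGrad y j)) x (e j) = _ := fun j =>
    fderiv_cut hε hψ hz (v := e j) fun hx => hasFDerivAt_potentialGrad hx j
  simp only [d1, d2]
  simp only [he, zform_single, cut]
  -- This is `ψ Δφ`: zero by harmonicity where `p > ε`, and by the cutoff elsewhere.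
  have hlap : (ψ (clen y x).re : ℂ) * ∑ j, (1 / (sphereArea n : ℂ) *
      (clen y x ^ (-(n : ℤ)) - n * cpoint x y j ^ 2 * clen y x ^ (-(n : ℤ) - 2))) = 0 := by
    rw [← Finset.mul_sum]
    rcases lt_or_ge ε (clen y x).re with hx | hx
    · rw [sum_potentialHess (hε.trans hx)]; simp
    · rw [hz _ hx]; simp
  rw [← sub_eq_zero, Finset.mul_sum, ← Finset.sum_sub_distrib]
  rw [Finset.mul_sum] at hlap
  refine Eq.trans ?_ ((congrArg (f x * ·) hlap).trans (mul_zero _))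
  simp only [Finset.mul_sum]
  refine Finset.sum_congr rfl fun j _ => ?_
  ring

end ComplexSource

end

/-! ### The flux in spheroidal coordinates -/

noncomputable section

namespace ComplexSource

variable {n : ℕ}

lemma clen_re_sq_sub (y x : Rn n) :
    (clen y x).re ^ 2 - (clen y x).im ^ 2 = ‖x‖ ^ 2 - ‖y‖ ^ 2 := by
  rw [← csq_re, ← clen_sq, pow_two (clen y x), Complex.mul_re]; ring

lemma clen_re_mul_im (y x : Rn n) : (clen y x).re * (clen y x).im = ∑ j, x j * y j := by
  have h := csq_im y x
  rw [← clen_sq, pow_two (clen y x), Complex.mul_im] at h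
  linarith

/-- The direction of `∂ₚ` in spheroidal coordinates. -/
def dirP (y x : Rn n) : Rn n :=
  (1 / (‖y‖ ^ 2 + (clen y x).re ^ 2)) • ((clen y x).re • x + (clen y x).im • y)

/-- The square of the gradient of `p`. -/
def gradSq (y x : Rn n) : ℝ :=
  (‖y‖ ^ 2 + (clen y x).re ^ 2) / ((clen y x).re ^ 2 + (clen y x).im ^ 2)

lemma re_cpoint_div (y x : Rn n) (j : Fin n) : (cpoint x y j / clen y x).re =
    (x j * (clen y x).re + y j * (clen y x).im) / ((clen y x).re ^ 2 + (clen y x).im ^ 2) := by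
  rw [Complex.div_re, Complex.normSq_apply]
  simp only [cpoint, Complex.add_re, Complex.ofReal_re, Complex.mul_re, Complex.I_re,
    Complex.add_im, Complex.ofReal_im, Complex.mul_im, Complex.I_im]
  ring

/-- Since `Re (z_j / γ) = ∂_j p` for `p > 0`, this evaluates `∇p · z`. It follows from `|x|² = a² +
p² - q²` and `x · y = p q`. -/
lemma sum_re_mul_cpoint (y x : Rn n) :
    ∑ j, ((cpoint x y j / clen y x).re : ℂ) * cpoint x y j = (gradSq y x : ℂ) * clen y x := by
  have hx : ∑ j, x j * x j = ‖x‖ ^ 2 := by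
    rw [EuclideanSpace.norm_sq_eq]; simp [pow_two]
  have hyy : ∑ j, y j * y j = ‖y‖ ^ 2 := by
    rw [EuclideanSpace.norm_sq_eq]; simp [pow_two]
  have hxy := clen_re_mul_im y x
  have hs := clen_re_sq_sub y x
  set D := (clen y x).re ^ 2 + (clen y x).im ^ 2 with hD
  have e1 : ∑ j, (x j * (clen y x).re + y j * (clen y x).im) / D * x j =
      ((clen y x).re * ‖x‖ ^ 2 + (clen y x).im * ((clen y x).re * (clen y x).im)) / D := by
    rw [hxy, ← hx, Finset.mul_sum, Finset.mul_sum, ← Finset.sum_add_distrib, Finset.sum_div]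
    exact Finset.sum_congr rfl fun j _ => by ring
  have e2 : ∑ j, (x j * (clen y x).re + y j * (clen y x).im) / D * y j =
      ((clen y x).re * ((clen y x).re * (clen y x).im) + (clen y x).im * ‖y‖ ^ 2) / D := by
    rw [hxy, ← hyy, Finset.mul_sum, Finset.mul_sum, ← Finset.sum_add_distrib, Finset.sum_div]
    exact Finset.sum_congr rfl fun j _ => by ring
  apply Complex.ext
  · simp only [Complex.re_sum, Complex.re_ofReal_mul, re_cpoint_div, ← hD, gradSq]
    simp only [cpoint, Complex.add_re, Complex.ofReal_re, Complex.mul_re, Complex.I_re,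
      Complex.ofReal_im, Complex.I_im]
    simp only [zero_mul, mul_zero, sub_zero, add_zero]
    rw [e1, show ‖x‖ ^ 2 = ‖y‖ ^ 2 + (clen y x).re ^ 2 - (clen y x).im ^ 2 by linarith]
    ring
  · simp only [Complex.im_sum, Complex.im_ofReal_mul, re_cpoint_div, ← hD, gradSq]
    simp only [cpoint, Complex.add_im, Complex.ofReal_re, Complex.mul_im, Complex.I_re,
      Complex.ofReal_im, Complex.I_im]
    simp only [zero_mul, one_mul, zero_add]
    rw [e2]
    ring

/-- Spheroidal coordinates are orthogonal, so `∇p` is parallel to the direction of `∂_p`; the flux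
therefore sees only the derivative of `f` along `p`. -/
lemma sum_re_smul_single {y : Rn n} (hy : y ≠ 0) (x : Rn n) :
    ∑ j, (cpoint x y j / clen y x).re • EuclideanSpace.single j (1 : ℝ) =
      gradSq y x • dirP y x := by
  ext i
  have ha : 0 < ‖y‖ := norm_pos_iff.2 hy
  have h1 : (∑ j, (cpoint x y j / clen y x).re • EuclideanSpace.single j (1 : ℝ) : Rn n) i =
      (cpoint x y i / clen y x).re := by
    rw [WithLp.ofLp_sum, Finset.sum_apply, Finset.sum_eq_single i]
    · simp
    · intro j _ hj; simp [hj.symm]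
    · simp
  rw [h1, re_cpoint_div]
  have : ‖y‖ ^ 2 + (clen y x).re ^ 2 ≠ 0 := by positivity
  simp [gradSq, dirP]
  field_simp

/-- The flux density of `φ ∇f - f ∇φ` through the level sets of `p`. -/
lemma sum_flux (hn : 3 ≤ n) {y : Rn n} (hy : y ≠ 0) {x : Rn n} (h : 0 < (clen y x).re)
    (f : Rn n → ℂ) :
    ∑ j, ((cpoint x y j / clen y x).re : ℂ) * (potentialGrad y j x * f x -
      potential (cpoint x y) * fderiv ℝ f x (EuclideanSpace.single j 1)) =
    1 / (sphereArea n : ℂ) * (gradSq y x : ℂ) *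
      ((f x + clen y x * fderiv ℝ f x (dirP y x) / ((n : ℂ) - 2)) / clen y x ^ (n - 1)) := by
  have h2 : ∑ j, ((cpoint x y j / clen y x).re : ℂ) * fderiv ℝ f x (EuclideanSpace.single j 1) =
      (gradSq y x : ℂ) * fderiv ℝ f x (dirP y x) := by
    have := congrArg (fderiv ℝ f x) (sum_re_smul_single hy x)
    simpa [map_sum, Complex.real_smul] using this
  have h1 := sum_re_mul_cpoint y x
  have e : ∑ j, ((cpoint x y j / clen y x).re : ℂ) * (potentialGrad y j x * f x -
      potential (cpoint x y) * fderiv ℝ f x (EuclideanSpace.single j 1)) =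
      1 / (sphereArea n : ℂ) * clen y x ^ (-(n : ℤ)) * f x *
        (∑ j, ((cpoint x y j / clen y x).re : ℂ) * cpoint x y j) -
      potential (cpoint x y) *
        ∑ j, ((cpoint x y j / clen y x).re : ℂ) * fderiv ℝ f x (EuclideanSpace.single j 1) := by
    rw [Finset.mul_sum, Finset.mul_sum, ← Finset.sum_sub_distrib]
    refine Finset.sum_congr rfl fun j _ => ?_
    rw [potentialGrad]; ring
  rw [e, h1, h2, potential, show complexLength (cpoint x y) = clen y x from rfl]
  have h0 := clen_ne_zero h
  obtain ⟨m, rfl⟩ : ∃ m, n = m + 1 := ⟨n - 1, by omega⟩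
  have hm : ((m + 1 : ℕ) : ℂ) - 2 ≠ 0 := by
    rw [sub_ne_zero]; norm_cast; omega
  have e1 : clen y x ^ (-((m + 1 : ℕ) : ℤ)) = (clen y x ^ m)⁻¹ * (clen y x)⁻¹ := by
    rw [zpow_neg, zpow_natCast, pow_succ, mul_inv]
  have e2 : clen y x ^ ((2 : ℤ) - ((m + 1 : ℕ) : ℤ)) = (clen y x ^ m)⁻¹ * clen y x := by
    rw [show (2 : ℤ) - ((m + 1 : ℕ) : ℤ) = -(m : ℤ) + 1 by push_cast; ring, zpow_add₀ h0,
      zpow_neg, zpow_natCast, zpow_one]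
  rw [e1, e2, show m + 1 - 1 = m by omega,
    show (2 : ℂ) - ((m + 1 : ℕ) : ℂ) = -(((m + 1 : ℕ) : ℂ) - 2) by ring]
  have hm' : clen y x ^ m ≠ 0 := pow_ne_zero _ h0
  generalize ((m + 1 : ℕ) : ℂ) - 2 = N at hm
  field_simp
  ring

lemma sphereIncl_inner (y : Rn n) (σ : Metric.sphere (0 : (ℝ ∙ y)ᗮ) 1) :
    inner ℝ y (sphereIncl y σ) = 0 :=
  Submodule.mem_orthogonal_singleton_iff_inner_right.1 σ.1.2

lemma norm_sphereIncl (y : Rn n) (σ : Metric.sphere (0 : (ℝ ∙ y)ᗮ) 1) : ‖sphereIncl y σ‖ = 1 := by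
  have := σ.2
  rw [mem_sphere_zero_iff_norm] at this
  exact this

lemma norm_sq_cylPoint {y : Rn n} (hy : y ≠ 0) (v : ℝ × ℝ)
    (σ : Metric.sphere (0 : (ℝ ∙ y)ᗮ) 1) :
    ‖cylPoint y v (sphereIncl y σ)‖ ^ 2 = v.1 ^ 2 + v.2 ^ 2 := by
  have ha : ‖y‖ ≠ 0 := norm_ne_zero_iff.2 hy
  have h1 := sphereIncl_inner y σ
  have h2 := norm_sphereIncl y σ
  have h3 : inner ℝ (sphereIncl y σ) y = (0 : ℝ) := by rw [real_inner_comm]; exact h1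
  rw [cylPoint, ← real_inner_self_eq_norm_sq]
  simp only [inner_add_left, inner_add_right, real_inner_smul_left, real_inner_smul_right,
    real_inner_self_eq_norm_sq, h1, h3]
  simp [norm_smul, h2, mul_pow, div_pow]
  field_simp

/-- The square of the complex length in cylindrical coordinates. -/
def cylSq (a : ℝ) (v : ℝ × ℝ) : ℂ :=
  ((v.1 ^ 2 + v.2 ^ 2 - a ^ 2 : ℝ) : ℂ) + Complex.I * ((2 * a * v.2 : ℝ) : ℂ)

/-- The complex length in cylindrical coordinates. -/
def cylLen (a : ℝ) (v : ℝ × ℝ) : ℂ := cylSq a v ^ (1 / 2 : ℂ)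

/-- `z²` involves only `|x|²` and `x · y`, so `γ` does not depend on the angle and factors out of
averages. -/
lemma clen_cylPoint {y : Rn n} (hy : y ≠ 0) (v : ℝ × ℝ) (σ : Metric.sphere (0 : (ℝ ∙ y)ᗮ) 1) :
    clen y (cylPoint y v (sphereIncl y σ)) = cylLen ‖y‖ v := by
  have ha : ‖y‖ ≠ 0 := norm_ne_zero_iff.2 hy
  have h1 := sphereIncl_inner y σ
  rw [clen_eq, cylLen]
  congr 1
  apply Complex.ext
  · rw [csq_re, norm_sq_cylPoint hy]
    simp [cylSq]
    norm_cast
  · have e : ∀ x : Rn n, ∑ j, x j * y j = inner ℝ y x := by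
      intro x
      simp [PiLp.inner_apply]
    rw [csq_im, e, cylPoint]
    simp only [inner_add_right, real_inner_smul_right, real_inner_self_eq_norm_sq, h1]
    simp [cylSq]
    field_simp
    norm_cast
    ring

lemma cylLen_cylOf {a p q : ℝ} (ha : 0 < a) (hp : 0 < p) (hq : |q| ≤ a) :
    cylLen a (cylOf a (p, q)) = gam p q := by
  rw [cylLen, show cylSq a (cylOf a (p, q)) = gam p q ^ 2 from ?_]
  · exact cpow_half_of_sq (by rwa [gam_re])
  · rw [cylSq, cylOf]
    simp only
    rw [rhoCoord_sq ha hq, zetaCoord, gam]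
    have : ((a ^ 2 + p ^ 2) * (a ^ 2 - q ^ 2) / a ^ 2 + (p * q / a) ^ 2 - a ^ 2) = p ^ 2 - q ^ 2 := by
      field_simp; ring
    rw [this, show 2 * a * (p * q / a) = 2 * p * q by field_simp]
    push_cast
    linear_combination (-(q : ℂ) ^ 2) * Complex.I_sq

/-- Points of the open half plane with `p > 0` have spheroidal coordinates. -/
lemma exists_cylOf_eq {a : ℝ} (ha : 0 < a) {v : ℝ × ℝ} (hv : 0 < v.1) (h : 0 < (cylLen a v).re) :
    |(cylLen a v).im| < a ∧ cylOf a ((cylLen a v).re, (cylLen a v).im) = v := by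
  have hs : cylLen a v ^ 2 = cylSq a v := cpow_half_sq _
  have h1 : (cylLen a v).re ^ 2 - (cylLen a v).im ^ 2 = v.1 ^ 2 + v.2 ^ 2 - a ^ 2 := by
    have := congrArg Complex.re hs
    rw [pow_two, Complex.mul_re] at this
    simp [cylSq] at this
    norm_cast at this
    linarith
  have h2 : (cylLen a v).re * (cylLen a v).im = a * v.2 := by
    have := congrArg Complex.im hs
    rw [pow_two, Complex.mul_im] at this
    simp [cylSq] at this
    norm_cast at this
    linarith
  set p := (cylLen a v).re
  set q := (cylLen a v).im
  -- The right side is positive off the axis, which forces `|q| < a`; its square root recovers the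
  -- cylindrical radius.
  have h3 : (a ^ 2 + p ^ 2) * (a ^ 2 - q ^ 2) = (a * v.1) ^ 2 := by
    linear_combination a ^ 2 * h1 - (p * q + a * v.2) * h2
  refine ⟨?_, ?_⟩
  · refine abs_lt_of_sq_lt_sq ?_ ha.le
    have : 0 < (a ^ 2 + p ^ 2) * (a ^ 2 - q ^ 2) := by rw [h3]; positivity
    have := pos_of_mul_pos_right this (by positivity)
    linarith
  · ext
    · simp only [cylOf, rhoCoord]
      rw [h3, Real.sqrt_sq (by positivity)]
      field_simp
    · simp only [cylOf, zetaCoord]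
      rw [h2]
      field_simp

end ComplexSource

end

/-! ### Integration in cylindrical coordinates -/

noncomputable section

namespace ComplexSource

variable {n : ℕ}

lemma finrank_orthogonal {y : Rn n} (hy : y ≠ 0) : Module.finrank ℝ (ℝ ∙ y)ᗮ = n - 1 := by
  have h := Submodule.finrank_add_finrank_orthogonal (ℝ ∙ y)
  rw [finrank_span_singleton hy, finrank_euclideanSpace, Fintype.card_fin] at h
  omega

lemma sphereMeas_univ (hn : 3 ≤ n) {y : Rn n} (hy : y ≠ 0) :
    (sphereMeas y).real Set.univ = sphereArea (n - 1) := by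
  have hd := finrank_orthogonal hy
  have hnt : Nontrivial (ℝ ∙ y)ᗮ := Module.nontrivial_of_finrank_pos (R := ℝ) (by omega)
  have hpos : (0 : ℝ) < ((n - 1 : ℕ) : ℝ) / 2 := by
    have : (0 : ℝ) < ((n - 1 : ℕ) : ℝ) := by exact_mod_cast (by omega : 0 < n - 1)
    positivity
  have hG := Real.Gamma_pos_of_pos hpos
  rw [sphereMeas, Measure.toSphere_real_apply_univ, measureReal_def,
    InnerProductSpace.volume_ball, hd, ENNReal.ofReal_one, one_pow, one_mul,
    ENNReal.toReal_ofReal (by rw [Real.Gamma_add_one hpos.ne']; positivity),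
    Real.Gamma_add_one hpos.ne', sphereArea]
  have e : √Real.pi ^ (n - 1) = Real.pi ^ (((n - 1 : ℕ) : ℝ) / 2) := by
    rw [Real.sqrt_eq_rpow, ← Real.rpow_natCast, ← Real.rpow_mul Real.pi_pos.le]
    congr 1; ring
  rw [e]
  have hn0 : ((n - 1 : ℕ) : ℝ) ≠ 0 := by exact_mod_cast (by omega : n - 1 ≠ 0)
  field_simp

/-- Integration in polar coordinates. -/
lemma integral_polar {E : Type*} [NormedAddCommGroup E] [NormedSpace ℝ E] [MeasurableSpace E]
    [Nontrivial E] (μ : Measure E) [FiniteDimensional ℝ E] [BorelSpace E] [μ.IsAddHaarMeasure]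
    {F : Type*} [NormedAddCommGroup F] [NormedSpace ℝ F] {g : E → F} (hg : Integrable g μ) :
    ∫ x, g x ∂μ = ∫ r in Set.Ioi (0 : ℝ),
      r ^ (Module.finrank ℝ E - 1) • ∫ σ : Metric.sphere (0 : E) 1, g (r • (σ : E)) ∂μ.toSphere := by
  have hemb := (homeomorphUnitSphereProd E).measurableEmbedding
  have hmp := μ.measurePreserving_homeomorphUnitSphereProd
  have hval : ∀ x : ({0}ᶜ : Set E),
      ((homeomorphUnitSphereProd E x).2 : ℝ) • ((homeomorphUnitSphereProd E x).1 : E) = x := by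
    intro x
    have := congrArg Subtype.val ((homeomorphUnitSphereProd E).symm_apply_apply x)
    rwa [homeomorphUnitSphereProd_symm_apply_coe] at this
  let G : Metric.sphere (0 : E) 1 × Set.Ioi (0 : ℝ) → F := fun z => g ((z.2 : ℝ) • (z.1 : E))
  have hG : ∀ x, G (homeomorphUnitSphereProd E x) = g x := fun x => congrArg g (hval x)
  have hi : Integrable G (μ.toSphere.prod (.volumeIoiPow (Module.finrank ℝ E - 1))) := by
    rw [← hmp.integrable_comp_emb hemb]
    have : G ∘ homeomorphUnitSphereProd E = g ∘ Subtype.val := funext hG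
    rw [this, ← integrableOn_iff_comap_subtypeVal (measurableSet_singleton _).compl]
    exact hg.integrableOn
  calc ∫ x, g x ∂μ = ∫ x : ({(0)}ᶜ : Set E), g x.1 ∂(μ.comap (↑)) := by
        rw [integral_subtype_comap (measurableSet_singleton _).compl g,
          restrict_compl_singleton]
    _ = ∫ z, G z ∂μ.toSphere.prod (.volumeIoiPow (Module.finrank ℝ E - 1)) := by
        rw [← hmp.integral_comp hemb]
        exact integral_congr_ae (Eventually.of_forall fun x => (hG x).symm)
    _ = ∫ r : Set.Ioi (0 : ℝ), (∫ σ, G (σ, r) ∂μ.toSphere)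
          ∂(.volumeIoiPow (Module.finrank ℝ E - 1)) := integral_prod_symm _ hi
    _ = _ := by
      simp only [Measure.volumeIoiPow, ENNReal.ofReal]
      rw [integral_withDensity_eq_integral_smul,
        integral_subtype_comap measurableSet_Ioi fun a =>
          Real.toNNReal (a ^ (Module.finrank ℝ E - 1)) •
            ∫ σ : Metric.sphere (0 : E) 1, g (a • (σ : E)) ∂μ.toSphere,
        setIntegral_congr_fun measurableSet_Ioi fun x hx => ?_]
      · simp only [NNReal.smul_def]
        rw [Real.coe_toNNReal _ (pow_nonneg (le_of_lt hx) _)]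
      · exact (measurable_subtype_coe.pow_const _).real_toNNReal

/-- The axis of `y`, parametrized by arc length. -/
def axisEquiv {y : Rn n} (hy : y ≠ 0) : ℝ ≃ₗᵢ[ℝ] (ℝ ∙ y) :=
  LinearIsometry.toLinearIsometryEquiv
    { toFun := fun t => ⟨(t / ‖y‖) • y, Submodule.smul_mem _ _ (Submodule.mem_span_singleton_self y)⟩
      map_add' := fun s t => by ext1; simp [add_div, add_smul]
      map_smul' := fun s t => by ext1; simp [mul_div_assoc, mul_smul]
      norm_map' := fun t => by
        have : ‖y‖ ≠ 0 := norm_ne_zero_iff.2 hy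
        change ‖(t / ‖y‖) • y‖ = ‖t‖
        rw [norm_smul, norm_div, norm_norm]
        field_simp }
    (by rw [finrank_span_singleton hy, Module.finrank_self])

/-- The orthogonal splitting into the axis and its complement preserves volume, and the arc length
parametrization of the axis is an isometry. -/
lemma integral_axis_orthogonal {y : Rn n} (hy : y ≠ 0) {H : Rn n → ℂ} (hH : Integrable H) :
    ∫ x, H x = ∫ t : ℝ, ∫ u : (ℝ ∙ y)ᗮ, H ((t / ‖y‖) • y + (u : Rn n)) := by
  have h1 := (ℝ ∙ y).measurePreserving_measurableEquivProd (0 : Rn n)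
  rw [InnerProductSpace.euclideanHausdorffMeasure_eq_volume] at h1
  have h2 := h1.symm
  have e : ∀ z, ((ℝ ∙ y).measurableEquivProd (0 : Rn n)).symm z = (z.1 : Rn n) + (z.2 : Rn n) := by
    intro z; simp
  have hi : Integrable fun z : (ℝ ∙ y) × (ℝ ∙ y)ᗮ => H ((z.1 : Rn n) + (z.2 : Rn n)) := by
    have := (h2.integrable_comp_emb (MeasurableEquiv.measurableEmbedding _)).2 hH
    refine this.congr (Eventually.of_forall fun z => ?_)
    exact congrArg H (e z)
  have h3 := h2.integral_comp (MeasurableEquiv.measurableEmbedding _) H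
  rw [← h3]
  simp only [e]
  rw [Measure.volume_eq_prod] at hi ⊢
  rw [integral_prod _ hi]
  have h4 := (axisEquiv hy).measurePreserving
  rw [← h4.integral_comp (axisEquiv hy).toHomeomorph.measurableEmbedding
    (fun s => ∫ u : (ℝ ∙ y)ᗮ, H ((s : Rn n) + (u : Rn n)))]
  rfl

lemma integral_sphereMeas (hn : 3 ≤ n) {y : Rn n} (hy : y ≠ 0) (H : Rn n → ℂ) (v : ℝ × ℝ) :
    ∫ σ, H (cylPoint y v (sphereIncl y σ)) ∂(sphereMeas y) =
      (sphereArea (n - 1) : ℂ) * cylMean y H v := by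
  have hpos : (0 : ℝ) < ((n - 1 : ℕ) : ℝ) / 2 := by
    have : (0 : ℝ) < ((n - 1 : ℕ) : ℝ) := by exact_mod_cast (by omega : 0 < n - 1)
    positivity
  have hA : sphereArea (n - 1) ≠ 0 := by
    have := Real.Gamma_pos_of_pos hpos
    rw [sphereArea]
    have := Real.pi_pos
    positivity
  rw [cylMean_eq, sphereMeas_univ hn hy]
  simp only
  rw [Complex.real_smul, ← mul_assoc, ← Complex.ofReal_mul,
    mul_inv_cancel₀ hA]
  simp

/-- Integration in cylindrical coordinates about the axis of `y`. -/
theorem integral_cylindrical (hn : 3 ≤ n) {y : Rn n} (hy : y ≠ 0) {H : Rn n → ℂ}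
    (hH : Continuous H) (hc : HasCompactSupport H) :
    ∫ x, H x = (sphereArea (n - 1) : ℂ) *
      ∫ v in Set.Ioi (0 : ℝ) ×ˢ (Set.univ : Set ℝ), ((v.1 ^ (n - 2) : ℝ) : ℂ) * cylMean y H v := by
  have hd := finrank_orthogonal hy
  have hnt : Nontrivial (ℝ ∙ y)ᗮ := Module.nontrivial_of_finrank_pos (R := ℝ) (by omega)
  have hcm : Continuous (cylMean y H) :=
    (contDiff_cylMean y (m := 0) (contDiff_zero.2 hH)).continuous
  have hcs : HasCompactSupport (cylMean y H) := by
    obtain ⟨R, hR⟩ := hc.isCompact.isBounded.subset_closedBall (0 : Rn n)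
    refine HasCompactSupport.of_support_subset_isCompact (isCompact_closedBall (0 : ℝ × ℝ) |R|) ?_
    intro v hv
    by_contra hvR
    apply hv
    rw [cylMean_eq]
    have : ∀ σ, H (cylPoint y v (sphereIncl y σ)) = 0 := by
      intro σ
      by_contra h0
      apply hvR
      have h1 := hR (subset_tsupport _ h0)
      rw [mem_closedBall_zero_iff] at h1 ⊢
      have h2 := norm_sq_cylPoint hy v σ
      have h3 : ‖cylPoint y v (sphereIncl y σ)‖ ^ 2 ≤ |R| ^ 2 :=
        pow_le_pow_left₀ (norm_nonneg _) (h1.trans (le_abs_self R)) 2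
      rw [h2] at h3
      refine max_le ?_ ?_
      · exact abs_le_of_sq_le_sq (by nlinarith [sq_nonneg v.2]) (abs_nonneg R)
      · exact abs_le_of_sq_le_sq (by nlinarith [sq_nonneg v.1]) (abs_nonneg R)
    simp [this]
  have hintg : Integrable fun v : ℝ × ℝ => ((v.1 ^ (n - 2) : ℝ) : ℂ) * cylMean y H v :=
    Continuous.integrable_of_hasCompactSupport
      ((Complex.continuous_ofReal.comp (continuous_fst.pow _)).mul hcm) hcs.mul_left
  rw [integral_axis_orthogonal hy (hH.integrable_of_hasCompactSupport hc)]
  have hin : ∀ t : ℝ, ∫ u : (ℝ ∙ y)ᗮ, H ((t / ‖y‖) • y + (u : Rn n)) =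
      ∫ r in Set.Ioi (0 : ℝ), (sphereArea (n - 1) : ℂ) *
        (((r ^ (n - 2) : ℝ) : ℂ) * cylMean y H (r, t)) := by
    intro t
    have hgc : Continuous fun u : (ℝ ∙ y)ᗮ => H ((t / ‖y‖) • y + (u : Rn n)) :=
      hH.comp (continuous_const.add continuous_subtype_val)
    have hgs : HasCompactSupport fun u : (ℝ ∙ y)ᗮ => H ((t / ‖y‖) • y + (u : Rn n)) :=
      hc.comp_isClosedEmbedding ((Homeomorph.addLeft _).isClosedEmbedding.comp
        (Submodule.closed_of_finiteDimensional (ℝ ∙ y)ᗮ).isClosedEmbedding_subtypeVal)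
    rw [integral_polar volume (hgc.integrable_of_hasCompactSupport hgs), hd]
    refine setIntegral_congr_fun measurableSet_Ioi fun r _ => ?_
    have e := integral_sphereMeas hn hy H (r, t)
    rw [mul_left_comm, ← e, show n - 1 - 1 = n - 2 by omega, Complex.real_smul]
    congr 1
    refine integral_congr_ae (Eventually.of_forall fun σ => ?_)
    simp only [cylPoint, sphereIncl]
    rw [add_comm]
    rfl
  simp only [hin]
  simp only [integral_const_mul]
  congr 1
  have hm : (volume : Measure (ℝ × ℝ)).restrict (Set.Ioi (0 : ℝ) ×ˢ Set.univ) =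
      (volume.restrict (Set.Ioi (0 : ℝ))).prod volume := by
    rw [Measure.volume_eq_prod, ← Measure.prod_restrict, Measure.restrict_univ]
  rw [hm, integral_prod_symm]
  rw [← hm]
  exact hintg.integrableOn

end ComplexSource

end

/-! ### Change of variables to spheroidal coordinates -/

noncomputable section

namespace ComplexSource

variable {n : ℕ}

/-- The derivative of the map from spheroidal to cylindrical coordinates. -/
def fderivCylOf (a : ℝ) (x : ℝ × ℝ) : ℝ × ℝ →L[ℝ] ℝ × ℝ :=
  (Matrix.toLin (.finTwoProd ℝ) (.finTwoProd ℝ)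
    !![x.1 * (rhoCoord a x.1 x.2 / (a ^ 2 + x.1 ^ 2)),
      -(x.2 * (rhoCoord a x.1 x.2 / (a ^ 2 - x.2 ^ 2))); x.2 / a, x.1 / a]).toContinuousLinearMap

lemma sq_sub_sq_pos {a q : ℝ} (hq : |q| < a) : 0 < a ^ 2 - q ^ 2 := by
  nlinarith [abs_nonneg q, sq_abs q]

lemma rhoCoord_pos {a p q : ℝ} (ha : 0 < a) (hq : |q| < a) : 0 < rhoCoord a p q := by
  have := sq_sub_sq_pos hq
  rw [rhoCoord]
  positivity

lemma hasFDerivAt_cylOf {a : ℝ} (ha : 0 < a) {x : ℝ × ℝ} (hq : |x.2| < a) :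
    HasFDerivAt (cylOf a) (fderivCylOf a x) x := by
  have hA : (0 : ℝ) < a ^ 2 + x.1 ^ 2 := by positivity
  have hB := sq_sub_sq_pos hq
  have hAB : 0 < (a ^ 2 + x.1 ^ 2) * (a ^ 2 - x.2 ^ 2) := mul_pos hA hB
  have h1 := (((hasFDerivAt_fst (𝕜 := ℝ) (E := ℝ) (F := ℝ) (p := x)).pow 2).const_add
    (a ^ 2)).mul (((hasFDerivAt_snd (𝕜 := ℝ) (E := ℝ) (F := ℝ) (p := x)).pow 2).const_sub (a ^ 2))
  have h2 := (h1.sqrt hAB.ne').mul_const a⁻¹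
  have h3 := ((hasFDerivAt_fst (𝕜 := ℝ) (E := ℝ) (F := ℝ) (p := x)).mul hasFDerivAt_snd).mul_const a⁻¹
  have h4 := h2.prodMk h3
  unfold fderivCylOf
  rw [Matrix.toLin_finTwoProd_toContinuousLinearMap]
  refine (h4.congr_fderiv ?_)
  set s := √((a ^ 2 + x.1 ^ 2) * (a ^ 2 - x.2 ^ 2)) with hs
  have hs0 : s ≠ 0 := (Real.sqrt_pos.2 hAB).ne'
  have hss : s ^ 2 = (a ^ 2 + x.1 ^ 2) * (a ^ 2 - x.2 ^ 2) := Real.sq_sqrt hAB.le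
  have hr : rhoCoord a x.1 x.2 = s / a := rfl
  rw [hr]
  ext
  · simp
    field_simp
    rw [← hs]
    linear_combination (-x.1) * hss
  · simp
    field_simp
  · simp
    field_simp
    rw [← hs]
    linear_combination (-x.2) * hss
  · simp
    field_simp

/-- The numerator `|γ|²` will cancel the denominator of `|∇p|²` in the flux. -/
lemma det_fderivCylOf {a : ℝ} (ha : 0 < a) {x : ℝ × ℝ} (hq : |x.2| < a) :
    (fderivCylOf a x).det = (x.1 ^ 2 + x.2 ^ 2) / (a * rhoCoord a x.1 x.2) := by
  have hA : (0 : ℝ) < a ^ 2 + x.1 ^ 2 := by positivity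
  have hB := sq_sub_sq_pos hq
  have hr := rhoCoord_pos (p := x.1) ha hq
  have hr2 := rhoCoord_sq (p := x.1) ha hq.le
  unfold fderivCylOf
  simp only [LinearMap.det_toContinuousLinearMap, LinearMap.det_toLin, Matrix.det_fin_two_of]
  generalize rhoCoord a x.1 x.2 = r at *
  rw [eq_div_iff (by positivity)] at hr2
  field_simp
  linear_combination (x.1 ^ 2 + x.2 ^ 2) * hr2

/-- Change of variables from cylindrical to spheroidal coordinates. -/
lemma integral_cylOf {a : ℝ} (ha : 0 < a) {g : ℝ × ℝ → ℂ}
    (hg : ∀ v, (cylLen a v).re ≤ 0 → g v = 0) :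
    ∫ v in Set.Ioi (0 : ℝ) ×ˢ (Set.univ : Set ℝ), g v =
      ∫ x in Set.Ioi (0 : ℝ) ×ˢ Set.Ioo (-a) a,
        (((x.1 ^ 2 + x.2 ^ 2) / (a * rhoCoord a x.1 x.2) : ℝ) : ℂ) * g (cylOf a x) := by
  set s : Set (ℝ × ℝ) := Set.Ioi (0 : ℝ) ×ˢ Set.Ioo (-a) a with hs
  have hsm : MeasurableSet s := measurableSet_Ioi.prod measurableSet_Ioo
  have habs : ∀ x ∈ s, |x.2| < a := fun x hx => abs_lt.2 hx.2
  -- `cylLen` recovers `p + iq` from the cylindrical coordinates, the branch being fixed by `p > 0`.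
  have hinj : Set.InjOn (cylOf a) s := by
    intro x hx x' hx' h
    have h1 : gam x.1 x.2 = gam x'.1 x'.2 := by
      rw [← cylLen_cylOf ha hx.1 (habs x hx).le, ← cylLen_cylOf ha hx'.1 (habs x' hx').le]
      exact congrArg _ h
    ext
    · simpa [gam_re] using congrArg Complex.re h1
    · simpa [gam_im] using congrArg Complex.im h1
  have himg : cylOf a '' s ⊆ Set.Ioi (0 : ℝ) ×ˢ (Set.univ : Set ℝ) := by
    rintro _ ⟨x, hx, rfl⟩
    exact ⟨rhoCoord_pos ha (habs x hx), Set.mem_univ _⟩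
  have h1 := integral_image_eq_integral_abs_det_fderiv_smul volume hsm
    (fun x hx => (hasFDerivAt_cylOf ha (habs x hx)).hasFDerivWithinAt) hinj g
  -- The image misses only points of the half plane where `Re γ ≤ 0`, and there `g` vanishes.
  rw [setIntegral_eq_of_subset_of_forall_sdiff_eq_zero (measurableSet_Ioi.prod .univ) himg, h1]
  · refine setIntegral_congr_fun hsm fun x hx => ?_
    have h2 := rhoCoord_pos (p := x.1) ha (habs x hx)
    rw [det_fderivCylOf ha (habs x hx), abs_of_nonneg (by positivity), Complex.real_smul]
  · rintro v ⟨hv, hv'⟩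
    refine hg v ?_
    by_contra! hpos
    obtain ⟨hq, he⟩ := exists_cylOf_eq ha hv.1 hpos
    exact hv' ⟨((cylLen a v).re, (cylLen a v).im), ⟨hpos, abs_lt.1 hq⟩, he⟩

lemma fderiv_cylMean (y : Rn n) {f : Rn n → ℂ} (hf : ContDiff ℝ 1 f) (v w : ℝ × ℝ) :
    fderiv ℝ (cylMean y f) v w = ((sphereMeas y).real Set.univ)⁻¹ •
      ∫ σ, fderiv ℝ f (cylPoint y v (sphereIncl y σ)) (cylPoint y w (sphereIncl y σ))
        ∂(sphereMeas y) := by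
  have hG : ContDiff ℝ 1 fun x : (ℝ × ℝ) × Rn n => f (cylPoint y x.1 x.2) :=
    hf.comp (contDiff_cylPoint y)
  have h1 := (hasFDerivAt_integral_param (sphereMeas y) (continuous_sphereIncl y) hG v).const_smul
    ((sphereMeas y).real Set.univ)⁻¹
  have e := h1.congr_of_eventuallyEq (f₁ := cylMean y f)
    (Eventually.of_forall fun u => by rw [cylMean_eq]; rfl)
  rw [e.fderiv, smul_apply, ContinuousLinearMap.integral_apply]
  · congr 1
    refine integral_congr_ae (Eventually.of_forall fun σ => ?_)
    have h2 : HasFDerivAt (fun v : ℝ × ℝ => cylPoint y v (sphereIncl y σ))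
        ((ContinuousLinearMap.fst ℝ ℝ ℝ).smulRight (sphereIncl y σ) +
          (‖y‖⁻¹ • ContinuousLinearMap.snd ℝ ℝ ℝ).smulRight y) v := by
      have := ((ContinuousLinearMap.fst ℝ ℝ ℝ).smulRight (sphereIncl y σ) +
          (‖y‖⁻¹ • ContinuousLinearMap.snd ℝ ℝ ℝ).smulRight y).hasFDerivAt (x := v)
      refine this.congr_of_eventuallyEq (Eventually.of_forall fun u => ?_)
      simp [cylPoint, div_eq_inv_mul]
    have h3 := ((hf.differentiable one_ne_zero _).hasFDerivAt).comp v h2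
    have h4 := HasFDerivAt.comp v
      ((hG.differentiable one_ne_zero (v, sphereIncl y σ)).hasFDerivAt)
      (hasFDerivAt_prodMk_left (𝕜 := ℝ) v (sphereIncl y σ))
    have h5 := congrArg (fun T => T w) (h4.unique h3)
    simp only at h5 ⊢
    rw [h5]
    simp [cylPoint, div_eq_inv_mul]
  · have hc' : Continuous (fun σ =>
      (fderiv ℝ (fun x : (ℝ × ℝ) × Rn n => f (cylPoint y x.1 x.2)) (v, sphereIncl y σ)).comp
        (ContinuousLinearMap.inl ℝ (ℝ × ℝ) (Rn n))) := by
      have := hG.continuous_fderiv one_ne_zero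
      have := continuous_sphereIncl y
      fun_prop
    exact hc'.integrable_of_hasCompactSupport (HasCompactSupport.of_compactSpace _)

/-- `dirP` is the velocity along `p` of the point with fixed `q` and `σ`; averaging the derivative
of `f` in this direction therefore gives `∂_p f̄`. -/
lemma dirP_cylPoint {y : Rn n} (hy : y ≠ 0) {p q : ℝ} (hp : 0 < p) (hq : |q| ≤ ‖y‖)
    (σ : Metric.sphere (0 : (ℝ ∙ y)ᗮ) 1) :
    dirP y (cylPoint y (cylOf ‖y‖ (p, q)) (sphereIncl y σ)) =
      cylPoint y (cylDp ‖y‖ (p, q)) (sphereIncl y σ) := by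
  have ha : 0 < ‖y‖ := norm_pos_iff.2 hy
  have hA : (0 : ℝ) < ‖y‖ ^ 2 + p ^ 2 := by positivity
  rw [dirP, clen_cylPoint hy, cylLen_cylOf ha hp hq, gam_re, gam_im, cylPoint, cylPoint]
  simp only [cylOf, cylDp, zetaCoord]
  match_scalars
  · field_simp
  · field_simp
    ring

lemma rhoCoord_pow (hn : 3 ≤ n) {a p q : ℝ} (ha : 0 < a) (hq : |q| < a) :
    rhoCoord a p q ^ (n - 3) =
      (a ^ 2 + p ^ 2) ^ (((n : ℝ) - 3) / 2) * wgt n a q / a ^ (n - 3) := by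
  have hA : (0 : ℝ) ≤ a ^ 2 + p ^ 2 := by positivity
  have hB := (sq_sub_sq_pos hq).le
  have e : ∀ t : ℝ, 0 ≤ t → √t ^ (n - 3) = t ^ (((n : ℝ) - 3) / 2) := by
    intro t ht
    rw [Real.sqrt_eq_rpow, ← Real.rpow_natCast, ← Real.rpow_mul ht]
    congr 1
    push_cast [hn]
    ring
  rw [rhoCoord_eq ha, div_pow, mul_pow, e _ hA, e _ hB, wgt]

end ComplexSource

end

/-! ### The cut off source as an integral of `F` -/

noncomputable section

namespace ComplexSource

variable {n : ℕ}

/-- The action of the regularized source in terms of spherical means. -/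
def regSource (y : Rn n) (p : ℝ) (f : Rn n → ℂ) : ℂ :=
  (((‖y‖ ^ 2 + p ^ 2) ^ (((n : ℝ) - 1) / 2) / ‖y‖ ^ (n - 2) / areaRatio n : ℝ) : ℂ) *
    ∫ q in (-‖y‖)..‖y‖, bigF y f (p, q) / gam p q ^ (n - 1)

/-- The flux density of the potential and `f` through the level sets of `p`. -/
def flux (y : Rn n) (f : Rn n → ℂ) (x : Rn n) : ℂ :=
  ∑ j, ((cpoint x y j / clen y x).re : ℂ) * (potentialGrad y j x * f x -
    potential (cpoint x y) * fderiv ℝ f x (EuclideanSpace.single j 1))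

lemma continuous_cut_flux {y : Rn n} {ψ : ℝ → ℝ} {ε : ℝ} (hε : 0 < ε) (hψ : Continuous ψ)
    (hz : ∀ t ≤ ε, ψ t = 0) {f : Rn n → ℂ} (hf : ContDiff ℝ 1 f) :
    Continuous (cut y ψ (flux y f)) := by
  rw [← contDiff_zero (𝕜 := ℝ)]
  refine contDiff_cut hε (contDiff_zero.2 hψ) hz fun x hx => ?_
  unfold flux
  have hf0 : ContDiff ℝ 0 f := hf.of_le (by norm_num)
  have hf1 : ContDiff ℝ 0 (fderiv ℝ f) := contDiff_zero.2 (hf.continuous_fderiv one_ne_zero)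
  refine ContDiffAt.sum fun j _ => ContDiffAt.mul ?_ (ContDiffAt.sub ?_ ?_)
  · have h : ContDiffAt ℝ 0 (fun x => cpoint x y j / clen y x) x :=
      (contDiff_cpoint y j).contDiffAt.mul ((contDiffAt_clen hx).inv (clen_ne_zero hx))
    exact Complex.ofRealCLM.contDiff.contDiffAt.comp x
      (Complex.reCLM.contDiff.contDiffAt.comp x h)
  · exact (contDiffAt_potentialGrad hx j).mul hf0.contDiffAt
  · exact (contDiffAt_potential hx).mul (hf1.contDiffAt.clm_apply contDiffAt_const)

lemma hasCompactSupport_cut_flux {y : Rn n} {ψ : ℝ → ℝ} {f : Rn n → ℂ}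
    (hc : HasCompactSupport f) : HasCompactSupport (cut y ψ (flux y f)) := by
  refine hc.mono' ?_
  intro x hx
  by_contra hxt
  apply hx
  have h1 : f x = 0 := image_eq_zero_of_notMem_tsupport hxt
  have h2 : fderiv ℝ f x = 0 := by
    by_contra h
    exact hxt (tsupport_fderiv_subset ℝ (subset_tsupport _ h))
  simp [cut, flux, h1, h2]

/-- Everything in the flux except `f` and its derivative is constant on the sphere of angles, so
averaging produces the bracket of `F`. -/
lemma cylMean_cut_flux (hn : 3 ≤ n) {y : Rn n} (hy : y ≠ 0) (ψ : ℝ → ℝ) {f : Rn n → ℂ}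
    (hf : ContDiff ℝ 1 f) {p q : ℝ} (hp : 0 < p) (hq : |q| < ‖y‖) :
    (wgt n ‖y‖ q : ℂ) * cylMean y (cut y ψ (flux y f)) (cylOf ‖y‖ (p, q)) =
      (ψ p : ℂ) * (1 / (sphereArea n : ℂ) * (((‖y‖ ^ 2 + p ^ 2) / (p ^ 2 + q ^ 2) : ℝ) : ℂ) *
        (bigF y f (p, q) / gam p q ^ (n - 1))) := by
  have ha : 0 < ‖y‖ := norm_pos_iff.2 hy
  have hval : ∀ σ, cut y ψ (flux y f) (cylPoint y (cylOf ‖y‖ (p, q)) (sphereIncl y σ)) =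
      (ψ p : ℂ) * (1 / (sphereArea n : ℂ) * (((‖y‖ ^ 2 + p ^ 2) / (p ^ 2 + q ^ 2) : ℝ) : ℂ)) /
        gam p q ^ (n - 1) * (f (cylPoint y (cylOf ‖y‖ (p, q)) (sphereIncl y σ)) +
        gam p q / ((n : ℂ) - 2) * fderiv ℝ f (cylPoint y (cylOf ‖y‖ (p, q)) (sphereIncl y σ))
          (cylPoint y (cylDp ‖y‖ (p, q)) (sphereIncl y σ))) := by
    intro σ
    have hcl : clen y (cylPoint y (cylOf ‖y‖ (p, q)) (sphereIncl y σ)) = gam p q := by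
      rw [clen_cylPoint hy, cylLen_cylOf ha hp hq.le]
    rw [cut, flux, sum_flux hn hy (by rw [hcl, gam_re]; exact hp), gradSq, hcl, gam_re, gam_im,
      dirP_cylPoint hy hp hq.le]
    ring
  have hc := hf.continuous
  have hc' := hf.continuous_fderiv one_ne_zero
  have hS := continuous_sphereIncl y
  have hcp : ∀ v, Continuous fun σ => cylPoint y v (sphereIncl y σ) := fun v =>
    (contDiff_cylPoint y (m := 0)).continuous.comp (continuous_const.prodMk hS)
  have i1 : Integrable (fun σ => f (cylPoint y (cylOf ‖y‖ (p, q)) (sphereIncl y σ)))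
      (sphereMeas y) :=
    (hc.comp (hcp _)).integrable_of_hasCompactSupport (HasCompactSupport.of_compactSpace _)
  have i2 : Integrable (fun σ => fderiv ℝ f (cylPoint y (cylOf ‖y‖ (p, q)) (sphereIncl y σ))
      (cylPoint y (cylDp ‖y‖ (p, q)) (sphereIncl y σ))) (sphereMeas y) :=
    ((hc'.comp (hcp _)).clm_apply (hcp _)).integrable_of_hasCompactSupport
      (HasCompactSupport.of_compactSpace _)
  rw [bigF, fderiv_cylMean y hf, cylMean_eq, cylMean_eq]
  simp only [hval]
  rw [integral_const_mul, integral_add i1 (i2.const_mul _), integral_const_mul]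
  simp only [Complex.real_smul]
  ring

/-- Jacobian times cylindrical density times `|∇p|²`: the factors `p² + q²` cancel and `ρ^(n-3)`
remains, a product of a function of `p` and the weight of `F`. -/
lemma rhoCoord_weight (hn : 3 ≤ n) {a p q : ℝ} (ha : 0 < a) (hp : 0 < p) (hq : |q| < a) :
    (p ^ 2 + q ^ 2) / (a * rhoCoord a p q) * rhoCoord a p q ^ (n - 2) *
      ((a ^ 2 + p ^ 2) / (p ^ 2 + q ^ 2)) =
      (a ^ 2 + p ^ 2) ^ (((n : ℝ) - 1) / 2) / a ^ (n - 2) * wgt n a q := by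
  have hA : (0 : ℝ) < a ^ 2 + p ^ 2 := by positivity
  have hr := rhoCoord_pos (p := p) ha hq
  have e : ((n : ℝ) - 1) / 2 = ((n : ℝ) - 3) / 2 + 1 := by ring
  rw [e, Real.rpow_add_one hA.ne', show n - 2 = n - 3 + 1 by omega, pow_succ _ (n - 3),
    rhoCoord_pow hn ha hq, pow_succ _ (n - 3)]
  have : p ^ 2 + q ^ 2 ≠ 0 := by positivity
  field_simp

lemma continuousOn_regSource_integrand (hn : 3 ≤ n) {y : Rn n} (hy : y ≠ 0) {f : Rn n → ℂ}
    (hf : ContDiff ℝ 1 f) :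
    ContinuousOn (fun x : ℝ × ℝ => bigF y f x / gam x.1 x.2 ^ (n - 1)) {x | 0 < x.1} :=
  (continuous_bigF hn hy hf).continuousOn.div ((continuous_gam.pow _).continuousOn)
    fun _ hx => pow_ne_zero _ (gam_ne_zero_of_pos hx _)

/-- The cut off Laplacian of the potential in terms of spherical means. -/
theorem integral_cut_eq (hn : 3 ≤ n) {y : Rn n} (hy : y ≠ 0) {ψ : ℝ → ℝ} {ε R : ℝ}
    (hε : 0 < ε) (hψ : ContDiff ℝ 1 ψ) (hz : ∀ t ≤ ε, ψ t = 0) (hR : ∀ t ≥ R, deriv ψ t = 0)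
    {f : Rn n → ℂ} (hf : ContDiff ℝ 2 f) (hc : HasCompactSupport f) :
    ∫ x, cut y ψ (fun x => potential (cpoint x y)) x * Laplacian.laplacian f x =
      ∫ p in Set.Ioi (0 : ℝ), ((deriv ψ p : ℝ) : ℂ) * regSource y p f := by
  have ha : 0 < ‖y‖ := norm_pos_iff.2 hy
  have hf1 : ContDiff ℝ 1 f := hf.of_le (by norm_num)
  have hz' := deriv_eq_zero_of_le hψ hz
  have hψ' : Continuous (deriv ψ) := hψ.continuous_deriv le_rfl
  rw [integral_cut_potential_mul_laplacian hn y hε hψ hz hf hc]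
  change ∫ x, cut y (deriv ψ) (flux y f) x = _
  rw [integral_cylindrical hn hy (continuous_cut_flux hε hψ' hz' hf1)
    (hasCompactSupport_cut_flux hc), integral_cylOf ha]
  · have hs : MeasurableSet (Set.Ioi (0 : ℝ) ×ˢ Set.Ioo (-‖y‖) ‖y‖) :=
      measurableSet_Ioi.prod measurableSet_Ioo
    set c : ℝ → ℝ := fun p => (‖y‖ ^ 2 + p ^ 2) ^ (((n : ℝ) - 1) / 2) / ‖y‖ ^ (n - 2) with hcdef
    have hcc : Continuous c := by
      have hn1 : (3 : ℝ) ≤ n := by exact_mod_cast hn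
      refine Continuous.div_const (Continuous.rpow_const (by fun_prop) fun p => Or.inr ?_) _
      linarith
    set k : ℝ × ℝ → ℂ := fun x => ((deriv ψ x.1 : ℝ) : ℂ) * ((c x.1 : ℂ) *
      (bigF y f x / gam x.1 x.2 ^ (n - 1))) with hk
    have hcongr : ∀ x ∈ Set.Ioi (0 : ℝ) ×ˢ Set.Ioo (-‖y‖) ‖y‖,
        (((x.1 ^ 2 + x.2 ^ 2) / (‖y‖ * rhoCoord ‖y‖ x.1 x.2) : ℝ) : ℂ) *
          ((((cylOf ‖y‖ x).1 ^ (n - 2) : ℝ) : ℂ) *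
            cylMean y (cut y (deriv ψ) (flux y f)) (cylOf ‖y‖ x)) =
          1 / (sphereArea n : ℂ) * k x := by
      rintro ⟨p, q⟩ ⟨hp, hq⟩
      have hq' : |q| < ‖y‖ := abs_lt.2 hq
      have h1 := cylMean_cut_flux hn hy (deriv ψ) hf1 hp hq'
      have h2 := congrArg (fun t : ℝ => (t : ℂ)) (rhoCoord_weight hn ha (hp : 0 < p) hq')
      have hw : wgt n ‖y‖ q ≠ 0 := (Real.rpow_pos_of_pos (sq_sub_sq_pos hq') _).ne'
      have hw' : (wgt n ‖y‖ q : ℂ) ≠ 0 := by exact_mod_cast hw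
      have h3 : (‖y‖ ^ 2 + p ^ 2) / (p ^ 2 + q ^ 2) ≠ 0 := by
        have : 0 < p := hp
        positivity
      have hcy : (cylOf ‖y‖ (p, q)).1 = rhoCoord ‖y‖ p q := rfl
      simp only [hk, hcdef, hcy]
      rw [← mul_right_inj' hw']
      rw [Complex.ofReal_mul, Complex.ofReal_mul, Complex.ofReal_mul] at h2
      simp only at h1
      calc _ = (((p ^ 2 + q ^ 2) / (‖y‖ * rhoCoord ‖y‖ p q) : ℝ) : ℂ) *
            ((rhoCoord ‖y‖ p q ^ (n - 2) : ℝ) : ℂ) * ((wgt n ‖y‖ q : ℂ) *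
              cylMean y (cut y (deriv ψ) (flux y f)) (cylOf ‖y‖ (p, q))) := by ring
        _ = _ := by rw [h1]; linear_combination (((deriv ψ p : ℝ) : ℂ) * (1 / (sphereArea n : ℂ)) *
            (bigF y f (p, q) / gam p q ^ (n - 1))) * h2
    rw [setIntegral_congr_fun hs hcongr, integral_const_mul]
    -- `ψ'` vanishes outside `[ε, R]`, so the integrand lives on a compact rectangle away from `γ =
    -- 0`; this justifies Fubini.
    have hik : IntegrableOn k (Set.Ioi (0 : ℝ) ×ˢ Set.Ioo (-‖y‖) ‖y‖) := by
      have hK : IntegrableOn k (Set.Icc ε R ×ˢ Set.Icc (-‖y‖) ‖y‖) := by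
        refine ContinuousOn.integrableOn_compact (isCompact_Icc.prod isCompact_Icc) ?_
        refine ContinuousOn.mul ?_ (ContinuousOn.mul ?_ ?_)
        · exact (Complex.continuous_ofReal.comp (hψ'.comp continuous_fst)).continuousOn
        · exact (Complex.continuous_ofReal.comp (hcc.comp continuous_fst)).continuousOn
        · exact (continuousOn_regSource_integrand hn hy hf1).mono
            fun x hx => hε.trans_le hx.1.1
      refine hK.of_forall_sdiff_eq_zero hs ?_
      rintro ⟨p, q⟩ ⟨⟨hp, hq⟩, hx⟩
      have : deriv ψ p = 0 := by
        by_contra h0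
        apply hx
        refine ⟨⟨?_, ?_⟩, ⟨hq.1.le, hq.2.le⟩⟩
        · by_contra h; exact h0 (hz' p (not_le.1 h).le)
        · by_contra h; exact h0 (hR p (not_le.1 h).le)
      simp [hk, this]
    rw [Measure.volume_eq_prod] at hik ⊢
    rw [setIntegral_prod _ hik, ← mul_assoc, ← integral_const_mul]
    refine setIntegral_congr_fun measurableSet_Ioi fun p hp => ?_
    simp only [hk, regSource]
    rw [integral_const_mul, integral_const_mul, intervalIntegral.integral_of_le (by linarith),
      integral_Ioc_eq_integral_Ioo, areaRatio]
    simp only [hcdef]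
    push_cast
    rw [div_div_eq_mul_div]
    ring
  · intro v hv
    rw [cylMean_eq]
    have : ∀ σ, cut y (deriv ψ) (flux y f) (cylPoint y v (sphereIncl y σ)) = 0 := by
      intro σ
      rw [cut, clen_cylPoint hy, hz' _ (hv.trans hε.le)]
      simp
    simp [this]

end ComplexSource

end

/-! ### Passing from smooth cutoffs to the sharp one -/

noncomputable section

namespace ComplexSource

variable {n : ℕ}

lemma continuous_regSource_coeff (hn : 3 ≤ n) (y : Rn n) : Continuous fun p : ℝ =>
    (((‖y‖ ^ 2 + p ^ 2) ^ (((n : ℝ) - 1) / 2) / ‖y‖ ^ (n - 2) / areaRatio n : ℝ) : ℂ) := by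
  have hn1 : (3 : ℝ) ≤ n := by exact_mod_cast hn
  refine Complex.continuous_ofReal.comp (Continuous.div_const (Continuous.div_const
    (Continuous.rpow_const (by fun_prop) fun p => Or.inr ?_) _) _)
  linarith

/-- Away from `p = 0` the function `regSource` extends continuously. -/
lemma exists_continuous_regSource (hn : 3 ≤ n) {y : Rn n} (hy : y ≠ 0) {f : Rn n → ℂ}
    (hf : ContDiff ℝ 1 f) {δ : ℝ} (hδ : 0 < δ) :
    ∃ G : ℝ → ℂ, Continuous G ∧ ∀ p, δ ≤ p → regSource y p f = G p := by
  -- Replacing `p` by `max δ p` in the denominator keeps it away from zero without changing values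
  -- for `p ≥ δ`.
  refine ⟨fun p => (((‖y‖ ^ 2 + p ^ 2) ^ (((n : ℝ) - 1) / 2) / ‖y‖ ^ (n - 2) /
    areaRatio n : ℝ) : ℂ) * ∫ q in (-‖y‖)..‖y‖, bigF y f (p, q) / gam (max δ p) q ^ (n - 1),
    (continuous_regSource_coeff hn y).mul ?_, fun p hp => by
      simp only [regSource, max_eq_right hp]⟩
  refine intervalIntegral.continuous_parametric_intervalIntegral_of_continuous' ?_ _ _
  refine Continuous.div (continuous_bigF hn hy hf) (Continuous.pow ?_ _) fun x =>
    pow_ne_zero _ (gam_ne_zero_of_pos (lt_max_of_lt_left hδ) _)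
  exact continuous_gam.comp
    (((continuous_const.max continuous_fst).prodMk continuous_snd) :
      Continuous fun x : ℝ × ℝ => (max δ x.1, x.2))

/-- The smooth approximation, of width `h`, of the step function at `ε`. -/
def step (ε h t : ℝ) : ℝ := Real.smoothTransition ((t - ε) / h)

lemma contDiff_step (ε h : ℝ) {m : ℕ∞} : ContDiff ℝ m (step ε h) :=
  Real.smoothTransition.contDiff.comp ((contDiff_id.sub contDiff_const).div_const h)

lemma step_of_le {ε h t : ℝ} (hh : 0 < h) (ht : t ≤ ε) : step ε h t = 0 :=
  Real.smoothTransition.zero_of_nonpos (div_nonpos_of_nonpos_of_nonneg (by linarith) hh.le)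

lemma step_of_ge {ε h t : ℝ} (hh : 0 < h) (ht : ε + h ≤ t) : step ε h t = 1 :=
  Real.smoothTransition.one_of_one_le (by rw [le_div_iff₀ hh]; linarith)

lemma deriv_step (ε h t : ℝ) :
    deriv (step ε h) t = deriv Real.smoothTransition ((t - ε) / h) / h := by
  have h1 : HasDerivAt (fun t : ℝ => (t - ε) / h) (1 / h) t :=
    ((hasDerivAt_id t).sub_const ε).div_const h
  have h2 := (((Real.smoothTransition.contDiff (n := 1)).differentiable (by simp)
    ((t - ε) / h)).hasDerivAt).comp t h1
  have h3 : deriv (step ε h) t = _ := h2.deriv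
  rw [h3]; ring

lemma deriv_step_of_gt {ε h t : ℝ} (hh : 0 < h) (ht : ε + h < t) : deriv (step ε h) t = 0 := by
  have : step ε h =ᶠ[𝓝 t] fun _ => 1 := by
    filter_upwards [isOpen_Ioi.mem_nhds ht] with u hu using step_of_ge hh (le_of_lt hu)
  rw [this.deriv_eq]
  simp

lemma integral_deriv_step_mul {ε : ℝ} (hε : 0 < ε) {h : ℝ} (hh : 0 < h) {g G : ℝ → ℂ}
    (hg : ∀ p, ε ≤ p → g p = G p) :
    ∫ p in Set.Ioi (0 : ℝ), ((deriv (step ε h) p : ℝ) : ℂ) * g p =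
      ∫ t in (0 : ℝ)..1, ((deriv Real.smoothTransition t : ℝ) : ℂ) * G (h * t + ε) := by
  have hsub : Set.Ioc ε (ε + h) ⊆ Set.Ioi (0 : ℝ) := fun p hp => hε.trans hp.1
  rw [setIntegral_eq_of_subset_of_forall_sdiff_eq_zero measurableSet_Ioi hsub]
  · rw [setIntegral_congr_fun (g := fun p => ((deriv (step ε h) p : ℝ) : ℂ) * G p)
      measurableSet_Ioc fun p hp => by simp only [hg p hp.1.le],
      ← intervalIntegral.integral_of_le (by linarith)]
    have h1 := intervalIntegral.smul_integral_comp_mul_add (a := 0) (b := 1)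
      (fun p => ((deriv (step ε h) p : ℝ) : ℂ) * G p) h ε
    rw [mul_zero, zero_add, mul_one, add_comm h ε] at h1
    rw [← h1, ← intervalIntegral.integral_smul]
    refine intervalIntegral.integral_congr fun t _ => ?_
    simp only [deriv_step, Complex.real_smul]
    rw [show (h * t + ε - ε) / h = t by field_simp; ring]
    have : (h : ℂ) ≠ 0 := by exact_mod_cast hh.ne'
    push_cast
    field_simp
  · rintro p ⟨_, hp'⟩
    have : deriv (step ε h) p = 0 := by
      rcases le_or_gt p ε with h1 | h1
      · exact deriv_eq_zero_of_le (contDiff_step ε h (m := 1)) (fun t ht => step_of_le hh ht) p h1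
      · refine deriv_step_of_gt hh ?_
        by_contra h2
        exact hp' ⟨h1, not_lt.1 h2⟩
    simp [this]

/-- After the substitution `p = h t + ε` the derivative of the step becomes a fixed density on `[0,
1]` of total mass one. It approaches `ε` from the right, so only values on `[ε, ∞)` matter. -/
lemma tendsto_integral_deriv_step {ε : ℝ} (hε : 0 < ε) {g G : ℝ → ℂ} (hG : Continuous G)
    (hg : ∀ p, ε ≤ p → g p = G p) :
    Tendsto (fun h => ∫ p in Set.Ioi (0 : ℝ), ((deriv (step ε h) p : ℝ) : ℂ) * g p) (𝓝[>] 0)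
      (𝓝 (g ε)) := by
  have hs' : Continuous (deriv Real.smoothTransition) :=
    (Real.smoothTransition.contDiff (n := 1)).continuous_deriv le_rfl
  have hcont : Continuous fun h : ℝ =>
      ∫ t in (0 : ℝ)..1, ((deriv Real.smoothTransition t : ℝ) : ℂ) * G (h * t + ε) := by
    refine intervalIntegral.continuous_parametric_intervalIntegral_of_continuous' ?_ _ _
    simp only [Function.uncurry_def]
    exact (Complex.continuous_ofReal.comp (hs'.comp continuous_snd)).mul
      (hG.comp (by fun_prop))
  have h0 : ∫ t in (0 : ℝ)..1, ((deriv Real.smoothTransition t : ℝ) : ℂ) * G (0 * t + ε) =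
      g ε := by
    simp only [zero_mul, zero_add]
    rw [intervalIntegral.integral_mul_const, intervalIntegral.integral_ofReal,
      intervalIntegral.integral_deriv_eq_sub
        (fun t _ => (Real.smoothTransition.contDiff (n := 1)).differentiable (by simp) t)
        (hs'.intervalIntegrable _ _), hg ε le_rfl]
    simp
  have h1 := hcont.tendsto 0
  rw [h0] at h1
  refine (h1.mono_left nhdsWithin_le_nhds).congr' ?_
  filter_upwards [self_mem_nhdsWithin] with h hh
  exact (integral_deriv_step_mul hε hh hg).symm

lemma norm_potential_le {y x : Rn n} (hn : 3 ≤ n) {ε : ℝ} (hε : 0 < ε) (h : ε < (clen y x).re) :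
    ‖potential (cpoint x y)‖ ≤
      ‖1 / (sphereArea n : ℂ)‖ * ((ε ^ (n - 2))⁻¹ / ‖2 - (n : ℂ)‖) := by
  rw [potential, norm_mul, norm_div (_ ^ _), norm_zpow]
  have h1 : ε ≤ ‖complexLength (cpoint x y)‖ :=
    h.le.trans ((le_abs_self _).trans (Complex.abs_re_le_norm _))
  gcongr
  rw [show (2 : ℤ) - n = -((n - 2 : ℕ) : ℤ) by omega, zpow_neg, zpow_natCast]
  gcongr

lemma continuous_laplacian {f : Rn n → ℂ} (hf : ContDiff ℝ 2 f) :
    Continuous (Laplacian.laplacian f) := by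
  rw [show Laplacian.laplacian f = _ from funext (laplacian_eq_sum hf)]
  refine continuous_finsetSum _ fun j _ => ?_
  have h1 : ContDiff ℝ 1 fun x => fderiv ℝ f x (EuclideanSpace.single j 1) :=
    (hf.fderiv_right (m := 1) (by norm_num)).clm_apply contDiff_const
  exact (h1.continuous_fderiv one_ne_zero).clm_apply continuous_const

lemma hasCompactSupport_laplacian {f : Rn n → ℂ} (hf : ContDiff ℝ 2 f) (hc : HasCompactSupport f) :
    HasCompactSupport (Laplacian.laplacian f) := by
  refine hc.mono' ?_
  intro x hx
  by_contra hxt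
  apply hx
  have h : f =ᶠ[𝓝 x] fun _ => 0 := notMem_tsupport_iff_eventuallyEq.1 hxt
  have h2 : fderiv ℝ f =ᶠ[𝓝 x] fun _ => 0 := by
    refine h.fderiv.trans (Eventually.of_forall fun u => ?_)
    simp
  rw [laplacian_eq_sum hf]
  refine Finset.sum_eq_zero fun j _ => ?_
  have h3 : (fun x => fderiv ℝ f x (EuclideanSpace.single j 1)) =ᶠ[𝓝 x] fun _ => 0 := by
    filter_upwards [h2] with u hu
    rw [hu]; rfl
  rw [h3.fderiv_eq]
  simp

/-- The distributional Laplacian of the regularized potential. -/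
theorem integral_regPotential_mul_laplacian (hn : 3 ≤ n) {y : Rn n} (hy : y ≠ 0) {ε : ℝ}
    (hε : 0 < ε) {f : Rn n → ℂ} (hf : ContDiff ℝ 2 f) (hc : HasCompactSupport f) :
    ∫ x, regPotential ε (cpoint x y) * Laplacian.laplacian f x = regSource y ε f := by
  have hf1 : ContDiff ℝ 1 f := hf.of_le (by norm_num)
  obtain ⟨G, hG, hgG⟩ := exists_continuous_regSource hn hy hf1 hε
  have hR := tendsto_integral_deriv_step hε hG hgG
  refine tendsto_nhds_unique (f := fun h => ∫ x,
    cut y (step ε h) (fun x => potential (cpoint x y)) x * Laplacian.laplacian f x)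
    (l := 𝓝[>] (0 : ℝ)) ?_ (hR.congr' ?_)
  · refine tendsto_integral_filter_of_dominated_convergence
      (fun x => ‖1 / (sphereArea n : ℂ)‖ * ((ε ^ (n - 2))⁻¹ / ‖2 - (n : ℂ)‖) *
        ‖Laplacian.laplacian f x‖) ?_ ?_ ?_ ?_
    · filter_upwards [self_mem_nhdsWithin] with h hh
      have hcut : Continuous (cut y (step ε h) fun x => potential (cpoint x y)) :=
        (contDiff_cut (m := 1) hε (contDiff_step ε h) (fun t ht => step_of_le hh ht)
          fun x hx => contDiffAt_potential hx).continuous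
      exact (hcut.mul (continuous_laplacian hf)).aestronglyMeasurable
    · filter_upwards [self_mem_nhdsWithin] with h hh
      refine Eventually.of_forall fun x => ?_
      rw [norm_mul, cut, norm_mul]
      refine mul_le_mul_of_nonneg_right ?_ (norm_nonneg _)
      rcases lt_or_ge ε (clen y x).re with hx | hx
      · have h1 := norm_potential_le hn hε hx
        refine (mul_le_of_le_one_left (norm_nonneg _) ?_).trans h1
        rw [Complex.norm_real, Real.norm_eq_abs, step, abs_of_nonneg
          (Real.smoothTransition.nonneg _)]
        exact Real.smoothTransition.le_one _
      · rw [step_of_le hh hx]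
        simp only [Complex.ofReal_zero, norm_zero, zero_mul]
        positivity
    · exact ((continuous_laplacian hf).integrable_of_hasCompactSupport
        (hasCompactSupport_laplacian hf hc)).norm.const_mul _
    -- Convergence holds at every point, `p = ε` included: the smooth steps vanish there, matching
    -- the strict inequality in `regPotential`.
    · refine Eventually.of_forall fun x => ?_
      refine Tendsto.congr' ?_ tendsto_const_nhds
      rcases lt_or_ge ε (clen y x).re with hx | hx
      · filter_upwards [Ioc_mem_nhdsGT (sub_pos.2 hx)] with h hh
        rw [cut, step_of_ge hh.1 (by linarith [hh.2]),
          regPotential, if_pos (show ε < (complexLength (cpoint x y)).re from hx)]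
        simp
      · filter_upwards [self_mem_nhdsWithin] with h hh
        rw [cut, step_of_le hh hx, regPotential,
          if_neg (show ¬ ε < (complexLength (cpoint x y)).re from not_lt.2 hx)]
        simp
  · filter_upwards [self_mem_nhdsWithin] with h hh
    refine (integral_cut_eq hn hy (R := ε + h + 1) hε (contDiff_step ε h (m := 1))
      (fun t ht => step_of_le hh ht) (fun t ht => deriv_step_of_gt hh ?_) hf hc).symm
    linarith [(hh : 0 < h)]

end ComplexSource

end

/-! ### The regularized functional and the explicit constants -/

noncomputable section

namespace ComplexSource

variable {n : ℕ}

lemma cylMean_add (y : Rn n) {f g : Rn n → ℂ} (hf : Continuous f) (hg : Continuous g) :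
    cylMean y (f + g) = cylMean y f + cylMean y g := by
  have hcp : ∀ v, Continuous fun σ => cylPoint y v (sphereIncl y σ) := fun v =>
    (contDiff_cylPoint y (m := 0)).continuous.comp
      (continuous_const.prodMk (continuous_sphereIncl y))
  funext v
  rw [Pi.add_apply, cylMean_eq, cylMean_eq, cylMean_eq]
  simp only [Pi.add_apply]
  rw [integral_add, smul_add]
  · exact (hf.comp (hcp v)).integrable_of_hasCompactSupport (HasCompactSupport.of_compactSpace _)
  · exact (hg.comp (hcp v)).integrable_of_hasCompactSupport (HasCompactSupport.of_compactSpace _)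

lemma cylMean_const_smul (y : Rn n) (c : ℂ) (f : Rn n → ℂ) :
    cylMean y (c • f) = c • cylMean y f := by
  funext v
  rw [Pi.smul_apply, cylMean_eq, cylMean_eq]
  simp only [Pi.smul_apply]
  rw [integral_smul, smul_comm]

lemma contDiff_one_cylMean (y : Rn n) {f : Rn n → ℂ} (hf : ContDiff ℝ 1 f) :
    ContDiff ℝ 1 (cylMean y f) := by
  exact_mod_cast contDiff_cylMean y (m := 1) (by exact_mod_cast hf)

lemma bigF_add (y : Rn n) {f g : Rn n → ℂ} (hf : ContDiff ℝ 1 f) (hg : ContDiff ℝ 1 g)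
    (x : ℝ × ℝ) : bigF y (f + g) x = bigF y f x + bigF y g x := by
  have h1 := (contDiff_one_cylMean y hf).differentiable one_ne_zero
  have h2 := (contDiff_one_cylMean y hg).differentiable one_ne_zero
  simp only [bigF]
  rw [cylMean_add y hf.continuous hg.continuous, fderiv_add (h1 _) (h2 _)]
  simp only [Pi.add_apply, add_apply]
  ring

lemma bigF_const_smul (y : Rn n) (c : ℂ) {f : Rn n → ℂ} (hf : ContDiff ℝ 1 f) (x : ℝ × ℝ) :
    bigF y (c • f) x = c * bigF y f x := by
  have h1 := (contDiff_one_cylMean y hf).differentiable one_ne_zero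
  simp only [bigF]
  rw [cylMean_const_smul, fderiv_const_smul (h1 _)]
  simp only [Pi.smul_apply, smul_apply, smul_eq_mul]
  ring

lemma contDiff_one_of_mem (hn : 3 ≤ n) (f : CSpace n (n - 2)) : ContDiff ℝ 1 (f : Rn n → ℂ) :=
  ContDiff.of_le (show ContDiff ℝ (n - 2 : ℕ) (f : Rn n → ℂ) from f.2)
    (by exact_mod_cast (by omega : 1 ≤ n - 2))

lemma intervalIntegrable_bigF_div (hn : 3 ≤ n) {y : Rn n} (hy : y ≠ 0) {f : Rn n → ℂ}
    (hf : ContDiff ℝ 1 f) {p : ℝ} (hp : 0 < p) (a b : ℝ) :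
    IntervalIntegrable (fun q => bigF y f (p, q) / gam p q ^ (n - 1)) volume a b := by
  refine Continuous.intervalIntegrable ?_ _ _
  refine Continuous.div ((continuous_bigF hn hy hf).comp (by fun_prop))
    ((continuous_gam.comp (by fun_prop : Continuous fun q : ℝ => (p, q))).pow _)
    fun q => pow_ne_zero _ (gam_ne_zero_of_pos hp q)

/-- The regularized source as a linear functional. -/
def regSourceL (hn : 3 ≤ n) {y : Rn n} (hy : y ≠ 0) {ε : ℝ} (hε : 0 < ε) :
    CSpace n (n - 2) →ₗ[ℂ] ℂ where
  toFun f := regSource y ε f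
  map_add' f g := by
    have hf := contDiff_one_of_mem hn f
    have hg := contDiff_one_of_mem hn g
    simp only [regSource, Submodule.coe_add, bigF_add y hf hg, add_div]
    rw [intervalIntegral.integral_add (intervalIntegrable_bigF_div hn hy hf hε _ _)
      (intervalIntegrable_bigF_div hn hy hg hε _ _), mul_add]
  map_smul' c f := by
    have hf := contDiff_one_of_mem hn f
    simp only [regSource, Submodule.coe_smul, bigF_const_smul y c hf, mul_div_assoc,
      intervalIntegral.integral_const_mul, RingHom.id_apply, smul_eq_mul]
    ring

/-- On the level set `|γ| ≥ ε`, and `F` is bounded by derivatives of order at most one, which `n - 2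
≥ 1` covers. -/
lemma isBoundedFunctional_regSourceL (hn : 3 ≤ n) {y : Rn n} (hy : y ≠ 0) {ε : ℝ} (hε : 0 < ε) :
    IsBoundedFunctional (regSourceL hn hy hε) := by
  obtain ⟨K, C, hK, hC, hb⟩ := exists_bigF_bound hn hy ε
  set c : ℂ := (((‖y‖ ^ 2 + ε ^ 2) ^ (((n : ℝ) - 1) / 2) / ‖y‖ ^ (n - 2) / areaRatio n : ℝ) : ℂ)
  refine ⟨K, hK, ‖c‖ * (C / ε ^ (n - 1) * |‖y‖ - -‖y‖|), fun f M hM hf => ?_⟩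
  have hf1 := contDiff_one_of_mem hn f
  have h1 : ‖∫ q in (-‖y‖)..‖y‖, bigF y f (ε, q) / gam ε q ^ (n - 1)‖ ≤
      C * M / ε ^ (n - 1) * |‖y‖ - -‖y‖| := by
    refine intervalIntegral.norm_integral_le_of_norm_le_const fun q hq => ?_
    rw [Set.uIoc_of_le (by linarith [norm_nonneg y])] at hq
    have hq' : |q| ≤ ‖y‖ := abs_le.2 ⟨hq.1.le, hq.2⟩
    have h2 := hb f hf1 M hM (fun j hj x hx => hf j (by omega) x hx) ε q hε.le le_rfl hq'
    have h3 : ε ≤ ‖gam ε q‖ := by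
      have := Complex.abs_re_le_norm (gam ε q)
      rw [gam_re] at this
      exact (le_abs_self ε).trans this
    rw [norm_div, norm_pow]
    gcongr
  change ‖c * _‖ ≤ _
  rw [norm_mul]
  calc _ ≤ ‖c‖ * (C * M / ε ^ (n - 1) * |‖y‖ - -‖y‖|) := by gcongr
    _ = _ := by ring

lemma isRegularizedSource_regSourceL (hn : 3 ≤ n) {y : Rn n} (hy : y ≠ 0) {ε : ℝ} (hε : 0 < ε) :
    IsRegularizedSource y ε (regSourceL hn hy hε) :=
  ⟨isBoundedFunctional_regSourceL hn hy hε, fun _ hf hc =>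
    (integral_regPotential_mul_laplacian hn hy hε
      (by exact_mod_cast contDiff_infty.1 hf 2) hc).symm⟩

lemma taylorT_eq {y : Rn n} (hy : y ≠ 0) {f : Rn n → ℂ} (hf : ContDiff ℝ 1 f) (m : ℕ) :
    taylorT y f m = axisT y f m := by
  simp only [taylorT, axisT, weightedMean_eq hy hf]

lemma remainderQuot_eq {y : Rn n} (hy : y ≠ 0) {f : Rn n → ℂ} (hf : ContDiff ℝ 1 f) (q : ℝ) :
    remainderQuot y f q = Complex.I ^ (n - 1) * ((bigF y f (0, q) -
      ∑ m ∈ Finset.range (n - 1), (q : ℂ) ^ m * axisT y f m) / (Complex.I * q) ^ (n - 1)) := by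
  simp only [remainderQuot, weightedMean_eq hy hf, taylorT_eq hy hf]
  rw [mul_pow]
  have : Complex.I ^ (n - 1) ≠ 0 := pow_ne_zero _ Complex.I_ne_zero
  rw [mul_div_assoc', mul_div_mul_left _ _ this]

lemma interiorTerm_eq (hn : 3 ≤ n) {y : Rn n} (hy : y ≠ 0) {f : Rn n → ℂ} (hf : ContDiff ℝ 1 f) :
    interiorTerm y f = (‖y‖ : ℂ) / (areaRatio n : ℂ) * ∫ q in (-‖y‖)..‖y‖, (bigF y f (0, q) -
      ∑ m ∈ Finset.range (n - 1), (q : ℂ) ^ m * axisT y f m) / (Complex.I * q) ^ (n - 1) := by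
  rw [interiorTerm]
  simp only [remainderQuot_eq hy hf]
  rw [intervalIntegral.integral_const_mul]
  have : Complex.I ^ ((1 : ℤ) - n) * Complex.I ^ (n - 1) = 1 := by
    rw [← zpow_natCast, ← zpow_add₀ Complex.I_ne_zero]
    rw [show (1 : ℤ) - n + ((n - 1 : ℕ) : ℤ) = 0 by omega, zpow_zero]
  linear_combination (‖y‖ : ℂ) / (areaRatio n : ℂ) * (∫ q in (-‖y‖)..‖y‖, (bigF y f (0, q) -
      ∑ m ∈ Finset.range (n - 1), (q : ℂ) ^ m * axisT y f m) / (Complex.I * q) ^ (n - 1)) * this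

lemma neg_I_pow_two_mul (l : ℕ) : (-Complex.I) ^ (2 * l) = (-1) ^ l := by
  rw [pow_mul]; simp

/-- The recursion reduces to `∫ γ^(-(2d+1))` with `d = k - l`. For `d > 0` the antiderivative is an
even power and its values at `±ia` cancel; for `d = 0` it is the logarithm. -/
lemma monoLim_odd {a : ℝ} {k l : ℕ} (hl : l ≤ k) : monoLim a (2 * l) (2 * k + 1) =
    if l = k then (-1) ^ k * (Real.pi : ℂ) else 0 := by
  obtain ⟨d, rfl⟩ := Nat.exists_eq_add_of_le hl
  have h := monoLim_add_left a 0 (2 * l) (2 * d + 1)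
  rw [zero_add, show 2 * d + 1 + 2 * l = 2 * (l + d) + 1 by ring] at h
  rw [h, neg_I_pow_two_mul]
  rcases d with _ | d
  · simp [monoLim]
  · rw [if_neg (by omega), show 2 * (d + 1) + 1 = (2 * d + 1) + 2 by ring, monoLim]
    have : (-(Complex.I * (a : ℂ))) ^ (-(((2 * d + 1 : ℕ) : ℤ) + 1)) =
        (Complex.I * (a : ℂ)) ^ (-(((2 * d + 1 : ℕ) : ℤ) + 1)) := by
      refine Even.neg_zpow ⟨-((d : ℤ) + 1), by push_cast; ring⟩ _
    rw [this]
    simp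

/-- Here the antiderivative is an odd power of `γ`, so the endpoint values at `±ia` add up and give
the factor `2`. -/
lemma monoLim_even {a : ℝ} (ha : 0 < a) {k l : ℕ} (hl : l ≤ k) :
    (a : ℂ) * monoLim a (2 * l) (2 * k + 2) =
      2 * (-1) ^ k * ((a : ℂ) ^ ((2 : ℤ) * l - 2 * k) / (2 * (k : ℂ) - 2 * (l : ℂ) + 1)) := by
  obtain ⟨d, rfl⟩ := Nat.exists_eq_add_of_le hl
  have ha' : (a : ℂ) ≠ 0 := by exact_mod_cast ha.ne'
  have h := monoLim_add_left a 0 (2 * l) (2 * d + 2)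
  rw [zero_add, show 2 * d + 2 + 2 * l = 2 * (l + d) + 2 by ring] at h
  rw [h, neg_I_pow_two_mul, monoLim]
  have h1 : (-(Complex.I * (a : ℂ))) ^ (-(((2 * d : ℕ) : ℤ) + 1)) =
      -(Complex.I * (a : ℂ)) ^ (-(((2 * d : ℕ) : ℤ) + 1)) := by
    refine Odd.neg_zpow ⟨-((d : ℤ) + 1), by push_cast; ring⟩ _
  have h2 : (Complex.I * (a : ℂ)) ^ (-(((2 * d : ℕ) : ℤ) + 1)) =
      (-Complex.I) * (-1) ^ d * ((a : ℂ) ^ (2 * d))⁻¹ * (a : ℂ)⁻¹ := by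
    rw [zpow_neg, show ((2 * d : ℕ) : ℤ) + 1 = ((2 * d + 1 : ℕ) : ℤ) by push_cast; ring,
      zpow_natCast, mul_pow, pow_succ, pow_succ, pow_mul Complex.I, Complex.I_sq, mul_inv,
      mul_inv, mul_inv, Complex.inv_I, ← inv_pow]
    rw [show ((-1 : ℂ))⁻¹ = -1 by norm_num]
    ring
  have h3 : (a : ℂ) ^ ((2 : ℤ) * l - 2 * ((l + d : ℕ) : ℤ)) = ((a : ℂ) ^ (2 * d))⁻¹ := by
    rw [← zpow_natCast, ← zpow_neg]
    congr 1
    push_cast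
    ring
  rw [h1, h2, h3]
  have h4 : (2 * (d : ℂ) + 1) ≠ 0 := by exact_mod_cast (by omega : 2 * d + 1 ≠ 0)
  have h5 : (2 * ((l + d : ℕ) : ℂ) - 2 * (l : ℂ) + 1) = 2 * (d : ℂ) + 1 := by push_cast; ring
  rw [h5, pow_add]
  push_cast
  have hI := Complex.I_ne_zero
  field_simp
  ring

lemma sum_range_two_mul_of_odd {g : ℕ → ℂ} (hg : ∀ m, Odd m → g m = 0) (k : ℕ) :
    ∑ m ∈ Finset.range (2 * k), g m = ∑ l ∈ Finset.range k, g (2 * l) := by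
  induction k with
  | zero => simp
  | succ k ih =>
    rw [show 2 * (k + 1) = 2 * k + 1 + 1 by ring, Finset.sum_range_succ, Finset.sum_range_succ, ih,
      hg (2 * k + 1) ⟨k, rfl⟩, add_zero, Finset.sum_range_succ]

/-- For even `n` the regular part of the limit vanishes by parity. -/
lemma integral_remainder_eq_zero (y : Rn n) (f : Rn n → ℂ) (a : ℝ) (hn : Odd (n - 1)) :
    ∫ q in (-a)..a, (bigF y f (0, q) -
      ∑ m ∈ Finset.range (n - 1), (q : ℂ) ^ m * axisT y f m) / (Complex.I * q) ^ (n - 1) = 0 := by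
  set u : ℝ → ℂ := fun q => (bigF y f (0, q) -
      ∑ m ∈ Finset.range (n - 1), (q : ℂ) ^ m * axisT y f m) / (Complex.I * q) ^ (n - 1) with hu
  have hodd : ∀ q, u (-q) = -u q := by
    intro q
    have hs : ∑ m ∈ Finset.range (n - 1), ((-q : ℝ) : ℂ) ^ m * axisT y f m =
        ∑ m ∈ Finset.range (n - 1), (q : ℂ) ^ m * axisT y f m := by
      refine Finset.sum_congr rfl fun m _ => ?_
      rcases Nat.even_or_odd m with h | h
      · rw [Complex.ofReal_neg, h.neg_pow]
      · rw [axisT_odd y f h, mul_zero, mul_zero]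
    simp only [hu]
    rw [hs, bigF_axis_neg, Complex.ofReal_neg, mul_neg, hn.neg_pow, div_neg]
  have h1 := intervalIntegral.integral_comp_neg (a := -a) (b := a) u
  rw [neg_neg] at h1
  simp only [hodd, intervalIntegral.integral_neg] at h1
  exact neg_eq_self.1 h1

end ComplexSource

end

/-! ### Existence of the singular source -/

noncomputable section

namespace ComplexSource

variable {n : ℕ}

lemma tendsto_regSource (hn : 3 ≤ n) {y : Rn n} (hy : y ≠ 0) {f : Rn n → ℂ} {L : ℂ}
    (h : Tendsto (fun p : ℝ => ∫ q in (-‖y‖)..‖y‖, bigF y f (p, q) / gam p q ^ (n - 1)) (𝓝[>] 0)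
      (𝓝 L)) :
    Tendsto (fun p => regSource y p f) (𝓝[>] 0) (𝓝 ((‖y‖ : ℂ) / (areaRatio n : ℂ) * L)) := by
  have ha : 0 < ‖y‖ := norm_pos_iff.2 hy
  refine Tendsto.mul ?_ h
  have h1 := ((continuous_regSource_coeff hn y).tendsto 0).mono_left
    (nhdsWithin_le_nhds (s := Set.Ioi 0))
  -- At `p = 0` the prefactor is `a^(n-1) / a^(n-2) = a`.
  have e : (‖y‖ ^ 2 + 0 ^ 2) ^ (((n : ℝ) - 1) / 2) / ‖y‖ ^ (n - 2) = ‖y‖ := by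
    rw [zero_pow two_ne_zero, add_zero, ← Real.rpow_natCast, ← Real.rpow_mul ha.le,
      ← Real.rpow_natCast, ← Real.rpow_sub ha]
    conv_rhs => rw [← Real.rpow_one ‖y‖]
    congr 1
    push_cast [show 2 ≤ n by omega]
    ring
  rw [e] at h1
  push_cast at h1 ⊢
  exact h1

/-- Existence of the singular source. -/
theorem exists_singularSource (hn : 3 ≤ n) {y : Rn n} (hy : y ≠ 0) :
    ∃ δ : CSpace n (n - 2) →ₗ[ℂ] ℂ, IsSingularSource y δ ∧ IsBoundedFunctional δ ∧
      ∀ f : CSpace n (n - 2),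
        IntervalIntegrable (remainderQuot y (f : Rn n → ℂ)) volume (-‖y‖) ‖y‖ ∧
        δ f = interiorTerm y (f : Rn n → ℂ) + (‖y‖ : ℂ) / (areaRatio n : ℂ) *
          ∑ m ∈ Finset.range (n - 1), taylorT y (f : Rn n → ℂ) m * monoLim ‖y‖ m (n - 1) := by
  obtain ⟨K, C, hK, hlim⟩ := exists_limit_bigF hn hy
  choose L hLb hLt hLi hLe using fun f : CSpace n (n - 2) => hlim f f.2
  classical
  let Lreg : ℝ → (CSpace n (n - 2) →ₗ[ℂ] ℂ) := fun ε =>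
    if h : 0 < ε then regSourceL hn hy h else 0
  have hreg : ∀ {ε : ℝ} (h : 0 < ε), Lreg ε = regSourceL hn hy h := fun h => dif_pos h
  have ht : ∀ f : CSpace n (n - 2), Tendsto (fun ε => Lreg ε f) (𝓝[>] 0)
      (𝓝 ((‖y‖ : ℂ) / (areaRatio n : ℂ) * L f)) := fun f => by
    refine (tendsto_regSource hn hy (hLt f)).congr' ?_
    filter_upwards [self_mem_nhdsWithin] with ε hε
    rw [hreg hε]
    rfl
  let δ : CSpace n (n - 2) →ₗ[ℂ] ℂ :=
    linearMapOfTendsto (fun f => (‖y‖ : ℂ) / (areaRatio n : ℂ) * L f) Lreg (tendsto_pi_nhds.2 ht)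
  refine ⟨δ, ⟨Lreg, fun ε hε => ?_, ht⟩, ?_, fun f => ?_⟩
  · rw [hreg hε]
    exact isRegularizedSource_regSourceL hn hy hε
  · refine ⟨K, hK, ‖(‖y‖ : ℂ) / (areaRatio n : ℂ)‖ * C, fun f M hM hf => ?_⟩
    change ‖(‖y‖ : ℂ) / (areaRatio n : ℂ) * L f‖ ≤ _
    rw [norm_mul, mul_assoc]
    exact mul_le_mul_of_nonneg_left (hLb f M hM hf) (norm_nonneg _)
  · have hf1 := contDiff_one_of_mem hn f
    refine ⟨?_, ?_⟩
    · rw [show remainderQuot y (f : Rn n → ℂ) = _ from funext (remainderQuot_eq hy hf1)]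
      exact (hLi f).const_mul _
    · change (‖y‖ : ℂ) / (areaRatio n : ℂ) * L f = _
      simp only [taylorT_eq hy hf1]
      rw [hLe f, interiorTerm_eq hn hy hf1, mul_add]

end ComplexSource

end

/-! ### The main theorem -/

theorem theorem2 (n : ℕ) (hn : 3 ≤ n) (y : ComplexSource.Rn n) (hy : y ≠ 0) :
    (∀ ε : ℝ, 0 < ε →
      ∃! L : ComplexSource.CSpace n (n - 2) →ₗ[ℂ] ℂ, ComplexSource.IsRegularizedSource y ε L) ∧
    (∀ f : ComplexSource.CSpace n (n - 2),
      ContDiffAt ℝ ((n - 3 : ℕ) : WithTop ℕ∞)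
        (fun q : ℝ => ComplexSource.weightedMean y (f : ComplexSource.Rn n → ℂ) 0 q) 0 ∧
      DifferentiableAt ℝ
        (iteratedDeriv (n - 3)
          (fun q : ℝ => ComplexSource.weightedMean y (f : ComplexSource.Rn n → ℂ) 0 q)) 0) ∧
    ∃ δ : ComplexSource.CSpace n (n - 2) →ₗ[ℂ] ℂ,
      ComplexSource.IsSingularSource y δ ∧
      ComplexSource.IsBoundedFunctional δ ∧
      (∀ k : ℕ, n = 2 * k + 2 → ∀ f : ComplexSource.CSpace n (n - 2),
        δ f = (Real.pi : ℂ) * (‖y‖ : ℂ) / (ComplexSource.areaRatio n : ℂ) * (-1) ^ k *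
          ComplexSource.taylorT y (f : ComplexSource.Rn n → ℂ) (2 * k)) ∧
      (∀ k : ℕ, n = 2 * k + 3 → ∀ f : ComplexSource.CSpace n (n - 2),
        IntervalIntegrable (ComplexSource.remainderQuot y (f : ComplexSource.Rn n → ℂ))
          volume (-‖y‖) ‖y‖ ∧
        δ f = ComplexSource.interiorTerm y (f : ComplexSource.Rn n → ℂ) +
          2 * (-1) ^ k / (ComplexSource.areaRatio n : ℂ) *
            ∑ l ∈ Finset.range (k + 1),
              (‖y‖ : ℂ) ^ ((2 : ℤ) * l - 2 * k) *
                ComplexSource.taylorT y (f : ComplexSource.Rn n → ℂ) (2 * l) /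
                  (2 * (k : ℂ) - 2 * (l : ℂ) + 1)) := by
  open ComplexSource in
  have ha : 0 < ‖y‖ := norm_pos_iff.2 hy
  refine ⟨fun ε hε => ⟨regSourceL hn hy hε, isRegularizedSource_regSourceL hn hy hε,
    fun L hL => ?_⟩, fun f => ?_, ?_⟩
  · have hR := isRegularizedSource_regSourceL hn hy hε
    exact eq_of_eqOn_testFunctions hL.1 hR.1 fun f hf hc => by rw [hL.2 f hf hc, hR.2 f hf hc]
  · simp only [weightedMean_eq hy (contDiff_one_of_mem hn f)]
    exact bigF_axis_regular hn hy f.2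
  · obtain ⟨δ, hδ, hb, hf⟩ := exists_singularSource hn hy
    refine ⟨δ, hδ, hb, fun k hk f => ?_, fun k hk f => ⟨(hf f).1, ?_⟩⟩
    · have hf1 := contDiff_one_of_mem hn f
      have hodd : Odd (n - 1) := ⟨k, by omega⟩
      -- Even dimension: the remainder integral vanishes by parity, and of the even coefficients
      -- only the top one meets a nonzero model limit.
      rw [(hf f).2, interiorTerm_eq hn hy hf1, integral_remainder_eq_zero y f ‖y‖ hodd, mul_zero,
        zero_add, show n - 1 = 2 * k + 1 by omega, Finset.sum_range_succ,
        sum_range_two_mul_of_odd (fun m hm => by rw [taylorT_eq hy hf1, axisT_odd y f hm, zero_mul]),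
        Finset.sum_eq_zero fun l hl => by
          rw [Finset.mem_range] at hl
          rw [monoLim_odd hl.le, if_neg hl.ne, mul_zero],
        monoLim_odd le_rfl, if_pos rfl]
      ring
    · have hf1 := contDiff_one_of_mem hn f
      rw [(hf f).2, show n - 1 = 2 * (k + 1) by omega,
        sum_range_two_mul_of_odd (fun m hm => by rw [taylorT_eq hy hf1, axisT_odd y f hm, zero_mul]),
        Finset.mul_sum, Finset.mul_sum]
      congr 1
      refine Finset.sum_congr rfl fun l hl => ?_
      have h := monoLim_even ha (Nat.lt_succ_iff.1 (Finset.mem_range.1 hl))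
      rw [show 2 * (k + 1) = 2 * k + 2 by ring]
      linear_combination taylorT y (f : Rn n → ℂ) (2 * l) / (areaRatio n : ℂ) * h
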